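/- A *pointed space* is a compactly generated topological space with a nondegenerate base point (the inclusion of the base point is a closed cofibration); maps preserve base points, and $*$ denotes both base points and the one-point space. A *homotopy functor* is a functor from pointed spaces to pointed spaces that preserves weak homotopy equivalences; homotopy functors and natural transformations form a category $\mathcal H$. Mapping spaces and subspaces carry their compactly generated topologies. For a finite set $S$, an *$S$-cube* of pointed spaces is a functor $\mathcal X$ on the poset of subsets of $S$. With $I=[0,1]$, its total homotopy fiber $\operatorname{hofib}\mathcal X$ is the subspace of $\prod_{A\subseteq S}\operatorname{Map}(I^A,\mathcal X(A))$ of all families $(\Phi_A)$ that are natural in $A$ (where $I^A\subseteq I^B$ for $A\subseteq B$ by extending with zeros) and such that $\Phi_A$ sends every point having some coordinate equal to $1$ to the base point. For $n\ge 0$ and $F\in\mathcal H$ let $\perp_nF(X)$ be the total homotopy fiber of the $\{1,\dots,n\}$-cube $V\mapsto F\big(\bigvee_{i\notin V}X\big)$, whose maps for $V\subseteq V'$ are induced by the identity on the copies of $X$ with index $i\notin V'$ and by the map to the base point on those with index $i\in V'$. Let $\varepsilon:\perp_nF(X)\to F(X)$ be the map induced by the fold map $\bigvee_{i=1}^nX\to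 X$, that is, $\varepsilon(\Phi)=F(\mathrm{fold})(\Phi_\emptyset)$. For a finite set $S$ write $U=\{1,\dots,n\}$ and $B_f=\{(s,u)\in S\times U: u\ne f(s)\}$ for $f:S\to U$. The *free $S\times U$-cube* on $X$ is $A\mapsto\bigvee_{f:\,A\subseteq B_f}X$, with maps given by identities of summands and maps to the base point. Let $C(S)=C(S)(F,X)$ be the total homotopy fiber of $F$ applied to this cube. A map $\varphi:S\to T$ induces $C(\varphi):C(T)\to C(S)$, $$(C(\varphi)\Phi)_A(x)=F(j_A)\big(\Phi_{A'}(\varphi_*x)\big),\qquad A'=(\varphi\times 1)(A),\quad (\varphi_*x)_{(t,u)}=\max_{\varphi(s)=t}x_{(s,u)}\ \ (\text{and }0\text{ if there is no such }s),$$ where $j_A:\bigvee_{f:\,A'\subseteq B_f}X\to\bigvee_{g:\,A\subseteq B_g}X$ is the identity from the summand $f$ to the summand $f\circ\varphi$; this makes $C$ a contravariant functor of finite sets $S$, natural in $F$ and $X$. **Theorem.** For every $n$, $\perp_n$ is a cotriple (comonad) on the category $\mathcal H$ of homotopy functors from pointed spaces to pointed spaces, with counit $\varepsilon:\perp_n\to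 1$ the map induced by the fold map $\bigvee X\to X$. In particular, $\perp_nF$ is again a homotopy functor with values in pointed spaces. Moreover, for every $k\ge 0$ there is a homeomorphism $\perp_n^kF(X)\cong C(\{1,\dots,k\})(F,X)$, natural in $F$ and $X$, and these can be chosen so that $\varepsilon:\perp_nF\to F$ corresponds to $C(\emptyset\to\{1\})$ and the comultiplication $\perp_nF\to\perp_n\perp_nF$ corresponds to $C(\{1,2\}\to\{1\})$. -/

import Mathlib

open CategoryTheory Topology
open scoped unitInterval

universe u

namespace CrossEffects

/-! ### Pointed spaces -/

/-- A pointed compactly generated space. -/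
structure PtCG : Type (u + 1) where
  carrier : Type u
  [top : TopologicalSpace carrier]
  [cg : CompactlyGeneratedSpace carrier]
  pt : carrier

attribute [instance] PtCG.top PtCG.cg

/-- A pointed map: a continuous map preserving base points. -/
@[ext]
structure PtCG.Hom (X Y : PtCG.{u}) : Type u where
  map : C(X.carrier, Y.carrier)
  map_pt : map X.pt = Y.pt

instance : Category PtCG.{u} where
  Hom := PtCG.Hom
  id X := ⟨ContinuousMap.id _, rfl⟩
  comp f g := ⟨g.map.comp f.map, by simp [f.map_pt, g.map_pt]⟩

@[ext]
theorem PtCG.hom_ext {X Y : PtCG.{u}} {f g : X ⟶ Y} (h : ∀ x, f.map x = g.map x) : f = g :=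
  PtCG.Hom.ext (ContinuousMap.ext h)

@[simp] theorem PtCG.id_map (X : PtCG.{u}) (x : X.carrier) :
    PtCG.Hom.map (𝟙 X) x = x := rfl

@[simp] theorem PtCG.comp_map {X Y Z : PtCG.{u}} (f : X ⟶ Y) (g : Y ⟶ Z) (x : X.carrier) :
    (f ≫ g).map x = g.map (f.map x) := rfl

@[simp] theorem PtCG.map_base {X Y : PtCG.{u}} (f : X ⟶ Y) : f.map X.pt = Y.pt := f.map_pt

/-- The base point is nondegenerate: its inclusion is a closed cofibration, that is, the base point
is closed and its inclusion has the homotopy extension property. -/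
def nondegenerate : ObjectProperty PtCG.{u} := fun X =>
  IsClosed {X.pt} ∧
    ∀ (Y : Type u) [TopologicalSpace Y] (f : C(X.carrier, Y)) (p : C(I, Y)), p 0 = f X.pt →
      ∃ H : C(X.carrier × I, Y), (∀ x, H (x, 0) = f x) ∧ ∀ t, H (X.pt, t) = p t

/-- The category of pointed spaces: compactly generated spaces with nondegenerate base point, and
pointed maps. -/
abbrev PtSpace : Type (u + 1) := nondegenerate.{u}.FullSubcategory

/-! ### Weak equivalences and homotopy functors -/

/-- The map on generalized loops induced by a continuous map. -/
def mapGenLoop {X Y : Type u} [TopologicalSpace X] [TopologicalSpace Y] (f : C(X, Y)) (k : ℕ)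
    (x : X) (p : GenLoop (Fin k) X x) : GenLoop (Fin k) Y (f x) :=
  ⟨f.comp p.1, fun y hy => congrArg f (p.2 y hy)⟩

/-- The map `π_k(X, x) → π_k(Y, f x)` induced by a continuous map `f : X → Y`. -/
def mapPi {X Y : Type u} [TopologicalSpace X] [TopologicalSpace Y] (f : C(X, Y)) (k : ℕ) (x : X) :
    π_ k X x → π_ k Y (f x) :=
  Quotient.map (mapGenLoop f k x) fun _ _ h => h.comp_continuousMap f

/-- A pointed map is a weak homotopy equivalence if it induces bijections on all homotopy groups
(and on the set `π_0` of path components), at all base points. -/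
def IsWeakEquiv {X Y : PtCG.{u}} (f : X ⟶ Y) : Prop :=
  ∀ (k : ℕ) (x : X.carrier), Function.Bijective (mapPi f.map k x)

/-- A functor from pointed spaces to pointed spaces is a homotopy functor if it preserves weak
homotopy equivalences. -/
def isHomotopyFunctor : ObjectProperty (PtSpace.{u} ⥤ PtSpace.{u}) := fun F =>
  ∀ ⦃X Y : PtSpace.{u}⦄ (f : X ⟶ Y), IsWeakEquiv f.hom → IsWeakEquiv (F.map f).hom

/-- The category of homotopy functors from pointed spaces to pointed spaces, and natural
transformations. -/
abbrev HoFunctor : Type (u + 1) := isHomotopyFunctor.{u}.FullSubcategory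

/-! ### Wedges -/

section Wedge

variable {J : Type} (g : J → PtSpace.{u}) (s : Set J)

/-- The space `g j`. -/
abbrev fam (j : J) : Type u := (g j).obj.carrier

/-- The relation identifying all base points with one extra point. -/
inductive WedgeRel : (PUnit.{u + 1} ⊕ Σ j : s, fam g j) → (PUnit.{u + 1} ⊕ Σ j : s, fam g j) → Prop
  | base (j : s) : WedgeRel (Sum.inl PUnit.unit) (Sum.inr ⟨j, (g j).obj.pt⟩)

/-- The wedge `⋁_{j ∈ s} g j` as a topological space: the quotient of the disjoint union that
identifies all base points (for `s = ∅` it is a point). -/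
def WedgeCarrier : Type u := Quot (WedgeRel g s)

instance : TopologicalSpace (WedgeCarrier g s) := inferInstanceAs (TopologicalSpace (Quot _))

/-- The quotient map. -/
def wedgeMk (a : PUnit.{u + 1} ⊕ Σ j : s, fam g j) : WedgeCarrier g s := Quot.mk _ a

theorem continuous_wedgeMk : Continuous (wedgeMk g s) := continuous_quot_mk

instance : CompactlyGeneratedSpace (WedgeCarrier g s) :=
  uCompactlyGeneratedSpace_of_coinduced (X := PUnit.{u + 1} ⊕ Σ j : s, fam g j)
    (f := wedgeMk g s) (continuous_wedgeMk g s) rfl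

/-- Wedges as pointed compactly generated spaces. -/
def wedgePt : PtCG.{u} := ⟨WedgeCarrier g s, wedgeMk g s (Sum.inl PUnit.unit)⟩

variable {g s}

/-- The continuous map out of a wedge given by continuous maps that agree on base points. -/
def wedgeLift {Y : Type*} [TopologicalSpace Y] (y : Y) (f : ∀ j : s, C(fam g j, Y))
    (hf : ∀ j, f j (g j).obj.pt = y) : C(WedgeCarrier g s, Y) where
  toFun := Quot.lift (Sum.elim (fun _ => y) fun a => f a.1 a.2) (by
    rintro _ _ ⟨j⟩
    exact (hf j).symm)
  continuous_toFun := by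
    refine continuous_quot_lift _ ?_
    refine continuous_const.sumElim ?_
    exact continuous_sigma fun j => (f j).continuous

theorem wedge_nondegenerate : nondegenerate (wedgePt g s) := by
  refine ⟨?_, ?_⟩
  · change IsClosed {wedgeMk g s (Sum.inl PUnit.unit)}
    refine isQuotientMap_quot_mk.isClosed_preimage.1 ?_
    rw [isClosed_sum_iff]
    refine ⟨isClosed_discrete _, isClosed_sigma_iff.2 fun j => ?_⟩
    convert (g j).property.1 using 1
    ext x
    constructor
    · intro hx
      let r : WedgeCarrier g s → Prop := Quot.lift
        (Sum.elim (fun _ => True) fun a => a.2 = (g a.1).obj.pt) (by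
          rintro _ _ ⟨i⟩
          simp)
      have h1 : r (wedgeMk g s (Sum.inr ⟨j, x⟩)) = r (wedgeMk g s (Sum.inl PUnit.unit)) :=
        congrArg r hx
      exact of_eq_true h1
    · rintro rfl
      exact (Quot.sound (WedgeRel.base j)).symm
  · intro Y _ f p hp
    have key : ∀ j : s, ∃ H : C(fam g j × I, Y),
        (∀ x, H (x, 0) = f (wedgeMk g s (Sum.inr ⟨j, x⟩))) ∧ ∀ t, H ((g j).obj.pt, t) = p t := by
      intro j
      refine (g j).property.2 Y
        (f.comp ⟨fun x => wedgeMk g s (Sum.inr ⟨j, x⟩), ?_⟩) p ?_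
      · exact (continuous_wedgeMk g s).comp (continuous_inr.comp continuous_sigmaMk)
      · rw [hp]
        exact congrArg f (Quot.sound (WedgeRel.base j))
    choose H h0 h1 using key
    let K : C(WedgeCarrier g s, C(I, Y)) := wedgeLift p (fun j => (H j).curry) (fun j => by
      ext t
      exact h1 j t)
    refine ⟨K.uncurry, ?_, fun t => rfl⟩
    intro x
    obtain ⟨a, rfl⟩ : ∃ a, wedgeMk g s a = x := Quot.exists_rep x
    rcases a with a | ⟨j, a⟩
    · exact hp
    · exact h0 j a

variable (g s) in
/-- The wedge `⋁_{j ∈ s} g j` in pointed spaces. -/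
def wedge : PtSpace.{u} := ⟨wedgePt g s, wedge_nondegenerate⟩

/-- The inclusion of a summand. -/
def wedgeIncl (j : J) (hj : j ∈ s) : g j ⟶ wedge g s :=
  ObjectProperty.homMk ⟨⟨fun x => wedgeMk g s (Sum.inr ⟨⟨j, hj⟩, x⟩),
    (continuous_wedgeMk g s).comp (continuous_inr.comp continuous_sigmaMk)⟩,
    (Quot.sound (WedgeRel.base (⟨j, hj⟩ : s))).symm⟩

/-- The pointed map out of a wedge with given restrictions to the summands. -/
def wedgeDesc {Y : PtSpace.{u}} (f : ∀ j ∈ s, g j ⟶ Y) : wedge g s ⟶ Y :=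
  ObjectProperty.homMk ⟨wedgeLift Y.obj.pt (fun j => (f j j.2).hom.map) fun j => (f j j.2).hom.map_pt,
    rfl⟩

@[simp] theorem wedgeIncl_desc {Y : PtSpace.{u}} (f : ∀ j ∈ s, g j ⟶ Y) (j : J) (hj : j ∈ s) :
    wedgeIncl j hj ≫ wedgeDesc f = f j hj := rfl

@[simp] theorem wedgeIncl_desc_assoc {Y Z : PtSpace.{u}} (f : ∀ j ∈ s, g j ⟶ Y) (j : J)
    (hj : j ∈ s) (k : Y ⟶ Z) : wedgeIncl j hj ≫ wedgeDesc f ≫ k = f j hj ≫ k := rfl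

theorem wedge_hom_ext {Y : PtSpace.{u}} {a b : wedge g s ⟶ Y}
    (h : ∀ j (hj : j ∈ s), wedgeIncl j hj ≫ a = wedgeIncl j hj ≫ b) : a = b := by
  apply ObjectProperty.hom_ext
  apply PtCG.hom_ext
  intro x
  obtain ⟨x, rfl⟩ : ∃ y, wedgeMk g s y = x := Quot.exists_rep x
  rcases x with x | ⟨j, x⟩
  · exact a.hom.map_pt.trans b.hom.map_pt.symm
  · have := congrArg (fun q => q.hom.map x) (h j j.2)
    exact this

end Wedge

/-- The map to the base point. -/
def zeroMap (X Y : PtSpace.{u}) : X ⟶ Y :=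
  ObjectProperty.homMk ⟨ContinuousMap.const _ Y.obj.pt, rfl⟩

@[simp] theorem zeroMap_comp {X Y Z : PtSpace.{u}} (f : Y ⟶ Z) :
    zeroMap X Y ≫ f = zeroMap X Z := by
  apply ObjectProperty.hom_ext
  apply PtCG.hom_ext
  intro x
  exact f.hom.map_pt

@[simp] theorem comp_zeroMap {X Y Z : PtSpace.{u}} (f : X ⟶ Y) :
    f ≫ zeroMap Y Z = zeroMap X Z := rfl

open Classical in
/-- The map `⋁_{j ∈ s} g j ⟶ ⋁_{j ∈ t} g j` that is the identity of `g j` if `j ∈ t` and the map to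
the base point otherwise. -/
noncomputable def collapseMap {J : Type} (g : J → PtSpace.{u}) (s t : Set J) :
    wedge g s ⟶ wedge g t :=
  wedgeDesc fun j _ => if h : j ∈ t then wedgeIncl j h else zeroMap _ _

/-- The wedges `⋁_{j ∈ s} g j`, as a contravariant functor of `s` (for inclusions of subsets) by the
collapse maps. -/
noncomputable def wedges {J : Type} (g : J → PtSpace.{u}) : (Set J)ᵒᵖ ⥤ PtSpace.{u} where
  obj s := wedge g s.unop
  map {s t} _ := collapseMap g s.unop t.unop
  map_id s := by
    apply wedge_hom_ext
    intro j hj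
    simp [collapseMap, hj]
  map_comp {r s t} a b := by
    apply wedge_hom_ext
    intro j hj
    have hts : t.unop ⊆ s.unop := leOfHom b.unop
    by_cases h : j ∈ t.unop
    · simp [collapseMap, h, hts h]
    · by_cases h' : j ∈ s.unop
      · simp [collapseMap, h, h']
      · simp [collapseMap, h, h']

/-- The map of wedges of copies of `X`, respectively of `Y`, that sends the summand `j` to the
summand `e j` by `f : X ⟶ Y`. -/
def copiesMap {J K : Type} {X Y : PtSpace.{u}} (e : J → K) (f : X ⟶ Y) (s : Set J) (t : Set K)
    (h : ∀ j ∈ s, e j ∈ t) : wedge (fun _ : J => X) s ⟶ wedge (fun _ : K => Y) t :=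
  wedgeDesc fun j hj => f ≫ wedgeIncl (g := fun _ : K => Y) (e j) (h j hj)

/-- The fold map `⋁ X ⟶ X`. -/
def fold {J : Type} (X : PtSpace.{u}) (s : Set J) : wedge (fun _ : J => X) s ⟶ X :=
  wedgeDesc fun _ _ => 𝟙 X

theorem copiesMap_fold {J K : Type} {X Y : PtSpace.{u}} (e : J → K) (f : X ⟶ Y) (s : Set J)
    (t : Set K) (h : ∀ j ∈ s, e j ∈ t) : copiesMap e f s t h ≫ fold Y t = fold X s ≫ f := by
  apply wedge_hom_ext
  intro j hj
  simp [copiesMap, fold]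

theorem copiesMap_comp {J K L : Type} {X Y Z : PtSpace.{u}} (e : J → K) (τ : K → L)
    (f : X ⟶ Y) (f' : Y ⟶ Z) (r : Set J) (s : Set K) (t : Set L)
    (h : ∀ j ∈ r, e j ∈ s) (h' : ∀ j ∈ s, τ j ∈ t) :
    copiesMap e f r s h ≫ copiesMap τ f' s t h' =
      copiesMap (τ ∘ e) (f ≫ f') r t (fun j hj => h' _ (h j hj)) := by
  apply wedge_hom_ext
  intro j hj
  simp [copiesMap]

theorem copiesMap_collapse {J K : Type} {X Y : PtSpace.{u}} (e : J → K) (f : X ⟶ Y)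
    (s s' : Set J) (t t' : Set K) (h : ∀ j ∈ s, e j ∈ t) (h' : ∀ j ∈ s', e j ∈ t')
    (hs : ∀ j ∈ s, e j ∈ t' → j ∈ s') :
    copiesMap e f s t h ≫ collapseMap (fun _ : K => Y) t t' =
      collapseMap (fun _ : J => X) s s' ≫ copiesMap e f s' t' h' := by
  apply wedge_hom_ext
  intro j hj
  by_cases hj' : j ∈ s'
  · simp [copiesMap, collapseMap, hj', h' j hj']
  · have : e j ∉ t' := fun hh => hj' (hs j hj hh)
    simp [copiesMap, collapseMap, hj', this]

/-- The wedges of copies of `X` indexed by the subsets of `J`, functorially in `X`. -/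
noncomputable def copies (J : Type) : PtSpace.{u} ⥤ (Set J)ᵒᵖ ⥤ PtSpace.{u} where
  obj X := wedges fun _ : J => X
  map f :=
    { app := fun s => copiesMap id f s.unop s.unop fun _ hj => hj
      naturality := fun s t a => (copiesMap_collapse id f _ _ _ _ _ _ fun _ _ h => h).symm }
  map_id X := by
    ext s : 2
    apply wedge_hom_ext
    intro j hj
    simp [copiesMap, wedges]
  map_comp f f' := by
    ext s : 2
    exact (copiesMap_comp id id f f' _ _ _ _ _).symm

/-! ### Cubes and their total homotopy fibers -/

/-- An `S`-cube is a functor on the poset of subsets of `S`. -/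
abbrev Cube (S : Type) : Type (u + 1) := Set S ⥤ PtCG.{u}

/-- The cube `I^A` for `A ⊆ S`, realized as the face of `I^S` on which the coordinates outside `A`
vanish. The inclusions `I^A ⊆ I^B` for `A ⊆ B` are then extension by zero. -/
def face {S : Type} (A : Set S) : Set (S → I) := {x | ∀ i ∉ A, x i = 0}

theorem face_mono {S : Type} {A B : Set S} (h : A ⊆ B) {x : S → I} (hx : x ∈ face A) :
    x ∈ face B := fun i hi => hx i fun hA => hi (h hA)

/-- The points of the total homotopy fiber of a cube: families of maps `Φ_A : I^A → X(A)`, natural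
in `A`, that send the points with some coordinate `1` to the base point. -/
def FiberSet {S : Type} (X : Cube.{u} S) : Type u :=
  {Φ : ∀ A : Set S, C(face A, (X.obj A).carrier) //
    (∀ (A B : Set S) (h : A ⟶ B) (x : face A),
      (X.map h).map (Φ A x) = Φ B ⟨x.1, face_mono (leOfHom h) x.2⟩) ∧
    ∀ (A : Set S) (x : face A) (i : S), i ∈ A → x.1 i = 1 → Φ A x = (X.obj A).pt}

instance {S : Type} (X : Cube.{u} S) : TopologicalSpace (FiberSet X) :=
  inferInstanceAs (TopologicalSpace {_Φ : ∀ A : Set S, C(face A, (X.obj A).carrier) // _})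

theorem continuous_fiberSet_apply {S : Type} {X : Cube.{u} S} (A : Set S) :
    Continuous fun Φ : FiberSet X => Φ.1 A :=
  (continuous_apply A).comp continuous_subtype_val

theorem continuous_fiberSet {S : Type} {X : Cube.{u} S} {Y : Type*} [TopologicalSpace Y]
    {f : Y → FiberSet X} (hf : ∀ A, Continuous fun y => (f y).1 A) : Continuous f :=
  continuous_induced_rng.2 (continuous_pi hf)

section CompactlyGenerated

variable {X Y : Type u} [TopologicalSpace X] [TopologicalSpace Y]

theorem compactlyGeneratedSpace_compactlyGenerated (X : Type u) [TopologicalSpace X] :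
    @UCompactlyGeneratedSpace.{u} X (TopologicalSpace.compactlyGenerated.{u} X) := by
  let f : (Σ (i : (S : CompHaus.{u}) × C(S, X)), i.fst) → X := fun a => a.1.2 a.2
  exact @uCompactlyGeneratedSpace_of_coinduced _ _ _
    (TopologicalSpace.compactlyGenerated.{u} X) _ f continuous_coinduced_rng rfl

theorem continuous_id_compactlyGenerated (X : Type u) [t : TopologicalSpace X] :
    Continuous[TopologicalSpace.compactlyGenerated.{u} X, t] id :=
  continuous_from_compactlyGenerated _ fun _ h => h.continuous

/-- A continuous map from a compact Hausdorff space stays continuous for the associated compactly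
generated topology. -/
theorem continuous_to_compactlyGenerated (S : CompHaus.{u}) (k : C(S, X)) :
    Continuous[inferInstance, TopologicalSpace.compactlyGenerated.{u} X] k := by
  let q : (Σ (i : (S : CompHaus.{u}) × C(S, X)), i.fst) → X := fun a => a.1.2 a.2
  have hq : Continuous[inferInstance, TopologicalSpace.compactlyGenerated.{u} X] q :=
    continuous_coinduced_rng
  have hk : Continuous (fun x : S => (⟨⟨S, k⟩, x⟩ :
      Σ (i : (S : CompHaus.{u}) × C(S, X)), i.fst)) :=
    @continuous_sigmaMk _ (fun i : (S : CompHaus.{u}) × C(S, X) => i.fst) _ ⟨S, k⟩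
  exact @Continuous.comp S _ X _ _ (TopologicalSpace.compactlyGenerated.{u} X) _ q hq hk

/-- A continuous map stays continuous for the associated compactly generated topologies. -/
theorem continuous_compactlyGenerated (f : X → Y) (hf : Continuous f) :
    Continuous[TopologicalSpace.compactlyGenerated.{u} X,
      TopologicalSpace.compactlyGenerated.{u} Y] f :=
  @continuous_from_compactlyGenerated _ _ _ (TopologicalSpace.compactlyGenerated.{u} Y) f
    fun S h => continuous_to_compactlyGenerated S ⟨f ∘ h, hf.comp h.continuous⟩

end CompactlyGenerated

/-- The total homotopy fiber of a cube, with the compactly generated topology associated to the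
subspace topology from the product of the mapping spaces. -/
def totalFiber {S : Type} (X : Cube.{u} S) : PtCG.{u} :=
  @PtCG.mk (FiberSet X) (TopologicalSpace.compactlyGenerated.{u} (FiberSet X))
    (compactlyGeneratedSpace_compactlyGenerated _)
    ⟨fun A => ContinuousMap.const _ (X.obj A).pt, fun _ _ h _ => (X.map h).map_pt,
      fun _ _ _ _ _ => rfl⟩

/-- A continuous pointed map of the underlying sets, as a map of total homotopy fibers. -/
def totalFiberHom {S T : Type} {X : Cube.{u} S} {Y : Cube.{u} T} (f : FiberSet X → FiberSet Y)
    (hf : Continuous f) (h : f (totalFiber X).pt = (totalFiber Y).pt) :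
    totalFiber X ⟶ totalFiber Y :=
  ⟨@ContinuousMap.mk _ _ (_) (_) f (continuous_compactlyGenerated f hf), h⟩

/-- The map of total homotopy fibers induced by a map of cubes. -/
def totalFiberMap {S : Type} {X Y : Cube.{u} S} (α : X ⟶ Y) : totalFiber X ⟶ totalFiber Y :=
  totalFiberHom
    (fun Φ => ⟨fun A => (α.app A).map.comp (Φ.1 A), by
      refine ⟨fun A B h x => ?_, fun A x i hi hx => ?_⟩
      · have h1 := congrArg (fun q => q.map (Φ.1 A x)) (α.naturality h)
        have h2 := Φ.2.1 A B h x
        simp only [PtCG.comp_map] at h1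
        simp only [ContinuousMap.comp_apply]
        rw [← h1, h2]
      · simp [Φ.2.2 A x i hi hx]⟩)
    (continuous_fiberSet fun A => (ContinuousMap.continuous_postcomp _).comp
      (continuous_fiberSet_apply A))
    (Subtype.ext (funext fun A => ContinuousMap.ext fun _ => (α.app A).map_pt))

/-- The total homotopy fiber as a functor of the cube. -/
def totalFiberFunctor (S : Type) : Cube.{u} S ⥤ PtCG.{u} where
  obj := totalFiber
  map := totalFiberMap

/-- The map of cubes `I^P → I^Q` induced by a map `φ : P → Q` of finite sets: the coordinate `q` of
the image of `x` is the maximum of the `x p` with `φ p = q` (and `0` if there is no such `p`). -/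
noncomputable def pushCoord {P Q : Type} [Finite P] (φ : P → Q) (x : P → I) (q : Q) : I := by
  classical
  letI := Fintype.ofFinite P
  exact (Finset.univ.filter fun p => φ p = q).sup x

theorem pushCoord_le_iff {P Q : Type} [Finite P] (φ : P → Q) (x : P → I) (q : Q) (c : I) :
    pushCoord φ x q ≤ c ↔ ∀ p, φ p = q → x p ≤ c := by
  simp [pushCoord, Finset.sup_le_iff]

theorem continuous_pushCoord {P Q : Type} [Finite P] (φ : P → Q) :
    Continuous (pushCoord φ) := by
  refine continuous_pi fun q => ?_
  unfold pushCoord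
  exact Continuous.finset_sup_apply fun p _ => continuous_apply p

theorem pushCoord_id {P : Type} [Finite P] (x : P → I) : pushCoord id x = x := by
  funext q
  refine eq_of_forall_ge_iff fun c => ?_
  simp [pushCoord_le_iff]

theorem pushCoord_comp {P Q R : Type} [Finite P] [Finite Q] (φ : P → Q) (ψ : Q → R) (x : P → I) :
    pushCoord ψ (pushCoord φ x) = pushCoord (ψ ∘ φ) x := by
  funext r
  refine eq_of_forall_ge_iff fun c => ?_
  simp only [pushCoord_le_iff, Function.comp_apply]
  constructor
  · intro h p hp
    exact h _ hp p rfl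
  · rintro h q hq p rfl
    exact h p hq

theorem pushCoord_mem_face {P Q : Type} [Finite P] (φ : P → Q) {A : Set P} {x : P → I}
    (hx : x ∈ face A) : pushCoord φ x ∈ face (φ '' A) := by
  intro q hq
  refine le_antisymm ((pushCoord_le_iff φ x q 0).2 fun p hp => ?_) unitInterval.nonneg'
  exact (hx p fun hA => hq ⟨p, hA, hp⟩).le

/-- The functor on posets of subsets given by the image under a map. -/
def imageFunctor {P Q : Type} (φ : P → Q) : Set P ⥤ Set Q where
  obj A := φ '' A
  map h := homOfLE (Set.image_mono (leOfHom h))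

/-- The map of total homotopy fibers induced by the map `φ` of indexing sets, from the total homotopy
fiber of a `Q`-cube to that of the `P`-cube obtained by precomposition with `A ↦ φ(A)`. -/
noncomputable def pullFiber {P Q : Type} [Finite P] (φ : P → Q) (X : Cube.{u} Q) :
    totalFiber X ⟶ totalFiber (imageFunctor φ ⋙ X) :=
  totalFiberHom
    (fun Φ => ⟨fun A => (Φ.1 (φ '' A)).comp
        ⟨fun x => ⟨pushCoord φ x.1, pushCoord_mem_face φ x.2⟩,
          ((continuous_pushCoord φ).comp continuous_subtype_val).subtype_mk _⟩, by
      refine ⟨fun A B h x => ?_, fun A x i hi hx => ?_⟩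
      · exact Φ.2.1 _ _ ((imageFunctor φ).map h) _
      · refine Φ.2.2 _ _ (φ i) ⟨i, hi, rfl⟩ ?_
        refine le_antisymm unitInterval.le_one' ?_
        rw [← hx]
        exact (pushCoord_le_iff φ x.1 (φ i) _).1 le_rfl i rfl⟩)
    (continuous_fiberSet fun A => (ContinuousMap.continuous_precomp _).comp
      (continuous_fiberSet_apply _))
    rfl

/-! ### Cross effects -/

/-- The inclusion of pointed spaces into pointed compactly generated spaces. -/
abbrev inclPt : PtSpace.{u} ⥤ PtCG.{u} := nondegenerate.ι

/-- A homotopy functor, regarded as a functor to pointed compactly generated spaces. -/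
abbrev forgetHo : HoFunctor.{u} ⥤ PtSpace.{u} ⥤ PtCG.{u} :=
  isHomotopyFunctor.ι ⋙ (Functor.whiskeringRight _ _ _).obj inclPt

/-- The functor taking a subset to its complement. -/
def complFunctor (S : Type) : Set S ⥤ (Set S)ᵒᵖ where
  obj V := Opposite.op Vᶜ
  map h := (homOfLE (Set.compl_subset_compl.2 (leOfHom h))).op

/-- The cross-effect cube: its vertex at `V` is `F (⋁_{i ∉ V} X i)`, and its maps are induced by the
identity of `X i` if `i` is outside the larger set, and by the map to the base point otherwise. -/
noncomputable def crossEffectCube {n : ℕ} (F : PtSpace.{u} ⥤ PtSpace.{u}) (X : Fin n → PtSpace.{u}) :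
    Cube.{u} (Fin n) :=
  complFunctor (Fin n) ⋙ wedges X ⋙ F ⋙ inclPt

/-- The `n`-th cross effect `cr_n F (X_1, …, X_n)`. -/
noncomputable def crossEffect {n : ℕ} (F : PtSpace.{u} ⥤ PtSpace.{u}) (X : Fin n → PtSpace.{u}) :
    PtCG.{u} :=
  totalFiber (crossEffectCube F X)

/-- For a functor `D` from subsets of `S` to subsets of `J`, the total homotopy fiber of the `S`-cube
`A ↦ F (⋁_{j ∈ D A} X)`, functorially in `F` and `X`. -/
noncomputable def fiberOfCopies {S J : Type} (D : Set S ⥤ (Set J)ᵒᵖ) :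
    HoFunctor.{u} ⥤ PtSpace.{u} ⥤ PtCG.{u} where
  obj F := copies J ⋙ (Functor.whiskeringLeft _ _ _).obj D ⋙
    (Functor.whiskeringRight _ _ _).obj (F.obj ⋙ inclPt) ⋙ totalFiberFunctor S
  map α := Functor.whiskerLeft (copies J ⋙ (Functor.whiskeringLeft _ _ _).obj D)
    (Functor.whiskerRight ((Functor.whiskeringRight _ _ _).map (Functor.whiskerRight α.hom inclPt))
      (totalFiberFunctor S))

theorem fiberOfCopies_obj_obj {S J : Type} (D : Set S ⥤ (Set J)ᵒᵖ) (F : HoFunctor.{u})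
    (X : PtSpace.{u}) : ((fiberOfCopies D).obj F).obj X =
      totalFiber (D ⋙ (wedges fun _ : J => X) ⋙ F.obj ⋙ inclPt) := rfl

/-- The diagonal cross effect `⊥_n F (X) = cr_n F (X, …, X)`, as a functor of `F` and `X`. -/
noncomputable def perp (n : ℕ) : HoFunctor.{u} ⥤ PtSpace.{u} ⥤ PtCG.{u} :=
  fiberOfCopies (complFunctor (Fin n))

theorem perp_obj_obj (n : ℕ) (F : HoFunctor.{u}) (X : PtSpace.{u}) :
    ((perp n).obj F).obj X = crossEffect F.obj fun _ : Fin n => X := rfl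

theorem fiberOfCopies_obj_map {S J : Type} (D : Set S ⥤ (Set J)ᵒᵖ) (F : HoFunctor.{u})
    {X Y : PtSpace.{u}} (f : X ⟶ Y) (Φ : (((fiberOfCopies D).obj F).obj X).carrier) (A : Set S)
    (x : face A) : ((((fiberOfCopies D).obj F).map f).map Φ).1 A x =
      (F.obj.map (copiesMap id f (D.obj A).unop (D.obj A).unop fun _ h => h)).hom.map (Φ.1 A x) :=
  rfl

theorem fiberOfCopies_map_app {S J : Type} (D : Set S ⥤ (Set J)ᵒᵖ) {F G : HoFunctor.{u}}
    (α : F ⟶ G) (X : PtSpace.{u}) (Φ : (((fiberOfCopies D).obj F).obj X).carrier) (A : Set S)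
    (x : face A) : ((((fiberOfCopies D).map α).app X).map Φ).1 A x =
      (α.hom.app (wedge (fun _ : J => X) (D.obj A).unop)).hom.map (Φ.1 A x) :=
  rfl

/-- The point `0` of `I^A`. -/
def faceZero {S : Type} (A : Set S) : face A := ⟨fun _ => 0, fun _ _ => rfl⟩

theorem continuous_totalFiber {S : Type} {X : Cube.{u} S} {Y : Type*} [TopologicalSpace Y]
    {f : FiberSet X → Y} (hf : Continuous f) : Continuous[(totalFiber X).top, inferInstance] f :=
  @Continuous.comp (FiberSet X) (FiberSet X) Y (TopologicalSpace.compactlyGenerated.{u} _) _ _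
    id f hf (continuous_id_compactlyGenerated (FiberSet X))

/-- The projection of the total homotopy fiber of a cube to the initial vertex: since `I^∅` is a
point, `Φ ↦ Φ_∅`. -/
def toInitial {S : Type} (X : Cube.{u} S) : totalFiber X ⟶ X.obj ∅ :=
  ⟨@ContinuousMap.mk _ _ (totalFiber X).top (X.obj ∅).top
    (fun Φ : FiberSet X => Φ.1 ∅ (faceZero ∅))
    (continuous_totalFiber
      ((continuous_eval_const (faceZero ∅)).comp (continuous_fiberSet_apply ∅))), rfl⟩

/-- The map `ε : ⊥_n F (X) ⟶ F (X)`: the map of total homotopy fibers, induced by the fold map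
`⋁ X ⟶ X` on the initial vertex, from the cross-effect cube to the cube whose initial vertex is
`F (X)` and whose other vertices are points (the total homotopy fiber of the latter is `F (X)`). -/
noncomputable def counit (n : ℕ) : perp.{u} n ⟶ forgetHo where
  app F :=
    { app := fun X => toInitial (crossEffectCube F.obj fun _ : Fin n => X) ≫
        (F.obj.map (fold X (∅ : Set (Fin n))ᶜ)).hom
      naturality := fun X Y f => by
        apply PtCG.hom_ext
        intro Φ
        have h := congrArg F.obj.map
          (copiesMap_fold id f (∅ : Set (Fin n))ᶜ (∅ : Set (Fin n))ᶜ fun _ h => h)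
        rw [F.obj.map_comp, F.obj.map_comp] at h
        exact congrArg (fun q => q.hom.map (Φ.1 ∅ (faceZero ∅))) h }
  naturality F G α := by
    ext X : 2
    apply PtCG.hom_ext
    intro Φ
    have h := congrArg (fun q => q.hom.map (Φ.1 ∅ (faceZero ∅)))
      (α.hom.naturality (fold X (∅ : Set (Fin n))ᶜ))
    exact h.symm

/-! ### Free cubes -/

/-- For `f : S → U`, the set `B_f = {(s, u) | u ≠ f s}`. -/
def diagB {S U : Type} (f : S → U) : Set (S × U) := {p | p.2 ≠ f p.1}

/-- The set of those `f : S → U` with `A ⊆ B_f`. -/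
def freeSet {S U : Type} (A : Set (S × U)) : Set (S → U) := {f | A ⊆ diagB f}

/-- The functor taking `A ⊆ S × U` to the set of those `f : S → U` with `A ⊆ B_f`. -/
def freeIndex (S U : Type) : Set (S × U) ⥤ (Set (S → U))ᵒᵖ where
  obj A := Opposite.op (freeSet A)
  map h := (homOfLE fun _ hf => (leOfHom h).trans hf).op

/-- The free cube on the family `g`: its vertex at `A ⊆ S × U` is the wedge of the `g f` over the
functions `f : S → U` with `A ⊆ B_f`, and its maps are induced by the identity maps of the `g f` and
by maps to the base point. -/
noncomputable def freeCube (S U : Type) (g : (S → U) → PtSpace.{u}) : Set (S × U) ⥤ PtSpace.{u} :=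
  freeIndex S U ⋙ wedges g

/-- `C(S)`: the total homotopy fiber of `F` applied to the free cube with constant value `X`,
functorially in `F` and `X`. -/
noncomputable def freeFiber (n : ℕ) (S : Type) : HoFunctor.{u} ⥤ PtSpace.{u} ⥤ PtCG.{u} :=
  fiberOfCopies (freeIndex S (Fin n))

theorem freeFiber_obj_obj (n : ℕ) (S : Type) (F : HoFunctor.{u}) (X : PtSpace.{u}) :
    ((freeFiber n S).obj F).obj X =
      totalFiber (freeCube S (Fin n) (fun _ => X) ⋙ F.obj ⋙ inclPt) := rfl

theorem freeSet_comp {S T U : Type} (φ : S → T) (A : Set (S × U)) :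
    ∀ f ∈ freeSet (Prod.map φ id '' A), f ∘ φ ∈ freeSet A :=
  fun _ hf _ hp => hf (Set.mem_image_of_mem _ hp)

/-- For `φ : S → T`, the map of free cubes from the pullback along `φ` of the free `T × U`-cube on
`X` to the free `S × U`-cube on `X`, the identity from the summand `f` to the summand `f ∘ φ`. -/
noncomputable def freeCubeMap {S T : Type} (U : Type) (φ : S → T) (X : PtSpace.{u}) :
    imageFunctor (Prod.map φ id) ⋙ freeCube T U (fun _ => X) ⟶ freeCube S U fun _ => X where
  app A := copiesMap (fun f : T → U => f ∘ φ) (𝟙 X) (freeSet (Prod.map φ id '' A)) (freeSet A) (freeSet_comp φ A)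
  naturality A B h := by
    refine (copiesMap_collapse _ _ _ _ _ _ _ _ ?_).symm
    rintro f - hf _ ⟨_, hp, rfl⟩
    exact hf hp

theorem totalFiber_hom_ext {S : Type} {X : Cube.{u} S} {Y : PtCG.{u}} {f g : Y ⟶ totalFiber X}
    (h : ∀ (y : Y.carrier) (A : Set S) (x : face A), (f.map y).1 A x = (g.map y).1 A x) : f = g :=
  PtCG.hom_ext fun y => Subtype.ext (funext fun A => ContinuousMap.ext fun x => h y A x)

/-- The map `C(T) ⟶ C(S)` induced by `φ : S → T`. -/
noncomputable def freeFiberMap (n : ℕ) {S T : Type} [Finite S] (φ : S → T) :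
    freeFiber.{u} n T ⟶ freeFiber.{u} n S where
  app F :=
    { app := fun X =>
        pullFiber (Prod.map φ id) (freeCube T (Fin n) (fun _ => X) ⋙ F.obj ⋙ inclPt) ≫
          totalFiberMap (Functor.whiskerRight (freeCubeMap (Fin n) φ X) (F.obj ⋙ inclPt))
      naturality := fun X Y f => by
        refine totalFiber_hom_ext (S := S × Fin n) fun Φ A x => ?_
        have h := congrArg F.obj.map
          ((copiesMap_comp id (fun g : T → Fin n => g ∘ φ) f (𝟙 Y) _ (freeSet (Prod.map φ id '' A)) (freeSet A)
            (fun _ h => h) (freeSet_comp φ A)).trans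
          (copiesMap_comp (fun g : T → Fin n => g ∘ φ) id (𝟙 X) f (freeSet (Prod.map φ id '' A)) (freeSet A) _
            (freeSet_comp φ A) (fun _ h => h)).symm)
        rw [F.obj.map_comp, F.obj.map_comp] at h
        exact congrArg (fun q => q.hom.map (Φ.1 (Prod.map φ id '' A)
          ⟨pushCoord (Prod.map φ id) x.1, pushCoord_mem_face _ x.2⟩)) h }
  naturality F G α := by
    ext X : 2
    refine totalFiber_hom_ext (S := S × Fin n) fun Φ A x => ?_
    have h := α.hom.naturality
      (copiesMap (fun g : T → Fin n => g ∘ φ) (𝟙 X) (freeSet (Prod.map φ id '' A)) (freeSet A) (freeSet_comp φ A))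
    exact congrArg (fun q => q.hom.map (Φ.1 (Prod.map φ id '' A)
      ⟨pushCoord (Prod.map φ id) x.1, pushCoord_mem_face _ x.2⟩)) h.symm

theorem freeFiberMap_apply (n : ℕ) {S T : Type} [Finite S] (φ : S → T) (F : HoFunctor.{u})
    (X : PtSpace.{u}) (Φ : (((freeFiber n T).obj F).obj X).carrier) (A : Set (S × Fin n))
    (x : face A) : ((((freeFiberMap n φ).app F).app X).map Φ).1 A x =
      (F.obj.map (copiesMap (fun g : T → Fin n => g ∘ φ) (𝟙 X) _ _
        (freeSet_comp φ A))).hom.map (Φ.1 (Prod.map φ id '' A)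
          ⟨pushCoord (Prod.map φ id) x.1, pushCoord_mem_face _ x.2⟩) := rfl

theorem freeFiber_natural (n : ℕ) {S : Type} (F : HoFunctor.{u}) (X : PtSpace.{u})
    (Φ : (((freeFiber n S).obj F).obj X).carrier) {A B : Set (S × Fin n)} (h : A ⊆ B)
    (x y : S × Fin n → I) (hx : x ∈ face A) (hy : y ∈ face B) (hxy : x = y) :
    Φ.1 B ⟨y, hy⟩ = (F.obj.map (collapseMap (fun _ => X) (freeSet A)
      (freeSet B))).hom.map (Φ.1 A ⟨x, hx⟩) := by
  subst hxy
  exact (Φ.2.1 A B (homOfLE h) ⟨x, hx⟩).symm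

theorem freeFiberMap_id (n : ℕ) (S : Type) [Finite S] :
    freeFiberMap.{u} n (id : S → S) = 𝟙 (freeFiber n S) := by
  ext F : 2
  ext X : 2
  refine totalFiber_hom_ext (S := S × Fin n) fun Φ A x => ?_
  have hA : A ⊆ Prod.map id id '' A := by simp
  have h := freeFiber_natural n F X Φ hA x.1 (pushCoord (Prod.map id id) x.1) x.2
    (pushCoord_mem_face _ x.2) (by rw [Prod.map_id, pushCoord_id])
  refine (freeFiberMap_apply n id F X Φ A x).trans ((congrArg _ h).trans ?_)
  have h' : collapseMap (fun _ => X) (freeSet A) (freeSet (Prod.map id id '' A)) ≫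
      copiesMap (fun g : S → Fin n => g ∘ id) (𝟙 X) (freeSet (Prod.map id id '' A)) (freeSet A) (freeSet_comp id A) = 𝟙 _ := by
    apply wedge_hom_ext
    intro j hj
    have hj' : j ∈ (freeSet (Prod.map id id '' A)) := by simpa using hj
    simp only [collapseMap, wedgeIncl_desc_assoc, dif_pos hj', copiesMap, wedgeIncl_desc,
      Category.comp_id, Category.id_comp]
    rfl
  have h'' := congrArg F.obj.map h'
  rw [F.obj.map_comp, F.obj.map_id] at h''
  exact congrArg (fun q => q.hom.map (Φ.1 A x)) h''

theorem freeFiberMap_comp (n : ℕ) {R S T : Type} [Finite R] [Finite S] (φ : R → S) (ψ : S → T) :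
    freeFiberMap.{u} n (ψ ∘ φ) = freeFiberMap n ψ ≫ freeFiberMap n φ := by
  ext F : 2
  ext X : 2
  refine totalFiber_hom_ext (S := R × Fin n) fun Φ A x => ?_
  have hA : Prod.map (ψ ∘ φ) id '' A ⊆ Prod.map ψ id '' (Prod.map φ id '' A) := by
    rw [← Set.image_comp]
    rfl
  have h := freeFiber_natural n F X Φ hA (pushCoord (Prod.map (ψ ∘ φ) id) x.1)
    (pushCoord (Prod.map ψ id) (pushCoord (Prod.map φ id) x.1)) (pushCoord_mem_face _ x.2)
    (pushCoord_mem_face _ (pushCoord_mem_face _ x.2)) (by rw [pushCoord_comp]; rfl)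
  have h' : collapseMap (fun _ => X) (freeSet (Prod.map (ψ ∘ φ) id '' A))
      (freeSet (Prod.map ψ id '' (Prod.map φ id '' A))) ≫
      (copiesMap (fun g : T → Fin n => g ∘ ψ) (𝟙 X) (freeSet (Prod.map ψ id '' (Prod.map φ id '' A)))
        (freeSet (Prod.map φ id '' A)) (freeSet_comp ψ _) ≫
      copiesMap (fun g : S → Fin n => g ∘ φ) (𝟙 X) (freeSet (Prod.map φ id '' A)) (freeSet A) (freeSet_comp φ A)) =
      copiesMap (fun g : T → Fin n => g ∘ (ψ ∘ φ)) (𝟙 X) (freeSet (Prod.map (ψ ∘ φ) id '' A)) (freeSet A) (freeSet_comp (ψ ∘ φ) A) := by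
    apply wedge_hom_ext
    intro j hj
    have hj' : j ∈ (freeSet (Prod.map ψ id '' (Prod.map φ id '' A))) := by
      have : Prod.map ψ id '' (Prod.map φ id '' A) = Prod.map (ψ ∘ φ) id '' A := by
        rw [← Set.image_comp]
        rfl
      simpa [this] using hj
    simp only [collapseMap, wedgeIncl_desc_assoc, dif_pos hj', copiesMap, wedgeIncl_desc,
      Category.id_comp]
    rfl
  have h'' := congrArg F.obj.map h'
  rw [F.obj.map_comp, F.obj.map_comp] at h''
  refine (freeFiberMap_apply n (ψ ∘ φ) F X Φ A x).trans ?_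
  refine (congrArg (fun q => q.hom.map (Φ.1 (Prod.map (ψ ∘ φ) id '' A)
    ⟨pushCoord (Prod.map (ψ ∘ φ) id) x.1, pushCoord_mem_face _ x.2⟩)) h''.symm).trans ?_
  exact (congrArg (fun z => (F.obj.map (copiesMap (fun g : S → Fin n => g ∘ φ) (𝟙 X)
    (freeSet (Prod.map φ id '' A)) (freeSet A) (freeSet_comp φ A))).hom.map
      ((F.obj.map (copiesMap (fun g : T → Fin n => g ∘ ψ) (𝟙 X)
        (freeSet (Prod.map ψ id '' (Prod.map φ id '' A)))
        (freeSet (Prod.map φ id '' A)) (freeSet_comp ψ _))).hom.map z)) h).symm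

/-- The contravariant functor `C` on finite sets. -/
noncomputable def freeFunctor (n : ℕ) :
    FintypeCat.{0}ᵒᵖ ⥤ HoFunctor.{u} ⥤ PtSpace.{u} ⥤ PtCG.{u} where
  obj S := freeFiber n S.unop
  map φ := freeFiberMap n φ.unop
  map_id S := freeFiberMap_id n S.unop
  map_comp φ ψ := freeFiberMap_comp n ψ.unop φ.unop

/-- The iterates of an endofunctor, with `iterate G (k + 1) = G ∘ iterate G k`. -/
def iterate {C : Type*} [Category C] (G : C ⥤ C) : ℕ → (C ⥤ C)
  | 0 => 𝟭 C
  | k + 1 => iterate G k ⋙ G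

/-- The finite set with `k` elements. -/
abbrev finSet (k : ℕ) : FintypeCat.{0} := FintypeCat.of (Fin k)

end CrossEffects

/-!
The theorem has two parts: that `⊥_n` preserves homotopy functors, and the combinatorics of its
comonad structure.

**Homotopy functors.** Weak homotopy equivalences are handled through the compression property
`Compresses`: a map `f : X → Y` is a weak equivalence if and only if every map of pairs from
`(I^m, ∂I^m)` to `f` can be deformed, relative to `∂I^m`, to one that lifts to `X`
(`isWeakEquiv_iff_compresses`). This form needs no base points. That `⊥_n F` preserves weak
equivalences follows from three facts.

* A finite wedge of weak equivalences between spaces with nondegenerate base points is a weak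
  equivalence (`compresses_wedgeMap`). The wedge is replaced by the homotopy equivalent whiskered
  wedge, in which the summands are attached to the ends of the legs of a star. This is covered by
  the open sets where one leg coordinate is nonzero and the open set where no coordinate is `1`;
  over these sets and their intersections the map is up to homotopy one of the summands, or a map
  of contractible spaces. Compression over the intersections of the members of an open cover
  implies compression, by subdividing the cube into a fine grid (`compresses_of_openCover`).
* `F` preserves weak equivalences.
* Total homotopy fibers preserve weak equivalences and nondegenerate base points. A total homotopy
  fiber can be formed in some of the directions first (`iteratedIso`), so cubes of dimension one
  suffice (`totalFiber_induction`). For these the points are pairs of a point and a path. A lifting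
  problem is solved first for the points and then for the paths (`compresses_hofib`), and the
  inclusion of the base point is a composite of two cofibrations with explicit deformations
  (`nondegenerate_hofib`).

**Comonad structure.** The comultiplication takes `Φ` to the family with values
`F(d) (Φ_{A ∪ B} (max x y))`, where `d : ⋁_{i ∉ A ∪ B} X → ⋁_{i ∉ B} ⋁_{i ∉ A} X` is the identity
from the summand `i` to the summand `(i, i)`. Both sides of each law are images under `F` of values
of `Φ`; by naturality of `Φ` and functoriality of `F` it suffices that these are taken at the same
point and along the same map of wedges (`map_fiber_congr`). The laws thus reduce to the fact that
`∪` and `max` are associative with units `∅` and `0`, and the diagonal is coassociative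
(`perpComonad`).

**Free cubes.** A function on `k + 1` points is its value at `0` and a function on `k` points, so
the free cube for `k + 1` points consists of the free cubes for `k` points on the vertices of the
cross-effect cube (`splitWedge`). With `iteratedIso` this identifies the total homotopy fiber for
`k + 1` points with one more cross effect (`freeFiberSucc`), and `iteratePerpIso` follows by
induction. The counit and the comultiplication are compared with the maps induced by `∅ → {1}` and
`{1, 2} → {1}` in `iteratePerpIso_counit` and `iteratePerpIso_comult`, once more by
`map_fiber_congr`.
-/

namespace CrossEffects

/-! ### Filling open boxes in cubes -/

section Filling

/-- Two functions that are continuous on closed sets and agree on the intersection can be glued. -/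
theorem exists_glue {α β : Type*} [TopologicalSpace α] [TopologicalSpace β] {A B : Set α}
    (hA : IsClosed A) (hB : IsClosed B) {f g : α → β} (hf : ContinuousOn f A)
    (hg : ContinuousOn g B) (h : ∀ x ∈ A, x ∈ B → f x = g x) :
    ∃ k : α → β, ContinuousOn k (A ∪ B) ∧ (∀ x ∈ A, k x = f x) ∧ ∀ x ∈ B, k x = g x := by
  classical
  have h1 : ∀ x ∈ A, A.piecewise f g x = f x := fun x hx => Set.piecewise_eq_of_mem _ _ _ hx
  have h2 : ∀ x ∈ B, A.piecewise f g x = g x := fun x hx => by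
    by_cases hxA : x ∈ A
    · rw [h1 x hxA, h x hxA hx]
    · exact Set.piecewise_eq_of_notMem _ _ _ hxA
  exact ⟨A.piecewise f g, (hf.congr h1).union_of_isClosed (hg.congr h2) hA hB, h1, h2⟩

theorem isClosed_boundary (ι : Type*) [Finite ι] : IsClosed (Cube.boundary ι) := by
  have : Cube.boundary ι = ⋃ i, ({y | y i = 0} ∪ {y | y i = 1}) := by
    ext y; simp [Cube.boundary]
  rw [this]
  refine isClosed_iUnion_of_finite fun i => ?_
  exact (isClosed_eq (continuous_apply i) continuous_const).union
    (isClosed_eq (continuous_apply i) continuous_const)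

/-- The open box `∂I^ι × I ∪ I^ι × {0}` is a retract of `I^ι × I`. -/
theorem exists_box_retraction (ι : Type*) [Fintype ι] :
    ∃ r : (ι → I) × I → (ι → I) × I, Continuous r ∧
      (∀ p, (r p).1 ∈ Cube.boundary ι ∨ (r p).2 = 0) ∧
      ∀ p : (ι → I) × I, (p.1 ∈ Cube.boundary ι ∨ p.2 = 0) → r p = p := by
  -- Rescale the cube to `[-1, 1]^ι` and project radially from the point `(0, 2)`: the ray through
  -- `(v, t)` leaves the box at `(c v, 2 - c (2 - t))`, where `c = 1 / max ‖v‖ ((2 - t) / 2)`.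
  let v : (ι → I) × I → ι → ℝ := fun p i => 2 * (p.1 i : ℝ) - 1
  let M : (ι → I) × I → ℝ := fun p => max ‖v p‖ ((2 - (p.2 : ℝ)) / 2)
  have hv : Continuous v := by fun_prop
  have hM : Continuous M := by fun_prop
  have hMpos : ∀ p, 0 < M p := fun p =>
    lt_of_lt_of_le (by have := p.2.2.2; linarith) (le_max_right _ _)
  have hv1 : ∀ p i, |v p i| ≤ 1 := fun p i => by
    have h0 := (p.1 i).2.1
    have h1 := (p.1 i).2.2
    rw [abs_le]; constructor <;> simp only [v] <;> linarith
  refine ⟨fun p => (fun i => Set.projIcc 0 1 zero_le_one (((M p)⁻¹ * v p i + 1) / 2),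
    Set.projIcc 0 1 zero_le_one (2 - (M p)⁻¹ * (2 - p.2))), ?_, ?_, ?_⟩
  · have hMi : Continuous fun p => (M p)⁻¹ := hM.inv₀ fun p => (hMpos p).ne'
    refine Continuous.prodMk (continuous_pi fun i => continuous_projIcc.comp ?_)
      (continuous_projIcc.comp ?_)
    · have : Continuous fun p => v p i := (continuous_apply i).comp hv
      fun_prop
    · fun_prop
  · intro p
    rcases le_total ((2 - (p.2 : ℝ)) / 2) ‖v p‖ with h | h
    · left
      have hMp : M p = ‖v p‖ := max_eq_left h
      have hpos : 0 < ‖v p‖ := hMp ▸ hMpos p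
      obtain ⟨i, hi⟩ : ∃ i, ‖v p i‖ = ‖v p‖ := by
        by_contra hcon
        have : ‖v p‖ < ‖v p‖ := (pi_norm_lt_iff hpos).2 fun i =>
          lt_of_le_of_ne (norm_le_pi_norm _ _) fun h' => hcon ⟨i, h'⟩
        exact lt_irrefl _ this
      refine ⟨i, ?_⟩
      rw [Real.norm_eq_abs] at hi
      rcases abs_choice (v p i) with h' | h'
      · right
        have : v p i = M p := by rw [hMp, ← hi, h']
        simp only [this, inv_mul_cancel₀ (hMpos p).ne']
        norm_num
      · left
        have : v p i = - M p := by rw [hMp, ← hi, h']; ring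
        have h2 : (M p)⁻¹ * v p i = -1 := by
          rw [this, mul_neg, inv_mul_cancel₀ (hMpos p).ne']
        simp only [h2]
        norm_num
    · right
      have hMp : M p = (2 - (p.2 : ℝ)) / 2 := max_eq_right h
      have h2 : (M p)⁻¹ * (2 - (p.2 : ℝ)) = 2 := by
        rw [inv_mul_eq_div, div_eq_iff (hMpos p).ne', hMp]; ring
      simp only [h2]
      norm_num
  · intro p hp
    have hnorm : ‖v p‖ ≤ 1 := (pi_norm_le_iff_of_nonneg zero_le_one).2 fun i => hv1 p i
    have hMp : M p = 1 := by
      rcases hp with ⟨i, hi⟩ | h0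
      · have : |v p i| = 1 := by
          rcases hi with hi | hi <;> simp [v, hi]; norm_num
        have h1 : ‖v p‖ = 1 := le_antisymm hnorm (by
          rw [← this]; exact norm_le_pi_norm (v p) i)
        have := p.2.2.1
        simp only [M, h1]
        exact max_eq_left (by linarith)
      · simp only [M, h0]
        rw [max_eq_right] <;> simp [hnorm]
    refine Prod.ext (funext fun i => ?_) ?_
    · simp only [hMp, v]
      have : ((1 : ℝ)⁻¹ * (2 * (p.1 i : ℝ) - 1) + 1) / 2 = p.1 i := by ring
      rw [this, Set.projIcc_val]
    · simp only [hMp]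
      have : (2 : ℝ) - 1⁻¹ * (2 - (p.2 : ℝ)) = p.2 := by ring
      rw [this, Set.projIcc_val]

variable {Y : Type*} [TopologicalSpace Y]

theorem exists_box_extension {ι : Type*} [Fintype ι] (φ : (ι → I) × I → Y)
    (hφ : ContinuousOn φ {p | p.1 ∈ Cube.boundary ι ∨ p.2 = 0}) :
    ∃ ψ : (ι → I) × I → Y, Continuous ψ ∧
      ∀ p : (ι → I) × I, (p.1 ∈ Cube.boundary ι ∨ p.2 = 0) → ψ p = φ p := by
  obtain ⟨r, hr, h1, h2⟩ := exists_box_retraction ι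
  exact ⟨φ ∘ r, hφ.comp_continuous hr h1, fun p hp => congrArg φ (h2 p hp)⟩

/-- The homotopy extension property of the pair `(I^ι, ∂I^ι)`. -/
theorem exists_homotopy_extension {ι : Type*} [Fintype ι] {b : (ι → I) → Y} (hb : Continuous b)
    {h : (ι → I) × I → Y} (hh : ContinuousOn h (Cube.boundary ι ×ˢ Set.univ))
    (h0 : ∀ x ∈ Cube.boundary ι, h (x, 0) = b x) :
    ∃ H : (ι → I) × I → Y, Continuous H ∧ (∀ x, H (x, 0) = b x) ∧
      ∀ x ∈ Cube.boundary ι, ∀ t, H (x, t) = h (x, t) := by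
  obtain ⟨k, hk, k1, k2⟩ := exists_glue (B := {p : (ι → I) × I | p.2 = 0})
    ((isClosed_boundary ι).prod isClosed_univ) (isClosed_eq continuous_snd continuous_const) hh
    (hb.comp continuous_fst).continuousOn (by
      rintro ⟨x, t⟩ hx (rfl : t = 0); exact h0 x hx.1)
  obtain ⟨H, hH, H1⟩ := exists_box_extension k (hk.mono (by
    rintro p (hp | hp)
    · exact Or.inl ⟨hp, trivial⟩
    · exact Or.inr hp))
  exact ⟨H, hH, fun x => (H1 _ (Or.inr rfl)).trans (k2 _ rfl),
    fun x hx t => (H1 _ (Or.inl hx)).trans (k1 _ ⟨hx, trivial⟩)⟩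

/-- Gluing a function on `∂I^ι × I` with functions on the two ends of the cylinder. -/
theorem exists_glue_cylinder {ι : Type*} [Finite ι] {b c : (ι → I) → Y} (hb : Continuous b)
    (hc : Continuous c)
    {h : (ι → I) × I → Y} (hh : ContinuousOn h (Cube.boundary ι ×ˢ Set.univ))
    (h0 : ∀ x ∈ Cube.boundary ι, h (x, 0) = b x) (h1 : ∀ x ∈ Cube.boundary ι, h (x, 1) = c x) :
    ∃ k : (ι → I) × I → Y, ContinuousOn k {p | p.1 ∈ Cube.boundary ι ∨ p.2 = 0 ∨ p.2 = 1} ∧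
      (∀ x, k (x, 0) = b x) ∧ (∀ x, k (x, 1) = c x) ∧
      ∀ x ∈ Cube.boundary ι, ∀ t, k (x, t) = h (x, t) := by
  have cl : ∀ s : I, IsClosed {p : (ι → I) × I | p.2 = s} := fun s =>
    isClosed_eq continuous_snd continuous_const
  obtain ⟨k, hk, k1, k2⟩ := exists_glue (cl 0) (cl 1) (hb.comp continuous_fst).continuousOn
    (hc.comp continuous_fst).continuousOn (by
      rintro ⟨x, t⟩ (rfl : t = 0) (h : (0 : I) = 1); exact absurd h zero_ne_one)
  obtain ⟨l, hl, l1, l2⟩ := exists_glue ((isClosed_boundary ι).prod isClosed_univ)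
    ((cl 0).union (cl 1)) hh hk (by
      rintro ⟨x, t⟩ hx (ht | ht)
      · obtain rfl : t = 0 := ht
        exact (h0 x hx.1).trans (k1 (x, 0) rfl).symm
      · obtain rfl : t = 1 := ht
        exact (h1 x hx.1).trans (k2 (x, 1) rfl).symm)
  refine ⟨l, hl.mono ?_, fun x => ?_, fun x => ?_, fun x hx t => l1 _ ⟨hx, trivial⟩⟩
  · rintro p (hp | hp)
    · exact Or.inl ⟨hp, trivial⟩
    · exact Or.inr hp
  · exact (l2 _ (Or.inl rfl)).trans (k1 _ rfl)
  · exact (l2 _ (Or.inr rfl)).trans (k2 _ rfl)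

/-- The cube `I^(m+1)` as a cylinder on `I^m`. -/
def cylinderHomeo (m : ℕ) : (Fin (m + 1) → I) ≃ₜ (Fin m → I) × I where
  toFun y := (fun i => y i.succ, y 0)
  invFun p := Fin.cons p.2 p.1
  left_inv y := by
    funext i
    refine Fin.cases ?_ (fun j => ?_) i <;> simp
  right_inv p := by simp
  continuous_toFun := by fun_prop
  continuous_invFun := Continuous.finCons continuous_snd continuous_fst

theorem mem_boundary_cylinderHomeo {m : ℕ} {y : Fin (m + 1) → I} :
    y ∈ Cube.boundary (Fin (m + 1)) ↔ (cylinderHomeo m y).1 ∈ Cube.boundary (Fin m) ∨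
      (cylinderHomeo m y).2 = 0 ∨ (cylinderHomeo m y).2 = 1 := by
  constructor
  · rintro ⟨i, hi⟩
    revert hi
    refine Fin.cases (fun h => Or.inr h) (fun j h => Or.inl ⟨j, h⟩) i
  · rintro (⟨j, h⟩ | h)
    · exact ⟨j.succ, h⟩
    · exact ⟨0, h⟩

/-- Filling a square of homotopies: in `I^m × I × I`, with coordinates `(x, t, s)`, a homotopy on
the face `s = 0`, homotopies on the faces `t = 0` and `t = 1` and a map on the part over `∂I^m`
induce a homotopy on the face `s = 1`. -/
theorem exists_square_filling {m : ℕ} {bot left right : (Fin m → I) × I → Y}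
    (hbot : Continuous bot) (hleft : Continuous left) (hright : Continuous right)
    {side : ((Fin m → I) × I) × I → Y}
    (hside : ContinuousOn side {p | p.1.1 ∈ Cube.boundary (Fin m)})
    (h00 : ∀ x, left (x, 0) = bot (x, 0)) (h10 : ∀ x, right (x, 0) = bot (x, 1))
    (hsl : ∀ x ∈ Cube.boundary (Fin m), ∀ s, side ((x, 0), s) = left (x, s))
    (hsr : ∀ x ∈ Cube.boundary (Fin m), ∀ s, side ((x, 1), s) = right (x, s))
    (hsb : ∀ x ∈ Cube.boundary (Fin m), ∀ t, side ((x, t), 0) = bot (x, t)) :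
    ∃ top : (Fin m → I) × I → Y, Continuous top ∧ (∀ x, top (x, 0) = left (x, 1)) ∧
      (∀ x, top (x, 1) = right (x, 1)) ∧
      ∀ x ∈ Cube.boundary (Fin m), ∀ t, top (x, t) = side ((x, t), 1) := by
  have clb : IsClosed {p : ((Fin m → I) × I) × I | p.1.1 ∈ Cube.boundary (Fin m)} :=
    (isClosed_boundary (Fin m)).preimage (continuous_fst.comp continuous_fst)
  have cl : ∀ s : I, IsClosed {p : ((Fin m → I) × I) × I | p.1.2 = s} := fun s =>
    isClosed_eq (continuous_snd.comp continuous_fst) continuous_const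
  obtain ⟨k, hk, k1, k2⟩ := exists_glue (cl 0) (cl 1)
    (f := fun p => left (p.1.1, p.2)) (g := fun p => right (p.1.1, p.2))
    (Continuous.continuousOn (by fun_prop)) (Continuous.continuousOn (by fun_prop)) (by
      rintro ⟨⟨x, t⟩, s⟩ (rfl : t = 0) (h : (0 : I) = 1); exact absurd h zero_ne_one)
  obtain ⟨l, hl, l1, l2⟩ := exists_glue clb ((cl 0).union (cl 1)) hside hk (by
      rintro ⟨⟨x, t⟩, s⟩ hx (ht | ht)
      · obtain rfl : t = 0 := ht
        exact (hsl x hx s).trans (k1 ((x, 0), s) rfl).symm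
      · obtain rfl : t = 1 := ht
        exact (hsr x hx s).trans (k2 ((x, 1), s) rfl).symm)
  have l0 : ∀ x s, l ((x, 0), s) = left (x, s) := fun x s =>
    (l2 ((x, 0), s) (Or.inl rfl)).trans (k1 ((x, 0), s) rfl)
  have l1' : ∀ x s, l ((x, 1), s) = right (x, s) := fun x s =>
    (l2 ((x, 1), s) (Or.inr rfl)).trans (k2 ((x, 1), s) rfl)
  obtain ⟨n, hn, n1, n2⟩ := exists_glue (clb.union ((cl 0).union (cl 1)))
    (B := {p : ((Fin m → I) × I) × I | p.2 = 0})
    (isClosed_eq continuous_snd continuous_const) hl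
    (hbot.comp continuous_fst).continuousOn (by
      rintro ⟨⟨x, t⟩, s⟩ hx (rfl : s = 0)
      rcases hx with hx | hx | hx
      · exact (l1 _ hx).trans (hsb x hx t)
      · obtain rfl : t = 0 := hx
        exact (l0 x 0).trans (h00 x)
      · obtain rfl : t = 1 := hx
        exact (l1' x 0).trans (h10 x))
  obtain ⟨N, hN, N1⟩ := exists_box_extension (ι := Fin (m + 1))
    (fun p => n (cylinderHomeo m p.1, p.2)) (by
      refine hn.comp (Continuous.continuousOn (by fun_prop)) ?_
      rintro p (hp | hp)
      · exact Or.inl (mem_boundary_cylinderHomeo.1 hp)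
      · exact Or.inr hp)
  have key : ∀ x t, (x ∈ Cube.boundary (Fin m) ∨ t = 0 ∨ t = 1) →
      N ((cylinderHomeo m).symm (x, t), 1) = l ((x, t), 1) := by
    intro x t h
    rw [N1 _ (Or.inl (mem_boundary_cylinderHomeo.2 (by simpa using h)))]
    simp only [Homeomorph.apply_symm_apply]
    exact n1 ((x, t), 1) h
  refine ⟨fun p => N ((cylinderHomeo m).symm p, 1), by fun_prop, fun x => ?_, fun x => ?_,
    fun x hx t => ?_⟩
  · exact (key x 0 (by simp)).trans (l0 x 1)
  · exact (key x 1 (by simp)).trans (l1' x 1)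
  · exact (key x t (Or.inl hx)).trans (l1 _ hx)

end Filling

/-! ### Compression of cubes -/

section Compression

variable {X Y Z W : Type*} [TopologicalSpace X] [TopologicalSpace Y] [TopologicalSpace Z]
  [TopologicalSpace W]

/-- A map `f` is a compression equivalence if it is continuous and every map of pairs from
`(I^m, ∂I^m)` to `f` can be compressed: if `b : I^m → Y` is equal to `f ∘ a` on `∂I^m`, then there
is an extension `a'` of `a` to `I^m` such that `f ∘ a'` is homotopic to `b` relative to `∂I^m`. -/
def Compresses (f : X → Y) : Prop :=
  Continuous f ∧ ∀ (m : ℕ) (a : (Fin m → I) → X) (b : (Fin m → I) → Y),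
    ContinuousOn a (Cube.boundary (Fin m)) → Continuous b →
    (∀ x ∈ Cube.boundary (Fin m), b x = f (a x)) →
    ∃ (a' : (Fin m → I) → X) (h : (Fin m → I) × I → Y), Continuous a' ∧ Continuous h ∧
      (∀ x ∈ Cube.boundary (Fin m), a' x = a x) ∧ (∀ x, h (x, 0) = f (a' x)) ∧
      (∀ x, h (x, 1) = b x) ∧ ∀ x ∈ Cube.boundary (Fin m), ∀ t, h (x, t) = b x

/-- The form of compression in which `b` is only homotopic to `f ∘ a` on the boundary: the homotopy
extends to one from `f ∘ a'` to `b`. -/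
theorem Compresses.lift {f : X → Y} (hf : Compresses f) {m : ℕ} {a : (Fin m → I) → X}
    {b : (Fin m → I) → Y} {h : (Fin m → I) × I → Y}
    (ha : ContinuousOn a (Cube.boundary (Fin m))) (hb : Continuous b)
    (hh : ContinuousOn h (Cube.boundary (Fin m) ×ˢ Set.univ))
    (h0 : ∀ x ∈ Cube.boundary (Fin m), h (x, 0) = f (a x))
    (h1 : ∀ x ∈ Cube.boundary (Fin m), h (x, 1) = b x) :
    ∃ (a' : (Fin m → I) → X) (h' : (Fin m → I) × I → Y), Continuous a' ∧ Continuous h' ∧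
      (∀ x ∈ Cube.boundary (Fin m), a' x = a x) ∧ (∀ x, h' (x, 0) = f (a' x)) ∧
      (∀ x, h' (x, 1) = b x) ∧ ∀ x ∈ Cube.boundary (Fin m), ∀ t, h' (x, t) = h (x, t) := by
  -- Extend the reverse of `h` to a homotopy from `b`, compress its end, and fill a square.
  obtain ⟨c, hc, c0, c1⟩ := exists_homotopy_extension hb (h := fun p => h (p.1, σ p.2))
    (hh.comp (Continuous.continuousOn (by fun_prop)) fun p hp => ⟨hp.1, trivial⟩)
    (fun x hx => by simpa using h1 x hx)
  obtain ⟨a', k, ha', hk, e1, e2, e3, e4⟩ := hf.2 m a (fun x => c (x, 1)) ha (by fun_prop)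
    (fun x hx => by rw [c1 x hx, unitInterval.symm_one, h0 x hx])
  obtain ⟨top, htop, t0, t1, t2⟩ := exists_square_filling (bot := k)
    (left := fun p => f (a' p.1)) (right := fun p => c (p.1, σ p.2))
    (side := fun p => h (p.1.1, min p.1.2 p.2)) hk
    (hf.1.comp (ha'.comp continuous_fst)) (by fun_prop)
    (hh.comp (Continuous.continuousOn (by fun_prop)) fun p hp => ⟨hp, trivial⟩)
    (fun x => (e2 x).symm) (fun x => by simp [e3])
    (fun x hx s => by simp [h0 x hx, e1 x hx])
    (fun x hx s => by simp [c1 x hx, min_eq_right unitInterval.le_one'])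
    (fun x hx t => by simp [h0 x hx, e4 x hx, c1 x hx])
  exact ⟨a', top, ha', htop, e1, t0, fun x => by simp [t1, c0], fun x hx t => by
    simp [t2 x hx, min_eq_left unitInterval.le_one']⟩

theorem Compresses.comp {f : X → Y} {g : Y → Z} (hg : Compresses g) (hf : Compresses f) :
    Compresses (g ∘ f) := by
  refine ⟨hg.1.comp hf.1, fun m a b ha hb hab => ?_⟩
  obtain ⟨c, k, hc, hk, c1, k0, k1, k2⟩ := hg.2 m (f ∘ a) b (hf.1.comp_continuousOn ha) hb hab
  obtain ⟨a', l, ha', hl, a1, l0, l1, l2⟩ := hf.2 m a c ha hc c1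
  let P : ∀ x, Path (g (f (a' x))) (g (c x)) := fun x =>
    ⟨⟨fun t => g (l (x, t)), hg.1.comp (hl.comp (by fun_prop))⟩, by simp [l0], by simp [l1]⟩
  let Q : ∀ x, Path (g (c x)) (b x) := fun x =>
    ⟨⟨fun t => k (x, t), by fun_prop⟩, by simp [k0], by simp [k1]⟩
  refine ⟨a', fun p => (P p.1).trans (Q p.1) p.2, ha', ?_, a1,
    fun x => ((P x).trans (Q x)).source, fun x => ((P x).trans (Q x)).target, ?_⟩
  · exact Path.trans_continuous_family P (hg.1.comp hl) Q hk
  · intro x hx t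
    simp only [P, Q, Path.trans_apply]
    split_ifs
    · simp [l2 x hx, c1 x hx, hab x hx]
    · simp [k2 x hx]

theorem Compresses.of_homotopy {f g : X → Y} (hf : Compresses f) {G : X × I → Y}
    (hG : Continuous G) (G0 : ∀ x, G (x, 0) = f x) (G1 : ∀ x, G (x, 1) = g x) : Compresses g := by
  have hg : Continuous g := by
    have : g = fun x => G (x, 1) := funext fun x => (G1 x).symm
    rw [this]; fun_prop
  refine ⟨hg, fun m a b ha hb hab => ?_⟩
  have hGa : ∀ {T : Type _} [TopologicalSpace T] (s : Set T) (p : T → Fin m → I) (q : T → I),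
      Continuous p → Continuous q → (∀ x ∈ s, p x ∈ Cube.boundary (Fin m)) →
      ContinuousOn (fun x => G (a (p x), q x)) s := fun s p q hp hq hs =>
    hG.comp_continuousOn ((ha.comp hp.continuousOn hs).prodMk hq.continuousOn)
  obtain ⟨a', k, ha', hk, a1, k0, k1, k2⟩ := hf.lift (h := fun p => G (a p.1, p.2)) ha hb
    (hGa _ _ _ continuous_fst continuous_snd fun p hp => hp.1) (fun x _ => G0 _)
    (fun x hx => by rw [G1, hab x hx])
  obtain ⟨top, htop, t0, t1, t2⟩ := exists_square_filling (bot := k)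
    (left := fun p => G (a' p.1, p.2)) (right := fun p => b p.1)
    (side := fun p => G (a p.1.1, max p.1.2 p.2)) hk (by fun_prop) (by fun_prop)
    (hGa _ _ _ (by fun_prop) (by fun_prop) fun p hp => hp)
    (fun x => by rw [G0, k0]) (fun x => (k1 x).symm)
    (fun x hx s => by simp [a1 x hx])
    (fun x hx s => by simp [max_eq_left unitInterval.le_one', G1, hab x hx])
    (fun x hx t => by simp [k2 x hx])
  refine ⟨a', top, ha', htop, a1, fun x => by rw [t0, G1], t1, fun x hx t => ?_⟩
  rw [t2 x hx, hab x hx]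
  simp [max_eq_right unitInterval.le_one', G1]

theorem compresses_id : Compresses (id : X → X) :=
  ⟨continuous_id, fun _ _ b _ hb hab => ⟨b, fun p => b p.1, hb, by fun_prop, fun x hx => hab x hx,
    fun _ => rfl, fun _ => rfl, fun _ _ _ => rfl⟩⟩

/-- One part of the two-out-of-six property. -/
theorem Compresses.of_comp_of_comp {f : X → Y} {g : Y → Z} {h : Z → W} (hf : Continuous f)
    (hg : Continuous g) (hgf : Compresses (g ∘ f)) (hhg : Compresses (h ∘ g)) (hh : Continuous h) :
    Compresses f := by
  refine ⟨hf, fun m a b ha hb hab => ?_⟩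
  obtain ⟨a', k, ha', hk, a1, k0, k1, k2⟩ := hgf.2 m a (g ∘ b) ha (by fun_prop)
    fun x hx => congrArg g (hab x hx)
  obtain ⟨d, hd, d0, d1, d2⟩ := exists_glue_cylinder (hf.comp ha') hb (h := fun p => b p.1)
    (Continuous.continuousOn (by fun_prop)) (fun x hx => by simp [a1 x hx, hab x hx])
    (fun x _ => rfl)
  obtain ⟨c, -, hc, -, c1, -⟩ := hhg.2 (m + 1) (fun y => d (cylinderHomeo m y))
    (fun y => h (k (cylinderHomeo m y)))
    (hd.comp (Continuous.continuousOn (by fun_prop)) fun y hy => mem_boundary_cylinderHomeo.1 hy)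
    (by fun_prop) (by
      intro y hy
      obtain ⟨⟨x, t⟩, rfl⟩ := (cylinderHomeo m).symm.surjective y
      have hy := mem_boundary_cylinderHomeo.1 hy
      simp only [Homeomorph.apply_symm_apply] at hy ⊢
      refine congrArg h ?_
      rcases hy with hx | rfl | rfl
      · rw [d2 x hx, k2 x hx]; rfl
      · rw [d0, k0]; rfl
      · rw [d1, k1]; rfl)
  have key : ∀ x t, (x ∈ Cube.boundary (Fin m) ∨ t = 0 ∨ t = 1) →
      c ((cylinderHomeo m).symm (x, t)) = d (x, t) := fun x t hx => by
    rw [c1 _ (mem_boundary_cylinderHomeo.2 (by simpa using hx)), Homeomorph.apply_symm_apply]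
  exact ⟨a', fun p => c ((cylinderHomeo m).symm p), ha', by fun_prop, a1,
    fun x => (key x 0 (by simp)).trans (d0 x), fun x => (key x 1 (by simp)).trans (d1 x),
    fun x hx t => (key x t (Or.inl hx)).trans (d2 x hx t)⟩

/-- Homotopy equivalences are compression equivalences. -/
theorem compresses_of_homotopyEquiv {f : X → Y} {g : Y → X} (hf : Continuous f) (hg : Continuous g)
    {G : X × I → X} (hG : Continuous G) (G0 : ∀ x, G (x, 0) = x) (G1 : ∀ x, G (x, 1) = g (f x))
    {H : Y × I → Y} (hH : Continuous H) (H0 : ∀ y, H (y, 0) = y) (H1 : ∀ y, H (y, 1) = f (g y)) :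
    Compresses f :=
  Compresses.of_comp_of_comp hf hg (compresses_id.of_homotopy hG G0 G1)
    (compresses_id.of_homotopy hH H0 H1) hf

end Compression

/-! ### Compression and homotopy groups -/

section HomotopyGroups

variable {X Y : Type u} [TopologicalSpace X] [TopologicalSpace Y]

theorem continuous_mapGenLoop (f : C(X, Y)) (k : ℕ) (x : X) : Continuous (mapGenLoop f k x) :=
  ((ContinuousMap.continuous_postcomp f).comp continuous_subtype_val).subtype_mk _

/-- A family of generalized loops is continuous if it is jointly continuous. -/
theorem continuous_genLoop {T : Type*} [TopologicalSpace T] {k : ℕ} {x : X}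
    {g : T → GenLoop (Fin k) X x} (hg : Continuous fun p : T × (Fin k → I) => (g p.1).1 p.2) :
    Continuous g :=
  continuous_induced_rng.2 (ContinuousMap.continuous_of_continuous_uncurry _ hg)

theorem continuous_genLoop_eval {T : Type*} [TopologicalSpace T] {k : ℕ} {x : X}
    {g : T → GenLoop (Fin k) X x} (hg : Continuous g) :
    Continuous fun p : T × (Fin k → I) => (g p.1).1 p.2 :=
  continuous_eval.comp (((continuous_subtype_val.comp hg).comp continuous_fst).prodMk
    continuous_snd)

theorem GenLoop_boundary_cylinder {k : ℕ} {x₀ : X} (c : GenLoop (Fin (k + 1)) X x₀)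
    (x : Fin k → I) (t : I) (h : x ∈ Cube.boundary (Fin k) ∨ t = 0 ∨ t = 1) :
    c.1 ((cylinderHomeo k).symm (x, t)) = x₀ :=
  c.2 _ (mem_boundary_cylinderHomeo.2 (by simpa using h))

/-- The path of `k`-dimensional loops given by a `(k+1)`-dimensional loop. -/
def genLoopPath {k : ℕ} {x₀ : X} (c : GenLoop (Fin (k + 1)) X x₀) :
    Path (GenLoop.const : GenLoop (Fin k) X x₀) GenLoop.const where
  toFun t := ⟨⟨fun x => c.1 ((cylinderHomeo k).symm (x, t)), by fun_prop⟩,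
    fun x hx => GenLoop_boundary_cylinder c x t (Or.inl hx)⟩
  continuous_toFun := continuous_genLoop
    (c.1.continuous.comp ((cylinderHomeo k).symm.continuous.comp continuous_swap))
  source' := GenLoop.ext _ _ fun x => GenLoop_boundary_cylinder c x 0 (by simp)
  target' := GenLoop.ext _ _ fun x => GenLoop_boundary_cylinder c x 1 (by simp)

/-- Compression for maps that are constant on the boundary except for the top face. Injectivity on
`π_k` extends the map on the boundary, and surjectivity on `π_(k+1)` corrects the extension. -/
theorem exists_compression_of_top_face {f : C(X, Y)} {x₀ : X} {k : ℕ}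
    (hinj : Function.Injective (mapPi f k x₀)) (hsurj : Function.Surjective (mapPi f (k + 1) x₀))
    (p : GenLoop (Fin k) X x₀) {b : (Fin k → I) × I → Y} (hb : Continuous b)
    (b0 : ∀ x, b (x, 0) = f x₀) (b1 : ∀ x, b (x, 1) = f (p.1 x))
    (b2 : ∀ x ∈ Cube.boundary (Fin k), ∀ t, b (x, t) = f x₀) :
    ∃ (a' : (Fin k → I) × I → X) (h : ((Fin k → I) × I) × I → Y), Continuous a' ∧ Continuous h ∧
      (∀ x, a' (x, 0) = x₀) ∧ (∀ x, a' (x, 1) = p.1 x) ∧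
      (∀ x ∈ Cube.boundary (Fin k), ∀ t, a' (x, t) = x₀) ∧
      (∀ z, h (z, 0) = f (a' z)) ∧ (∀ z, h (z, 1) = b z) ∧
      ∀ z, (z.1 ∈ Cube.boundary (Fin k) ∨ z.2 = 0 ∨ z.2 = 1) → ∀ t, h (z, t) = b z := by
  let M := mapGenLoop f k x₀
  have hM : Continuous M := continuous_mapGenLoop f k x₀
  have hMc : ∀ x, (M GenLoop.const).1 x = f x₀ := fun x => rfl
  let β : Path (M GenLoop.const) (M p) :=
    { toFun := fun t => ⟨⟨fun x => b (x, t), by fun_prop⟩, fun x hx => b2 x hx t⟩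
      continuous_toFun := continuous_genLoop (hb.comp continuous_swap)
      source' := GenLoop.ext _ _ b0
      target' := GenLoop.ext _ _ b1 }
  obtain ⟨γ⟩ : Nonempty (Path (GenLoop.const : GenLoop (Fin k) X x₀) p) := by
    have h1 : GenLoop.Homotopic (M GenLoop.const) (M p) := by
      refine ⟨⟨⟨⟨fun z => b (z.2, z.1), hb.comp continuous_swap⟩, b0, b1⟩, fun t x hx => ?_⟩⟩
      exact (b2 x hx t).trans (hMc x).symm
    have h2 : mapPi f k x₀ ⟦GenLoop.const⟧ = mapPi f k x₀ ⟦p⟧ := Quotient.sound h1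
    obtain ⟨H⟩ := Quotient.exact (hinj h2)
    exact ⟨{ toFun := fun t => ⟨⟨fun x => H (t, x), by fun_prop⟩, fun x hx => H.eq_fst t hx⟩
             continuous_toFun := continuous_genLoop H.continuous
             source' := GenLoop.ext _ _ fun x => H.apply_zero x
             target' := GenLoop.ext _ _ fun x => H.apply_one x }⟩
  let l : Path (M GenLoop.const) (M GenLoop.const) := β.trans (γ.map hM).symm
  let d : GenLoop (Fin (k + 1)) Y (f x₀) :=
    ⟨⟨fun y => (l (cylinderHomeo k y).2).1 (cylinderHomeo k y).1,
      (continuous_genLoop_eval l.continuous).comp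
        (continuous_swap.comp (cylinderHomeo k).continuous)⟩, fun y hy => by
      rcases mem_boundary_cylinderHomeo.1 hy with h | h | h
      · exact (l (cylinderHomeo k y).2).2 _ h
      · simp only [ContinuousMap.coe_mk, h, l.source]; exact hMc _
      · simp only [ContinuousMap.coe_mk, h, l.target]; exact hMc _⟩
  obtain ⟨c', hc'⟩ := hsurj ⟦d⟧
  obtain ⟨c, rfl⟩ := Quotient.exists_rep c'
  obtain ⟨H⟩ : GenLoop.Homotopic (mapGenLoop f (k + 1) x₀ c) d := Quotient.exact hc'
  have hH : ∀ (s : I) (x : Fin k → I) (t : I), (x ∈ Cube.boundary (Fin k) ∨ t = 0 ∨ t = 1) →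
      H (s, (cylinderHomeo k).symm (x, t)) = f x₀ := fun s x t h =>
    (H.eq_fst s (mem_boundary_cylinderHomeo.2 (by simpa using h))).trans
      (congrArg f (GenLoop_boundary_cylinder c x t h))
  have h1 : ((genLoopPath c).map hM).Homotopic l := by
    refine ⟨⟨⟨⟨fun z => ⟨⟨fun x => H (z.1, (cylinderHomeo k).symm (x, z.2)), by fun_prop⟩,
      fun x hx => hH _ _ _ (Or.inl hx)⟩, continuous_genLoop ?_⟩, ?_, ?_⟩, ?_⟩⟩
    · exact H.continuous.comp (by fun_prop)
    · intro t
      exact GenLoop.ext _ _ fun x => H.apply_zero _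
    · intro t
      refine GenLoop.ext _ _ fun x => (H.apply_one _).trans ?_
      exact congrArg (fun z => (l z.2).1 z.1) ((cylinderHomeo k).apply_symm_apply (x, t))
    · intro s t ht
      have ht : t = 0 ∨ t = 1 := ht
      exact GenLoop.ext _ _ fun x => (hH _ _ _ (Or.inr ht)).trans
        (congrArg f (GenLoop_boundary_cylinder c x t (Or.inr ht))).symm
  let α := (genLoopPath c).trans γ
  have h2 : (α.map hM).Homotopic β := by
    rw [Path.map_trans]
    refine (h1.hcomp (Path.Homotopic.refl _)).trans ?_
    refine Path.Homotopic.trans ⟨Path.Homotopy.transAssoc _ _ _⟩ ?_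
    refine Path.Homotopic.trans (Path.Homotopic.hcomp (Path.Homotopic.refl _)
      ⟨(Path.Homotopy.reflSymmTrans _).symm⟩) ⟨Path.Homotopy.transRefl _⟩
  obtain ⟨F⟩ := h2
  have hF : Continuous fun w : ((Fin k → I) × I) × I => (F (w.2, w.1.2)).1 w.1.1 :=
    (continuous_genLoop_eval F.continuous).comp
      ((continuous_snd.prodMk (continuous_snd.comp continuous_fst)).prodMk
        (continuous_fst.comp continuous_fst))
  refine ⟨fun z => (α z.2).1 z.1, fun w => (F (w.2, w.1.2)).1 w.1.1,
    (continuous_genLoop_eval α.continuous).comp continuous_swap, hF,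
    fun x => congrArg (fun c => c.1 x) α.source, fun x => congrArg (fun c => c.1 x) α.target,
    fun x hx t => (α t).2 x hx, fun z => congrArg (fun c => c.1 z.1) (F.apply_zero z.2),
    fun z => congrArg (fun c => c.1 z.1) (F.apply_one z.2), ?_⟩
  rintro ⟨x, t⟩ (hx | rfl | rfl) s
  · exact ((F (s, t)).2 x hx).trans (b2 x hx t).symm
  · exact (congrArg (fun c => c.1 x) (F.source s)).trans (b0 x).symm
  · exact (congrArg (fun c => c.1 x) (F.target s)).trans (b1 x).symm

/-- Solutions of compression problems can be transported along homotopies of problems. -/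
theorem exists_compression_of_homotopy {f : X → Y} (hf : Continuous f) {m : ℕ}
    {a : (Fin m → I) × I → X} {b : (Fin m → I) × I → Y}
    (ha : ContinuousOn a (Cube.boundary (Fin m) ×ˢ Set.univ)) (hb : Continuous b)
    (hab : ∀ x ∈ Cube.boundary (Fin m), ∀ s, b (x, s) = f (a (x, s)))
    {a₀ : (Fin m → I) → X} {h₀ : (Fin m → I) × I → Y} (ha₀ : Continuous a₀) (hh₀ : Continuous h₀)
    (e1 : ∀ x ∈ Cube.boundary (Fin m), a₀ x = a (x, 0)) (e2 : ∀ x, h₀ (x, 0) = f (a₀ x))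
    (e3 : ∀ x, h₀ (x, 1) = b (x, 0)) (e4 : ∀ x ∈ Cube.boundary (Fin m), ∀ t, h₀ (x, t) = b (x, 0)) :
    ∃ (a' : (Fin m → I) → X) (h : (Fin m → I) × I → Y), Continuous a' ∧ Continuous h ∧
      (∀ x ∈ Cube.boundary (Fin m), a' x = a (x, 1)) ∧ (∀ x, h (x, 0) = f (a' x)) ∧
      (∀ x, h (x, 1) = b (x, 1)) ∧ ∀ x ∈ Cube.boundary (Fin m), ∀ t, h (x, t) = b (x, 1) := by
  obtain ⟨A, hA, A0, A1⟩ := exists_homotopy_extension ha₀ ha fun x hx => (e1 x hx).symm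
  obtain ⟨top, htop, t0, t1, t2⟩ := exists_square_filling (bot := h₀)
    (left := fun p => f (A p)) (right := b) (side := fun p => b (p.1.1, p.2)) hh₀
    (hf.comp hA) hb (Continuous.continuousOn (by fun_prop))
    (fun x => by rw [A0, e2]) (fun x => (e3 x).symm)
    (fun x hx s => by simp [A1 x hx, hab x hx]) (fun x hx s => rfl) (fun x hx t => (e4 x hx t).symm)
  exact ⟨fun x => A (x, 1), top, by fun_prop, htop, fun x hx => A1 x hx 1, t0, t1, t2⟩

/-- A lifting problem for `(I^(k+1), ∂I^(k+1))` is deformed to one in which `a` is constant outside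
the top face, so that the top face is a loop in `X` whose image is contracted by `b`; such problems
are solved by bijectivity on homotopy groups. -/
theorem compresses_of_bijective_mapPi [Nonempty X] (f : C(X, Y))
    (hf : ∀ k x, Function.Bijective (mapPi f k x)) : Compresses f := by
  refine ⟨f.continuous, fun m a b ha hb hab => ?_⟩
  rcases m with _ | k
  · let x₀ : X := Classical.arbitrary X
    obtain ⟨c', hc'⟩ := (hf 0 x₀).2 ⟦⟨⟨b, hb⟩, fun y hy => by
      obtain ⟨i, -⟩ := hy; exact i.elim0⟩⟧
    obtain ⟨c, rfl⟩ := Quotient.exists_rep c'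
    obtain ⟨H⟩ := Quotient.exact hc'
    refine ⟨c.1, fun z => H (z.2, z.1), c.1.continuous, H.continuous.comp continuous_swap, ?_,
      fun x => H.apply_zero x, fun x => H.apply_one x, ?_⟩
    · rintro x ⟨i, -⟩; exact i.elim0
    · rintro x ⟨i, -⟩; exact i.elim0
  · -- The boundary of the cylinder without its top face is a retract of the cylinder, so it can be
    -- contracted to a corner; extend the contraction to a homotopy of problems.
    obtain ⟨r, hr, r1, r2⟩ := exists_box_retraction (Fin k)
    have hmem : ∀ z : (Fin k → I) × I, (z.1 ∈ Cube.boundary (Fin k) ∨ z.2 = 0) →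
        (cylinderHomeo k).symm z ∈ Cube.boundary (Fin (k + 1)) := fun z hz =>
      mem_boundary_cylinderHomeo.2 (by
        rw [Homeomorph.apply_symm_apply]; exact hz.imp_right Or.inl)
    let A : ((Fin k → I) × I) × I → X := fun w =>
      a ((cylinderHomeo k).symm (r (fun i => w.2 * w.1.1 i, w.2 * w.1.2)))
    have hA : Continuous A := ha.comp_continuous (by fun_prop) fun w => hmem _ (r1 _)
    have A1 : ∀ z : (Fin k → I) × I, (z.1 ∈ Cube.boundary (Fin k) ∨ z.2 = 0) →
        A (z, 1) = a ((cylinderHomeo k).symm z) := fun z hz => by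
      simp only [A, one_mul]
      rw [r2 (z.1, z.2) hz]
    let x₀ : X := a ((cylinderHomeo k).symm (r (fun _ => 0, 0)))
    have A0 : ∀ z : (Fin k → I) × I, A (z, 0) = x₀ := fun z => by
      simp only [A, x₀, zero_mul]
    have hatop : Continuous fun x : Fin k → I => a ((cylinderHomeo k).symm (x, 1)) :=
      ha.comp_continuous (by fun_prop) fun x => mem_boundary_cylinderHomeo.2 (by simp)
    obtain ⟨T, hT, T0, T1⟩ := exists_homotopy_extension hatop (h := fun p => A ((p.1, 1), σ p.2))
      (Continuous.continuousOn (by fun_prop)) (fun x hx => by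
        simp [A1 (x, 1) (Or.inl hx)])
    let p : GenLoop (Fin k) X x₀ := ⟨⟨fun x => T (x, 1), by fun_prop⟩, fun x hx => by
      simp [T1 x hx, A0]⟩
    -- The homotopy on the boundary of the cylinder, with the parameter in the last place.
    have cl1 : IsClosed {w : ((Fin k → I) × I) × I | w.1.1 ∈ Cube.boundary (Fin k)} :=
      (isClosed_boundary _).preimage (by fun_prop)
    have cl2 : ∀ s : I, IsClosed {w : ((Fin k → I) × I) × I | w.1.2 = s} := fun s =>
      isClosed_eq (by fun_prop) continuous_const
    obtain ⟨g, hg, g1, g2⟩ := exists_glue (cl1.union (cl2 0)) (cl2 1) (f := A)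
      (g := fun w => T (w.1.1, σ w.2)) hA.continuousOn (Continuous.continuousOn (by fun_prop)) (by
        rintro ⟨⟨x, t⟩, s⟩ (hx | ht) (rfl : t = 1)
        · simp [T1 x hx]
        · exact absurd ht one_ne_zero)
    have hg' : ContinuousOn (fun q : (Fin (k + 1) → I) × I => g (cylinderHomeo k q.1, q.2))
        (Cube.boundary (Fin (k + 1)) ×ˢ Set.univ) := by
      refine hg.comp (Continuous.continuousOn (by fun_prop)) ?_
      rintro ⟨y, s⟩ ⟨hy, -⟩
      rcases mem_boundary_cylinderHomeo.1 hy with h | h | h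
      · exact Or.inl (Or.inl h)
      · exact Or.inl (Or.inr h)
      · exact Or.inr h
    have gend : ∀ y ∈ Cube.boundary (Fin (k + 1)), g (cylinderHomeo k y, 1) = a y := by
      intro y hy
      obtain ⟨z, rfl⟩ := (cylinderHomeo k).symm.surjective y
      have h := mem_boundary_cylinderHomeo.1 hy
      rw [Homeomorph.apply_symm_apply] at h ⊢
      rcases h with h | h | h
      · rw [g1 _ (Or.inl h), A1 z (Or.inl h)]
      · rw [g1 _ (Or.inr h), A1 z (Or.inr h)]
      · rw [g2 _ h]
        obtain ⟨x, t⟩ := z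
        obtain rfl : t = 1 := h
        simp [T0]
    obtain ⟨B, hB, B0, B1⟩ := exists_homotopy_extension hb
      (h := fun q => f (g (cylinderHomeo k q.1, σ q.2)))
      (f.continuous.comp_continuousOn (hg'.comp (t := Cube.boundary (Fin (k + 1)) ×ˢ Set.univ)
        (f := fun q : (Fin (k + 1) → I) × I => (q.1, σ q.2)) (Continuous.continuousOn (by fun_prop))
        fun q hq => ⟨hq.1, trivial⟩))
      (fun y hy => by simp [gend y hy, hab y hy])
    have gB : ∀ z : (Fin k → I) × I, (z.1 ∈ Cube.boundary (Fin k) ∨ z.2 = 0 ∨ z.2 = 1) →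
        B ((cylinderHomeo k).symm z, 1) = f (g (z, 0)) := fun z hz => by
      rw [B1 _ (mem_boundary_cylinderHomeo.2 (by rwa [Homeomorph.apply_symm_apply]))]
      simp
    have g01 : ∀ z : (Fin k → I) × I, (z.1 ∈ Cube.boundary (Fin k) ∨ z.2 = 0) →
        g (z, 0) = x₀ := fun z hz => by rw [g1 _ hz, A0]
    have g02 : ∀ x : Fin k → I, g ((x, 1), 0) = p.1 x := fun x => by
      rw [g2 _ rfl]; simp [p]
    obtain ⟨a', h, ha', hh, c0, c1, c2, d0, d1, d2⟩ := exists_compression_of_top_face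
      (hf k x₀).1 (hf (k + 1) x₀).2 p (b := fun z => B ((cylinderHomeo k).symm z, 1))
      (by fun_prop) (fun x => by rw [gB _ (by simp), g01 _ (by simp)])
      (fun x => by rw [gB _ (by simp), g02])
      (fun x hx t => by rw [gB _ (Or.inl hx), g01 _ (Or.inl hx)])
    obtain ⟨a'', h', ha'', hh', e1, e2, e3, e4⟩ := exists_compression_of_homotopy f.continuous
      (a := fun q => g (cylinderHomeo k q.1, q.2)) (b := fun q => B (q.1, σ q.2)) hg'
      (by fun_prop) (fun y hy s => by rw [B1 y hy]; simp)
      (a₀ := fun y => a' (cylinderHomeo k y)) (h₀ := fun q => h (cylinderHomeo k q.1, q.2))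
      (by fun_prop) (by fun_prop) (by
        intro y hy
        obtain ⟨⟨x, t⟩, rfl⟩ := (cylinderHomeo k).symm.surjective y
        have h := mem_boundary_cylinderHomeo.1 hy
        simp only [Homeomorph.apply_symm_apply] at h ⊢
        rcases h with h | rfl | rfl
        · rw [c2 x h, g01 _ (Or.inl h)]
        · rw [c0, g01 _ (Or.inr rfl)]
        · rw [c1, g02]) (fun y => d0 _) (fun y => by simp [d1])
      (fun y hy t => by simp [d2 _ (mem_boundary_cylinderHomeo.1 hy)])
    refine ⟨a'', h', ha'', hh', fun y hy => (e1 y hy).trans (gend y hy), e2, fun y => ?_,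
      fun y hy t => ?_⟩
    · rw [e3]; simp [B0]
    · rw [e4 y hy]; simp [B0]

/-- Surjectivity is compression of `(I^k, ∂I^k)`, and injectivity is compression of homotopies, that
is of `(I^(k+1), ∂I^(k+1))`. -/
theorem Compresses.bijective_mapPi {f : C(X, Y)} (hf : Compresses f) (k : ℕ) (x₀ : X) :
    Function.Bijective (mapPi f k x₀) := by
  constructor
  · intro p' q' hpq
    obtain ⟨p, rfl⟩ := Quotient.exists_rep p'
    obtain ⟨q, rfl⟩ := Quotient.exists_rep q'
    obtain ⟨H⟩ : GenLoop.Homotopic (mapGenLoop f k x₀ p) (mapGenLoop f k x₀ q) :=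
      Quotient.exact hpq
    obtain ⟨d, hd, d0, d1, d2⟩ := exists_glue_cylinder p.1.continuous q.1.continuous
      (h := fun _ => x₀) continuousOn_const (fun x hx => (p.2 x hx).symm)
      (fun x hx => (q.2 x hx).symm)
    obtain ⟨c, -, hc, -, c1, -⟩ := hf.2 (k + 1) (fun y => d (cylinderHomeo k y))
      (fun y => H ((cylinderHomeo k y).2, (cylinderHomeo k y).1))
      (hd.comp (Continuous.continuousOn (by fun_prop)) fun y hy => mem_boundary_cylinderHomeo.1 hy)
      (by fun_prop) (by
        intro y hy
        obtain ⟨⟨x, t⟩, rfl⟩ := (cylinderHomeo k).symm.surjective y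
        have hy := mem_boundary_cylinderHomeo.1 hy
        simp only [Homeomorph.apply_symm_apply] at hy ⊢
        rcases hy with hx | rfl | rfl
        · rw [d2 x hx, H.eq_fst t hx]; exact congrArg f (p.2 x hx)
        · rw [d0, H.apply_zero]; rfl
        · rw [d1, H.apply_one]; rfl)
    have key : ∀ x t, (x ∈ Cube.boundary (Fin k) ∨ t = 0 ∨ t = 1) →
        c ((cylinderHomeo k).symm (x, t)) = d (x, t) := fun x t hx => by
      rw [c1 _ (mem_boundary_cylinderHomeo.2 (by simpa using hx)), Homeomorph.apply_symm_apply]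
    refine Quotient.sound ⟨⟨⟨⟨fun z => c ((cylinderHomeo k).symm (z.2, z.1)), by fun_prop⟩,
      fun x => (key x 0 (by simp)).trans (d0 x), fun x => (key x 1 (by simp)).trans (d1 x)⟩,
      fun t x hx => ?_⟩⟩
    exact (key x t (Or.inl hx)).trans ((d2 x hx t).trans (p.2 x hx).symm)
  · intro q'
    obtain ⟨q, rfl⟩ := Quotient.exists_rep q'
    obtain ⟨a', h, ha', hh, a1, h0, h1, h2⟩ := hf.2 k (fun _ => x₀) q.1 continuousOn_const
      q.1.continuous (fun x hx => q.2 x hx)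
    refine ⟨⟦⟨⟨a', ha'⟩, a1⟩⟧, Quotient.sound ⟨⟨⟨⟨fun z => h (z.2, z.1), hh.comp continuous_swap⟩,
      h0, h1⟩, fun t x hx => ?_⟩⟩⟩
    exact (h2 x hx t).trans ((q.2 x hx).trans (congrArg f (a1 x hx)).symm)

/-- A pointed map is a weak equivalence if and only if all maps of pairs from cubes to it can be
compressed. -/
theorem isWeakEquiv_iff_compresses {X Y : PtCG.{u}} (f : X ⟶ Y) :
    IsWeakEquiv f ↔ Compresses f.map := by
  have : Nonempty X.carrier := ⟨X.pt⟩
  exact ⟨compresses_of_bijective_mapPi f.map, fun h k x => h.bijective_mapPi k x⟩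

end HomotopyGroups

/-! ### Compression over the members of an open cover -/

section Excision

variable {X Y : Type*} [TopologicalSpace X] [TopologicalSpace Y] {E E' : Type*} [TopologicalSpace E]
  [TopologicalSpace E']

/-- A map `a` and a homotopy `h` from `f ∘ a` to `b`, all defined on `S`, such that the values of
`h` satisfy the constraint `P`. -/
structure PartialCompression (f : X → Y) (b : E → Y) (P : E → Y → Prop) (a : E → X)
    (h : E × I → Y) (S : Set E) : Prop where
  cont : ContinuousOn a S
  cont_homotopy : ContinuousOn h (S ×ˢ Set.univ)
  apply_zero : ∀ x ∈ S, h (x, 0) = f (a x)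
  apply_one : ∀ x ∈ S, h (x, 1) = b x
  constraint : ∀ x ∈ S, ∀ t, P x (h (x, t))

theorem PartialCompression.mono {f : X → Y} {b : E → Y} {P : E → Y → Prop} {a : E → X}
    {h : E × I → Y} {S T : Set E} (H : PartialCompression f b P a h S) (hT : T ⊆ S) :
    PartialCompression f b P a h T :=
  ⟨H.cont.mono hT, H.cont_homotopy.mono (Set.prod_mono hT subset_rfl),
    fun x hx => H.apply_zero x (hT hx), fun x hx => H.apply_one x (hT hx),
    fun x hx => H.constraint x (hT hx)⟩

theorem PartialCompression.glue {f : X → Y} {b : E → Y} {P : E → Y → Prop} {a a' : E → X}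
    {h h' : E × I → Y} {S T : Set E} (hS : IsClosed S) (hT : IsClosed T)
    (H : PartialCompression f b P a h S) (H' : PartialCompression f b P a' h' T)
    (ha : ∀ x ∈ S, x ∈ T → a x = a' x) (hh : ∀ x ∈ S, x ∈ T → ∀ t, h (x, t) = h' (x, t)) :
    ∃ a₁ h₁, PartialCompression f b P a₁ h₁ (S ∪ T) ∧ (∀ x ∈ S, a₁ x = a x) ∧
      (∀ x ∈ T, a₁ x = a' x) ∧ (∀ x ∈ S, ∀ t, h₁ (x, t) = h (x, t)) ∧
      ∀ x ∈ T, ∀ t, h₁ (x, t) = h' (x, t) := by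
  obtain ⟨a₁, c1, c2, c3⟩ := exists_glue hS hT H.cont H'.cont ha
  obtain ⟨h₁, d1, d2, d3⟩ := exists_glue (hS.prod isClosed_univ) (hT.prod isClosed_univ)
    H.cont_homotopy H'.cont_homotopy fun x hx hx' => hh x.1 hx.1 hx'.1 x.2
  have d2' : ∀ x ∈ S, ∀ t, h₁ (x, t) = h (x, t) := fun x hx t => d2 (x, t) ⟨hx, trivial⟩
  have d3' : ∀ x ∈ T, ∀ t, h₁ (x, t) = h' (x, t) := fun x hx t => d3 (x, t) ⟨hx, trivial⟩
  refine ⟨a₁, h₁, ⟨c1, d1.mono (by rw [Set.union_prod]), ?_, ?_, ?_⟩, c2, c3, d2', d3'⟩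
  · rintro x (hx | hx)
    · rw [d2' x hx, c2 x hx, H.apply_zero x hx]
    · rw [d3' x hx, c3 x hx, H'.apply_zero x hx]
  · rintro x (hx | hx)
    · rw [d2' x hx, H.apply_one x hx]
    · rw [d3' x hx, H'.apply_one x hx]
  · rintro x (hx | hx) t
    · rw [d2' x hx]; exact H.constraint x hx t
    · rw [d3' x hx]; exact H'.constraint x hx t

/-- Compression for the pair `(B, L)` over the subset `O` of the target. -/
def CompressesPair (f : X → Y) (O : Set Y) (B L : Set E) : Prop :=
  ∀ (b : E → Y), ContinuousOn b B → (∀ x ∈ B, b x ∈ O) → ∀ (a : E → X) (h : E × I → Y),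
    PartialCompression f b (fun _ y => y ∈ O) a h L →
    ∃ a' h', PartialCompression f b (fun _ y => y ∈ O) a' h' B ∧ (∀ x ∈ L, a' x = a x) ∧
      ∀ x ∈ L, ∀ t, h' (x, t) = h (x, t)

/-- Compression passes to a pair that is a retract, and in particular to homeomorphic pairs. -/
theorem CompressesPair.transfer {f : X → Y} {O : Set Y} {B L : Set E} {B' L' : Set E'}
    (H : CompressesPair f O B L) (hL' : L' ⊆ B') {φ : E' → E} {ψ : E → E'}
    (hφ : Continuous φ)
    (hψ : Continuous ψ) (φB : ∀ x ∈ B', φ x ∈ B) (φL : ∀ x ∈ L', φ x ∈ L) (ψB : ∀ x ∈ B, ψ x ∈ B')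
    (ψL : ∀ x ∈ L, ψ x ∈ L') (hψφ : ∀ x ∈ B', ψ (φ x) = x) : CompressesPair f O B' L' := by
  intro b hb hbO a h hah
  obtain ⟨a', h', H', e1, e2⟩ := H (b ∘ ψ) (hb.comp hψ.continuousOn ψB)
    (fun x hx => hbO _ (ψB x hx))
    (a ∘ ψ) (fun p => h (ψ p.1, p.2))
    ⟨hah.cont.comp hψ.continuousOn ψL, hah.cont_homotopy.comp
      (Continuous.continuousOn (by fun_prop)) fun p hp => ⟨ψL _ hp.1, trivial⟩,
      fun x hx => hah.apply_zero _ (ψL x hx), fun x hx => hah.apply_one _ (ψL x hx),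
      fun x hx => hah.constraint _ (ψL x hx)⟩
  refine ⟨a' ∘ φ, fun p => h' (φ p.1, p.2), ⟨H'.cont.comp hφ.continuousOn φB,
    H'.cont_homotopy.comp (Continuous.continuousOn (by fun_prop)) fun p hp => ⟨φB _ hp.1, trivial⟩,
    fun x hx => H'.apply_zero _ (φB x hx), fun x hx => ?_,
    fun x hx => H'.constraint _ (φB x hx)⟩, fun x hx => ?_, fun x hx t => ?_⟩
  · exact (H'.apply_one _ (φB x hx)).trans (congrArg b (hψφ x hx))
  · exact (e1 _ (φL x hx)).trans (congrArg a (hψφ x (hL' hx)))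
  · exact (e2 _ (φL x hx) t).trans (congrArg (fun y => h (y, t)) (hψφ x (hL' hx)))

/-- Compression of cubes over the subset `O` of the target. -/
def CompressesOver (f : X → Y) (O : Set Y) : Prop :=
  ∀ m : ℕ, CompressesPair f O (Set.univ : Set (Fin m → I)) (Cube.boundary (Fin m))

/-- The box in the cube with the given bounds. -/
def realBox {ι : Type*} (l r : ι → ℝ) : Set (ι → I) := {x | ∀ i, l i ≤ x i ∧ (x i : ℝ) ≤ r i}

/-- The boundary of a box relative to the affine subspace that it spans. -/
def realBoxBoundary {ι : Type*} (l r : ι → ℝ) : Set (ι → I) :=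
  {x | x ∈ realBox l r ∧ ∃ i, l i < r i ∧ ((x i : ℝ) = l i ∨ (x i : ℝ) = r i)}

theorem isClosed_realBox {ι : Type*} (l r : ι → ℝ) : IsClosed (realBox l r) := by
  have : realBox l r = ⋂ i, {x : ι → I | l i ≤ x i} ∩ {x : ι → I | (x i : ℝ) ≤ r i} := by
    ext x; simp [realBox]
  rw [this]
  exact isClosed_iInter fun i => (isClosed_le continuous_const (by fun_prop)).inter
    (isClosed_le (by fun_prop) continuous_const)

theorem isClosed_realBoxBoundary {ι : Type*} [Finite ι] (l r : ι → ℝ) :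
    IsClosed (realBoxBoundary l r) := by
  have : realBoxBoundary l r = realBox l r ∩ ⋃ i, {x : ι → I | l i < r i ∧
      ((x i : ℝ) = l i ∨ (x i : ℝ) = r i)} := by
    ext x; simp [realBoxBoundary]
  rw [this]
  refine (isClosed_realBox l r).inter (isClosed_iUnion_of_finite fun i => ?_)
  by_cases h : l i < r i
  · simp only [h, true_and, Set.ofPred_or]
    exact (isClosed_eq (by fun_prop) continuous_const).union
      (isClosed_eq (by fun_prop) continuous_const)
  · simp [h]

/-- Compression of boxes: a box is a cube of the dimension of the box. -/
theorem CompressesOver.realBox {f : X → Y} {O : Set Y} (H : CompressesOver f O) {ι : Type*}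
    [Finite ι] {l r : ι → ℝ} (h0 : ∀ i, 0 ≤ l i) (hlr : ∀ i, l i ≤ r i) (h1 : ∀ i, r i ≤ 1) :
    CompressesPair f O (realBox l r) (realBoxBoundary l r) := by
  classical
  obtain ⟨m, ⟨e⟩⟩ := Finite.exists_equiv_fin {i // l i < r i}
  let φ : (ι → I) → Fin m → I := fun x j => Set.projIcc 0 1 zero_le_one
    (((x (e.symm j).1 : ℝ) - l (e.symm j).1) / (r (e.symm j).1 - l (e.symm j).1))
  let ψ : (Fin m → I) → ι → I := fun y i => Set.projIcc 0 1 zero_le_one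
    (if h : l i < r i then l i + y (e ⟨i, h⟩) * (r i - l i) else l i)
  have hψ1 : ∀ y i, (ψ y i : ℝ) = if h : l i < r i then l i + y (e ⟨i, h⟩) * (r i - l i)
      else l i := by
    intro y i
    have hm : (if h : l i < r i then l i + y (e ⟨i, h⟩) * (r i - l i) else l i) ∈
        Set.Icc (0 : ℝ) 1 := by
      split_ifs with h
      · have y0 := (y (e ⟨i, h⟩)).2.1
        have y1 := (y (e ⟨i, h⟩)).2.2
        have := h0 i
        have := h1 i
        constructor <;> nlinarith
      · exact ⟨h0 i, (hlr i).trans (h1 i)⟩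
    simp only [ψ]
    rw [Set.projIcc_of_mem zero_le_one hm]
  have hφ1 : ∀ x ∈ CrossEffects.realBox l r, ∀ j, (φ x j : ℝ) =
      ((x (e.symm j).1 : ℝ) - l (e.symm j).1) / (r (e.symm j).1 - l (e.symm j).1) := by
    intro x hx j
    have hp : 0 < r (e.symm j).1 - l (e.symm j).1 := sub_pos.2 (e.symm j).2
    have hm : ((x (e.symm j).1 : ℝ) - l (e.symm j).1) / (r (e.symm j).1 - l (e.symm j).1) ∈
        Set.Icc (0 : ℝ) 1 := by
      have := hx (e.symm j).1
      exact ⟨div_nonneg (by linarith) hp.le, (div_le_one hp).2 (by linarith)⟩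
    simp only [φ]
    rw [Set.projIcc_of_mem zero_le_one hm]
  have hψB : ∀ y, ψ y ∈ CrossEffects.realBox l r := by
    intro y i
    rw [hψ1]
    split_ifs with h
    · have y0 := (y (e ⟨i, h⟩)).2.1
      have y1 := (y (e ⟨i, h⟩)).2.2
      constructor <;> nlinarith
    · exact ⟨le_rfl, hlr i⟩
  refine (H m).transfer (fun x hx => hx.1) (φ := φ) (ψ := ψ) ?_ ?_
    (fun _ _ => trivial) ?_ (fun y _ => hψB y) ?_ ?_
  · refine continuous_pi fun j => continuous_projIcc.comp ?_
    fun_prop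
  · refine continuous_pi fun i => continuous_projIcc.comp ?_
    split_ifs <;> fun_prop
  · rintro x ⟨hx, i, hi, h⟩
    refine ⟨e ⟨i, hi⟩, ?_⟩
    rcases h with h | h
    · left
      apply Subtype.ext
      rw [hφ1 x hx]
      simp [h]
    · right
      apply Subtype.ext
      rw [hφ1 x hx]
      simp [h, div_self (sub_pos.2 hi).ne']
  · rintro y ⟨j, hj⟩
    refine ⟨hψB y, (e.symm j).1, (e.symm j).2, ?_⟩
    rw [hψ1, dif_pos (e.symm j).2]
    rcases hj with hj | hj
    · left; simp [hj]
    · right; simp [hj]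
  · intro x hx
    funext i
    apply Subtype.ext
    rw [hψ1]
    split_ifs with h
    · rw [hφ1 x hx]
      simp only [Equiv.symm_apply_apply]
      rw [div_mul_cancel₀ _ (sub_pos.2 h).ne']
      ring
    · have := hx i
      linarith [hlr i]

/-- **Excision**: if `f` satisfies compression over all intersections of members of an open cover of
the target, then it is a compression equivalence. Subdivide the cube into a grid each of whose cubes
maps to a member of the cover. The grid boxes are treated by induction: those of edge length at most
one are compressed over the intersection of the members assigned to the grid cubes containing them,
and larger ones are cut into two along a slice, which is treated before the two parts. -/
theorem compresses_of_openCover {f : X → Y} (hf : Continuous f) {κ : Type*} {U : κ → Set Y}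
    (hU : ∀ i, IsOpen (U i)) (hcov : ∀ y, ∃ i, y ∈ U i)
    (H : ∀ T : Set κ, T.Nonempty → CompressesOver f (⋂ i ∈ T, U i)) : Compresses f := by
  classical
  refine ⟨hf, fun m a b ha hb hab => ?_⟩
  obtain ⟨δ, hδ, hball⟩ := lebesgue_number_lemma_of_metric (s := (Set.univ : Set (Fin m → I)))
    (c := fun i => b ⁻¹' U i) isCompact_univ (fun i => (hU i).preimage hb)
    (fun x _ => Set.mem_iUnion.2 (hcov (b x)))
  obtain ⟨N', hN'⟩ := exists_nat_one_div_lt hδ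
  obtain ⟨N, hN1, hNpos, hNδ⟩ : ∃ N : ℕ, 1 ≤ N ∧ (0 : ℝ) < N ∧ 1 / (N : ℝ) < δ :=
    ⟨N' + 1, by omega, by positivity, by exact_mod_cast hN'⟩
  let box : (Fin m → ℕ) → (Fin m → ℕ) → Set (Fin m → I) := fun lo hi =>
    realBox (fun i => lo i / N) (fun i => hi i / N)
  let bdry : (Fin m → ℕ) → (Fin m → ℕ) → Set (Fin m → I) := fun lo hi =>
    realBoxBoundary (fun i => lo i / N) (fun i => hi i / N)
  have mem_box : ∀ {lo hi x}, x ∈ box lo hi ↔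
      ∀ i, (lo i : ℝ) ≤ N * (x i : ℝ) ∧ N * (x i : ℝ) ≤ hi i := by
    intro lo hi x
    refine forall_congr' fun i => ?_
    simp only [div_le_iff₀' hNpos, le_div_iff₀' hNpos]
  have mem_bdry : ∀ {lo hi x}, x ∈ bdry lo hi ↔ x ∈ box lo hi ∧
      ∃ i, lo i < hi i ∧ (N * (x i : ℝ) = lo i ∨ N * (x i : ℝ) = hi i) := by
    intro lo hi x
    refine and_congr_right fun _ => exists_congr fun i => ?_
    simp only [div_lt_div_iff_of_pos_right hNpos, Nat.cast_lt, eq_div_iff hNpos.ne', mul_comm]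
  let cube : (Fin m → ℕ) → Set (Fin m → I) := fun q => box q (fun i => q i + 1)
  have hκ : ∀ q : Fin m → ℕ, ∃ i, ∀ x ∈ cube q, b x ∈ U i := by
    intro q
    by_cases hq : (cube q).Nonempty
    · obtain ⟨x, hx⟩ := hq
      obtain ⟨i, hi⟩ := hball x trivial
      refine ⟨i, fun y hy => hi ?_⟩
      refine lt_of_le_of_lt ((dist_pi_le_iff (by positivity)).2 fun j => ?_) hNδ
      have hx' := mem_box.1 hx j
      have hy' := mem_box.1 hy j
      rw [Subtype.dist_eq, Real.dist_eq, le_div_iff₀ hNpos]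
      push_cast at hx' hy'
      rw [← abs_of_pos hNpos, ← abs_mul, abs_le]
      constructor <;> nlinarith
    · obtain ⟨i, hi⟩ := hcov (b fun _ => 0)
      exact ⟨i, fun x hx => (hq ⟨x, hx⟩).elim⟩
  choose κ' hκ' using hκ
  let P : (Fin m → I) → Y → Prop := fun x y =>
    ∀ q : Fin m → ℕ, (∀ i, q i < N) → x ∈ cube q → y ∈ U (κ' q)
  -- The inductive claim on the grid boxes.
  have good : ∀ (n : ℕ) (lo hi : Fin m → ℕ), (∀ i, lo i ≤ hi i) → (∀ i, hi i ≤ N) →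
      ∑ i, (hi i - lo i) = n → ∀ a h, PartialCompression f b P a h (bdry lo hi) →
      ∃ a' h', PartialCompression f b P a' h' (box lo hi) ∧ (∀ x ∈ bdry lo hi, a' x = a x) ∧
        ∀ x ∈ bdry lo hi, ∀ t, h' (x, t) = h (x, t) := by
    intro n
    induction n using Nat.strong_induction_on with
    | _ n ih =>
    intro lo hi hlh hhN hn a h hah
    by_cases hel : ∀ i, hi i ≤ lo i + 1
    · -- An elementary box.
      let T : Set κ := {k | ∃ q : Fin m → ℕ, (∀ i, q i < N) ∧ box lo hi ⊆ cube q ∧ κ' q = k}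
      have hT : T.Nonempty := by
        refine ⟨_, fun i => min (lo i) (N - 1), fun i => ?_, fun x hx => ?_, rfl⟩
        · have : min (lo i) (N - 1) ≤ N - 1 := min_le_right _ _
          change min (lo i) (N - 1) < N
          omega
        · refine mem_box.2 fun i => ?_
          have hx' := mem_box.1 hx i
          have h2 : min (lo i) (N - 1) ≤ lo i := min_le_left _ _
          have h3 : hi i ≤ min (lo i) (N - 1) + 1 := by
            have := hel i
            have := hhN i
            omega
          have h2' : ((min (lo i) (N - 1) : ℕ) : ℝ) ≤ lo i := by exact_mod_cast h2
          have h3' : (hi i : ℝ) ≤ ((min (lo i) (N - 1) + 1 : ℕ) : ℝ) := by exact_mod_cast h3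
          exact ⟨h2'.trans hx'.1, hx'.2.trans h3'⟩
      obtain ⟨a', h', H', e1, e2⟩ := (H T hT).realBox (l := fun i => (lo i : ℝ) / N)
        (r := fun i => (hi i : ℝ) / N) (fun i => by positivity)
        (fun i => (div_le_div_iff_of_pos_right hNpos).2 (by exact_mod_cast hlh i))
        (fun i => (div_le_one hNpos).2 (by exact_mod_cast hhN i)) b hb.continuousOn
        (fun x hx => by
          simp only [Set.mem_iInter]
          rintro _ ⟨q, -, hq, rfl⟩
          exact hκ' q x (hq hx)) a h
        ⟨hah.cont, hah.cont_homotopy, hah.apply_zero, hah.apply_one, fun x hx t => by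
          simp only [Set.mem_iInter]
          rintro _ ⟨q, hqN, hq, rfl⟩
          exact hah.constraint x hx t q hqN (hq hx.1)⟩
      refine ⟨a', h', ⟨H'.cont, H'.cont_homotopy, H'.apply_zero, H'.apply_one, ?_⟩, e1, e2⟩
      intro x hx t
      by_cases hxb : x ∈ bdry lo hi
      · rw [e2 x hxb t]; exact hah.constraint x hxb t
      · -- A grid cube containing a point of the relative interior contains the box.
        intro q hqN hxq
        refine Set.mem_iInter₂.1 (H'.constraint x hx t) (κ' q) ⟨q, hqN, fun y hy => ?_, rfl⟩
        refine mem_box.2 fun i => ?_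
        have hx' := mem_box.1 hx i
        have hy' := mem_box.1 hy i
        have hxq' := mem_box.1 hxq i
        rcases (hlh i).eq_or_lt with heq | hlt
        · rw [← heq] at hx' hy'
          have : N * (x i : ℝ) = N * (y i : ℝ) := by linarith [hx'.1, hx'.2, hy'.1, hy'.2]
          rwa [← this]
        · have hhi : hi i = lo i + 1 := le_antisymm (hel i) hlt
          have n1 : N * (x i : ℝ) ≠ lo i := fun h => hxb (mem_bdry.2 ⟨hx, i, hlt, Or.inl h⟩)
          have n2 : N * (x i : ℝ) ≠ hi i := fun h => hxb (mem_bdry.2 ⟨hx, i, hlt, Or.inr h⟩)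
          have s1 : (lo i : ℝ) < N * (x i : ℝ) := lt_of_le_of_ne hx'.1 n1.symm
          have s2 : N * (x i : ℝ) < hi i := lt_of_le_of_ne hx'.2 n2
          have l1 : (q i : ℝ) < hi i := hxq'.1.trans_lt s2
          have l2 : (lo i : ℝ) < (q i + 1 : ℕ) := s1.trans_le hxq'.2
          have l1' : q i < hi i := by exact_mod_cast l1
          have l2' : lo i < q i + 1 := by exact_mod_cast l2
          have : q i = lo i := by omega
          rw [this, ← hhi]
          exact hy'
    · -- Cut the box along a slice.
      push Not at hel
      obtain ⟨i, hi2⟩ := hel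
      let mid := lo i + 1
      let lo' := Function.update lo i mid
      let hi' := Function.update hi i mid
      have lo_le : ∀ j, lo j ≤ lo' j := fun j => by
        by_cases hj : j = i
        · subst hj; simp [lo', mid]
        · simp [lo', hj]
      have hi_le : ∀ j, hi' j ≤ hi j := fun j => by
        by_cases hj : j = i
        · subst hj; simp [hi', mid]; omega
        · simp [hi', hj]
      have lohi' : ∀ j, lo j ≤ hi' j := fun j => by
        by_cases hj : j = i
        · subst hj; simp [hi', mid]
        · simp [hi', hj, hlh j]
      have lo'hi : ∀ j, lo' j ≤ hi j := fun j => by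
        by_cases hj : j = i
        · subst hj; simp [lo', mid]; omega
        · simp [lo', hj, hlh j]
      have lo'hi' : ∀ j, lo' j ≤ hi' j := fun j => by
        by_cases hj : j = i
        · subst hj; simp [lo', hi']
        · simp [lo', hi', hj, hlh j]
      have hi'N : ∀ j, hi' j ≤ N := fun j => (hi_le j).trans (hhN j)
      have lt1 : ∑ j, (hi' j - lo j) < n := by
        rw [← hn]
        refine Finset.sum_lt_sum (fun j _ => Nat.sub_le_sub_right (hi_le j) _) ⟨i, by simp, ?_⟩
        simp [hi', mid]; omega
      have lt2 : ∑ j, (hi j - lo' j) < n := by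
        rw [← hn]
        refine Finset.sum_lt_sum (fun j _ => Nat.sub_le_sub_left (lo_le j) _) ⟨i, by simp, ?_⟩
        simp [lo', mid]; omega
      have lt3 : ∑ j, (hi' j - lo' j) < n :=
        lt_of_le_of_lt (Finset.sum_le_sum fun j _ => Nat.sub_le_sub_left (lo_le j) _) lt1
      have box1 : ∀ x, x ∈ box lo hi' ↔ x ∈ box lo hi ∧ N * (x i : ℝ) ≤ mid := by
        intro x
        rw [mem_box, mem_box]
        constructor
        · intro hx
          refine ⟨fun j => ⟨(hx j).1, (hx j).2.trans (by exact_mod_cast hi_le j)⟩, ?_⟩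
          have := (hx i).2
          simpa [hi'] using this
        · rintro ⟨hx, hxi⟩ j
          refine ⟨(hx j).1, ?_⟩
          by_cases hj : j = i
          · subst hj; simpa [hi'] using hxi
          · simpa [hi', hj] using (hx j).2
      have box2 : ∀ x, x ∈ box lo' hi ↔ x ∈ box lo hi ∧ (mid : ℝ) ≤ N * (x i : ℝ) := by
        intro x
        rw [mem_box, mem_box]
        constructor
        · intro hx
          refine ⟨fun j => ⟨le_trans (by exact_mod_cast lo_le j) (hx j).1, (hx j).2⟩, ?_⟩
          have := (hx i).1
          simpa [lo'] using this
        · rintro ⟨hx, hxi⟩ j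
          refine ⟨?_, (hx j).2⟩
          by_cases hj : j = i
          · subst hj; simpa [lo'] using hxi
          · simpa [lo', hj] using (hx j).1
      have box3 : ∀ x, x ∈ box lo' hi' ↔ x ∈ box lo hi ∧ N * (x i : ℝ) = mid := by
        intro x
        rw [mem_box, mem_box]
        constructor
        · intro hx
          refine ⟨fun j => ⟨le_trans (by exact_mod_cast lo_le j) (hx j).1,
            (hx j).2.trans (by exact_mod_cast hi_le j)⟩, ?_⟩
          have := hx i
          simp only [lo', hi', Function.update_self] at this
          exact le_antisymm this.2 this.1
        · rintro ⟨hx, hxi⟩ j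
          by_cases hj : j = i
          · subst hj; simp [lo', hi', hxi]
          · simpa [lo', hi', hj] using hx j
      have cb := fun lo hi : Fin m → ℕ => isClosed_realBox (fun i : Fin m => (lo i : ℝ) / N)
        (fun i => (hi i : ℝ) / N)
      have cbd := fun lo hi : Fin m → ℕ =>
        isClosed_realBoxBoundary (fun i : Fin m => (lo i : ℝ) / N)
        (fun i => (hi i : ℝ) / N)
      have mid1 : (lo i : ℝ) < mid := by exact_mod_cast Nat.lt_succ_self _
      have mid2 : (mid : ℝ) < hi i := by exact_mod_cast hi2
      -- The boundary of the slice lies in the boundary of the box.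
      have hs : ∀ x ∈ box lo' hi', (x ∈ bdry lo' hi' ↔ x ∈ bdry lo hi) := by
        intro x hx
        have hxi := ((box3 x).1 hx).2
        rw [mem_bdry, mem_bdry]
        constructor
        · rintro ⟨-, j, hj, h⟩
          have hji : j ≠ i := by rintro rfl; simp [lo', hi'] at hj
          exact ⟨((box3 x).1 hx).1, j, by simpa [lo', hi', hji] using hj,
            by simpa [lo', hi', hji] using h⟩
        · rintro ⟨-, j, hj, h⟩
          have hji : j ≠ i := by
            rintro rfl
            rw [hxi] at h
            rcases h with h | h <;> linarith
          exact ⟨hx, j, by simpa [lo', hi', hji] using hj, by simpa [lo', hi', hji] using h⟩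
      obtain ⟨a₃, h₃, H₃, e3, e3'⟩ := ih _ lt3 lo' hi' lo'hi' hi'N rfl a h
        (hah.mono fun x hx => (hs x hx.1).1 hx)
      obtain ⟨a₀, h₀, H₀, f1, f2, f3, f4⟩ := hah.glue (cbd lo hi) (cb lo' hi') H₃
        (fun x hx hx' => (e3 x ((hs x hx').2 hx)).symm)
        (fun x hx hx' t => (e3' x ((hs x hx').2 hx) t).symm)
      have sub1 : bdry lo hi' ⊆ bdry lo hi ∪ box lo' hi' := by
        intro x hx
        obtain ⟨hxb, j, hj, h⟩ := mem_bdry.1 hx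
        obtain ⟨hxB, hxi⟩ := (box1 x).1 hxb
        by_cases hji : j = i
        · subst hji
          rcases h with h | h
          · exact Or.inl (mem_bdry.2 ⟨hxB, j, by omega, Or.inl h⟩)
          · exact Or.inr ((box3 x).2 ⟨hxB, by simpa [hi'] using h⟩)
        · exact Or.inl (mem_bdry.2 ⟨hxB, j, by simpa [hi', hji] using hj,
            by simpa [hi', hji] using h⟩)
      have sub2 : bdry lo' hi ⊆ bdry lo hi ∪ box lo' hi' := by
        intro x hx
        obtain ⟨hxb, j, hj, h⟩ := mem_bdry.1 hx
        obtain ⟨hxB, hxi⟩ := (box2 x).1 hxb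
        by_cases hji : j = i
        · subst hji
          rcases h with h | h
          · exact Or.inr ((box3 x).2 ⟨hxB, by simpa [lo'] using h⟩)
          · exact Or.inl (mem_bdry.2 ⟨hxB, j, by omega, Or.inr h⟩)
        · exact Or.inl (mem_bdry.2 ⟨hxB, j, by simpa [lo', hji] using hj,
            by simpa [lo', hji] using h⟩)
      obtain ⟨a₁, h₁, H₁, g1, g1'⟩ := ih _ lt1 lo hi' lohi' hi'N rfl a₀ h₀ (H₀.mono sub1)
      obtain ⟨a₂, h₂, H₂, g2, g2'⟩ := ih _ lt2 lo' hi lo'hi hhN rfl a₀ h₀ (H₀.mono sub2)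
      have inter : ∀ x ∈ box lo hi', x ∈ box lo' hi → x ∈ bdry lo hi' ∧ x ∈ bdry lo' hi := by
        intro x hx hx'
        have hxi : N * (x i : ℝ) = mid := le_antisymm ((box1 x).1 hx).2 ((box2 x).1 hx').2
        exact ⟨mem_bdry.2 ⟨hx, i, by simp [hi', mid], Or.inr (by simpa [hi'] using hxi)⟩,
          mem_bdry.2 ⟨hx', i, by simp [lo', mid]; omega, Or.inl (by simpa [lo'] using hxi)⟩⟩
      obtain ⟨a₄, h₄, H₄, k1, k2, k3, k4⟩ := H₁.glue (cb lo hi') (cb lo' hi) H₂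
        (fun x hx hx' => by rw [g1 x (inter x hx hx').1, g2 x (inter x hx hx').2])
        (fun x hx hx' t => by rw [g1' x (inter x hx hx').1, g2' x (inter x hx hx').2])
      have cover : ∀ x ∈ box lo hi, x ∈ box lo hi' ∨ x ∈ box lo' hi := fun x hx => by
        rcases le_total (N * (x i : ℝ)) mid with h | h
        · exact Or.inl ((box1 x).2 ⟨hx, h⟩)
        · exact Or.inr ((box2 x).2 ⟨hx, h⟩)
      have bd : ∀ x ∈ bdry lo hi, (x ∈ box lo hi' → x ∈ bdry lo hi') ∧
          (x ∈ box lo' hi → x ∈ bdry lo' hi) := by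
        intro x hx
        obtain ⟨hxB, j, hj, h⟩ := mem_bdry.1 hx
        refine ⟨fun hxb => ?_, fun hxb => ?_⟩
        · by_cases hji : j = i
          · subst hji
            refine mem_bdry.2 ⟨hxb, j, by simp [hi', mid], ?_⟩
            rcases h with h | h
            · exact Or.inl h
            · have := ((box1 x).1 hxb).2
              linarith
          · exact mem_bdry.2 ⟨hxb, j, by simpa [hi', hji] using hj, by simpa [hi', hji] using h⟩
        · by_cases hji : j = i
          · subst hji
            refine mem_bdry.2 ⟨hxb, j, by simp [lo', mid]; omega, ?_⟩
            rcases h with h | h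
            · have := ((box2 x).1 hxb).2
              linarith
            · exact Or.inr h
          · exact mem_bdry.2 ⟨hxb, j, by simpa [lo', hji] using hj, by simpa [lo', hji] using h⟩
      refine ⟨a₄, h₄, H₄.mono cover, fun x hx => ?_, fun x hx t => ?_⟩
      · rcases cover x hx.1 with h | h
        · rw [k1 x h, g1 x ((bd x hx).1 h), f1 x hx]
        · rw [k2 x h, g2 x ((bd x hx).2 h), f1 x hx]
      · rcases cover x hx.1 with h | h
        · rw [k3 x h, g1' x ((bd x hx).1 h), f3 x hx]
        · rw [k4 x h, g2' x ((bd x hx).2 h), f3 x hx]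
  have hbox : ∀ x, x ∈ box (fun _ => 0) (fun _ => N) := fun x => mem_box.2 fun i =>
    ⟨by have := (x i).2.1; push_cast; positivity, by
      have := (x i).2.2; nlinarith⟩
  have hbd : ∀ x, x ∈ bdry (fun _ => 0) (fun _ => N) ↔ x ∈ Cube.boundary (Fin m) := fun x => by
    rw [mem_bdry]
    constructor
    · rintro ⟨-, i, -, h⟩
      refine ⟨i, h.imp (fun h => ?_) fun h => ?_⟩
      · have : (x i : ℝ) = 0 := by simpa [hNpos.ne'] using h
        exact Subtype.ext this
      · have : (x i : ℝ) = 1 := mul_left_cancel₀ hNpos.ne' (by rw [h, mul_one])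
        exact Subtype.ext this
    · rintro ⟨i, h⟩
      refine ⟨hbox x, i, hN1, h.imp (fun h => ?_) fun h => ?_⟩ <;> simp [h]
  obtain ⟨a', h', H', e1, e2⟩ := good _ (fun _ => 0) (fun _ => N) (fun _ => Nat.zero_le _)
    (fun _ => le_rfl) rfl a (fun p => b p.1)
    ⟨ha.mono fun x hx => (hbd x).1 hx, Continuous.continuousOn (by fun_prop),
      fun x hx => hab x ((hbd x).1 hx), fun _ _ => rfl, fun x _ t q _ hq => hκ' q x hq⟩
  have hu : box (fun _ => 0) (fun _ => N) = Set.univ := Set.eq_univ_of_forall hbox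
  rw [hu] at H'
  exact ⟨a', h', continuousOn_univ.1 H'.cont, by
    have := H'.cont_homotopy
    rwa [Set.univ_prod_univ, continuousOn_univ] at this, fun x hx => e1 x ((hbd x).2 hx),
    fun x => H'.apply_zero x trivial, fun x => H'.apply_one x trivial,
    fun x hx t => e2 x ((hbd x).2 hx) t⟩

end Excision

/-! ### Wedges preserve weak equivalences -/

section Restriction

variable {X Y : Type*} [TopologicalSpace X] [TopologicalSpace Y]

theorem compressesOver_of_restrict {f : X → Y} {O : Set Y} (hne : (f ⁻¹' O).Nonempty)
    (hf : Compresses (O.restrictPreimage f)) : CompressesOver f O := by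
  classical
  intro m b hb hbO a h hah
  obtain ⟨x₀, hx₀⟩ := hne
  have haO : ∀ x ∈ Cube.boundary (Fin m), f (a x) ∈ O := fun x hx => by
    rw [← hah.apply_zero x hx]; exact hah.constraint x hx 0
  let a₁ : (Fin m → I) → f ⁻¹' O := fun x =>
    if hx : x ∈ Cube.boundary (Fin m) then ⟨a x, haO x hx⟩ else ⟨x₀, hx₀⟩
  have ha₁ : ∀ x ∈ Cube.boundary (Fin m), (a₁ x : X) = a x := fun x hx => by simp [a₁, hx]
  let h₁ : (Fin m → I) × I → O := fun p =>
    if hx : p.1 ∈ Cube.boundary (Fin m) then ⟨h p, hah.constraint _ hx _⟩ else ⟨f x₀, hx₀⟩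
  have hh₁ : ∀ x ∈ Cube.boundary (Fin m), ∀ t, (h₁ (x, t) : Y) = h (x, t) := fun x hx t => by
    simp [h₁, hx]
  obtain ⟨a', h', ha', hh', e1, e2, e3, e4⟩ := hf.lift (a := a₁)
    (b := fun x => ⟨b x, hbO x trivial⟩) (h := h₁)
    (IsInducing.subtypeVal.continuousOn_iff.2 (hah.cont.congr ha₁))
    ((continuousOn_univ.1 hb).subtype_mk _)
    (IsInducing.subtypeVal.continuousOn_iff.2
      (hah.cont_homotopy.congr fun p hp => hh₁ p.1 hp.1 p.2))
    (fun x hx => Subtype.ext (by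
      rw [hh₁ x hx, hah.apply_zero x hx, Set.restrictPreimage_coe, ha₁ x hx]))
    (fun x hx => Subtype.ext (by rw [hh₁ x hx, hah.apply_one x hx]))
  exact ⟨fun x => a' x, fun p => h' p,
    ⟨(continuous_subtype_val.comp ha').continuousOn, (continuous_subtype_val.comp hh').continuousOn,
      fun x _ => congrArg Subtype.val (e2 x), fun x _ => congrArg Subtype.val (e3 x),
      fun x _ t => (h' (x, t)).2⟩,
    fun x hx => (congrArg Subtype.val (e1 x hx)).trans (ha₁ x hx),
    fun x hx t => (congrArg Subtype.val (e4 x hx t)).trans (hh₁ x hx t)⟩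

/-- A map between spaces with contractions to corresponding points is a compression equivalence. -/
theorem compresses_of_contraction {f : X → Y} (hf : Continuous f) (x₀ : X) {G : X × I → X}
    (hG : Continuous G) (G0 : ∀ x, G (x, 0) = x) (G1 : ∀ x, G (x, 1) = x₀)
    {H : Y × I → Y} (hH : Continuous H) (H0 : ∀ y, H (y, 0) = y) (H1 : ∀ y, H (y, 1) = f x₀) :
    Compresses f :=
  compresses_of_homotopyEquiv (g := fun _ => x₀) hf continuous_const hG G0 G1 hH H0 H1

end Restriction

/-- A nondegenerate base point has a neighbourhood deformation: a homotopy `H` of the identity and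
a function `τ` that are the two coordinates of a retraction of `X × I` to `X × {0} ∪ {*} × I`. -/
theorem nondegenerate.exists_retraction {X : PtCG.{u}} (hX : nondegenerate X) :
    ∃ (H : C(X.carrier × I, X.carrier)) (τ : C(X.carrier × I, I)),
      (∀ x, H (x, 0) = x) ∧ (∀ x, τ (x, 0) = 0) ∧ (∀ t, H (X.pt, t) = X.pt) ∧
      (∀ t, τ (X.pt, t) = t) ∧ ∀ z, τ z = 0 ∨ H z = X.pt := by
  obtain ⟨R, R0, R1⟩ := hX.2 {z : X.carrier × I // z.2 = 0 ∨ z.1 = X.pt}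
    ⟨fun x => ⟨(x, 0), Or.inl rfl⟩, by fun_prop⟩ ⟨fun t => ⟨(X.pt, t), Or.inr rfl⟩, by fun_prop⟩ rfl
  refine ⟨⟨fun z => (R z).1.1, by fun_prop⟩, ⟨fun z => (R z).1.2, by fun_prop⟩, fun x => ?_,
    fun x => ?_, fun t => ?_, fun t => ?_, fun z => (R z).2⟩
  · exact congrArg (fun w => w.1.1) (R0 x)
  · exact congrArg (fun w => w.1.2) (R0 x)
  · exact congrArg (fun w => w.1.1) (R1 t)
  · exact congrArg (fun w => w.1.2) (R1 t)

section WedgeEquiv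

variable {J : Type} (g : J → PtSpace.{u}) (s : Set J)

/-- The base point of the wedge. -/
def wedgeBase : WedgeCarrier g s := wedgeMk g s (Sum.inl PUnit.unit)

variable {g s}

/-- The point of the wedge given by a point of a summand. -/
def wedgeIn (j : s) (x : fam g j) : WedgeCarrier g s := wedgeMk g s (Sum.inr ⟨j, x⟩)

theorem wedgeIn_pt (j : s) : wedgeIn j (g j).obj.pt = wedgeBase g s :=
  (Quot.sound (WedgeRel.base j)).symm

theorem continuous_wedgeIn (j : s) : Continuous (wedgeIn (g := g) j) :=
  (continuous_wedgeMk g s).comp (continuous_inr.comp continuous_sigmaMk)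

theorem wedge_cases (q : WedgeCarrier g s) :
    q = wedgeBase g s ∨ ∃ (j : s) (x : fam g j), q = wedgeIn j x := by
  obtain ⟨x, rfl⟩ : ∃ y, wedgeMk g s y = q := Quot.exists_rep q
  rcases x with x | ⟨j, x⟩
  · exact Or.inl rfl
  · exact Or.inr ⟨j, x, rfl⟩

open Classical in
/-- The projection of a wedge to one of its summands. -/
noncomputable def wedgeProj (i : s) : C(WedgeCarrier g s, fam g i) :=
  wedgeLift (g i).obj.pt
    (fun j => if h : j = i then ⟨fun x => h ▸ x, by subst h; exact continuous_id⟩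
      else ContinuousMap.const _ (g i).obj.pt) (by
    intro j
    split_ifs with h
    · subst h; rfl
    · rfl)

theorem wedgeProj_base (i : s) : wedgeProj i (wedgeBase g s) = (g i).obj.pt := rfl

open Classical in
theorem wedgeProj_self (i : s) (x : fam g i) : wedgeProj i (wedgeIn i x) = x := by
  change (if h : i = i then (⟨fun x => h ▸ x, _⟩ : C(fam g i, fam g i))
      else ContinuousMap.const _ (g i).obj.pt) x = x
  rw [dif_pos rfl]
  rfl

open Classical in
theorem wedgeProj_of_ne {i j : s} (h : j ≠ i) (x : fam g j) :
    wedgeProj i (wedgeIn j x) = (g i).obj.pt := by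
  change (if h : j = i then (⟨fun x => h ▸ x, _⟩ : C(fam g j, fam g i))
      else ContinuousMap.const _ (g i).obj.pt) x = _
  rw [dif_neg h]
  rfl

theorem eq_base_of_wedgeProj {q : WedgeCarrier g s}
    (h : ∀ i, wedgeProj i q = (g i).obj.pt) : q = wedgeBase g s := by
  rcases wedge_cases q with rfl | ⟨j, x, rfl⟩
  · rfl
  · have := h j
    rw [wedgeProj_self] at this
    rw [this, wedgeIn_pt]

theorem eq_wedgeIn_of_wedgeProj {q : WedgeCarrier g s} (i : s)
    (h : ∀ j, j ≠ i → wedgeProj j q = (g j).obj.pt) : q = wedgeIn i (wedgeProj i q) := by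
  rcases wedge_cases q with rfl | ⟨j, x, rfl⟩
  · rw [wedgeProj_base, wedgeIn_pt]
  · by_cases hj : j = i
    · subst hj; rw [wedgeProj_self]
    · have := h j hj
      rw [wedgeProj_self] at this
      rw [this, wedgeIn_pt, wedgeProj_base, wedgeIn_pt]

theorem wedgeProj_or (q : WedgeCarrier g s) {i j : s} (hij : i ≠ j) :
    wedgeProj i q = (g i).obj.pt ∨ wedgeProj j q = (g j).obj.pt := by
  rcases wedge_cases q with rfl | ⟨k, x, rfl⟩
  · exact Or.inl (wedgeProj_base i)
  · by_cases hk : k = i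
    · subst hk; exact Or.inr (wedgeProj_of_ne hij x)
    · exact Or.inl (wedgeProj_of_ne hk x)

/-- Pointed deformations of the summands induce a deformation of the wedge. -/
theorem exists_wedge_deformation {H : ∀ j : s, C(fam g j × I, fam g j)}
    (h0 : ∀ j x, H j (x, 0) = x) (hpt : ∀ j t, H j ((g j).obj.pt, t) = (g j).obj.pt) :
    ∃ K : C(WedgeCarrier g s × I, WedgeCarrier g s), (∀ q, K (q, 0) = q) ∧
      ∀ i q t, wedgeProj i (K (q, t)) = H i (wedgeProj i q, t) := by
  let K₀ : C(WedgeCarrier g s, C(I, WedgeCarrier g s)) :=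
    wedgeLift (ContinuousMap.const _ (wedgeBase g s))
      (fun j => ContinuousMap.curry ⟨fun z => wedgeIn j (H j z),
        (continuous_wedgeIn j).comp (H j).continuous⟩) (fun j => by
        ext t
        exact (congrArg (wedgeIn j) (hpt j t)).trans (wedgeIn_pt j))
  have K1 : ∀ t, K₀.uncurry (wedgeBase g s, t) = wedgeBase g s := fun t => rfl
  have K2 : ∀ j x t, K₀.uncurry (wedgeIn j x, t) = wedgeIn j (H j (x, t)) := fun j x t => rfl
  refine ⟨K₀.uncurry, fun q => ?_, fun i q t => ?_⟩
  · rcases wedge_cases q with rfl | ⟨j, x, rfl⟩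
    · exact K1 0
    · rw [K2, h0]
  · rcases wedge_cases q with rfl | ⟨j, x, rfl⟩
    · rw [K1, wedgeProj_base, hpt]
    · rw [K2]
      by_cases hj : j = i
      · subst hj; rw [wedgeProj_self, wedgeProj_self]
      · rw [wedgeProj_of_ne hj, wedgeProj_of_ne hj, hpt]

variable (g s) in
/-- The whiskered wedge: the union of the summands, placed at the ends of the legs of a star. A
point consists of a point of the wedge and a point of the star, given by its coordinates along the
legs, of which at most one is not zero; if the former lies in a summand and is not the base point,
the latter is the end of the corresponding leg. -/
def WhiskeredWedge : Type u :=
  {z : WedgeCarrier g s × (s → I) // (∀ i j, i ≠ j → z.2 i = 0 ∨ z.2 j = 0) ∧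
    ∀ i, wedgeProj i z.1 ≠ (g i).obj.pt → z.2 i = 1}

instance : TopologicalSpace (WhiskeredWedge g s) :=
  inferInstanceAs (TopologicalSpace {_z : WedgeCarrier g s × (s → I) // _})

/-- The projection of the whiskered wedge to the wedge. -/
def whiskerProj (z : WhiskeredWedge g s) : WedgeCarrier g s := z.1.1

/-- The coordinates along the legs. -/
def whiskerCoord (z : WhiskeredWedge g s) : s → I := z.1.2

theorem continuous_whiskerProj : Continuous (whiskerProj (g := g) (s := s)) :=
  continuous_fst.comp continuous_subtype_val

theorem continuous_whiskerCoord : Continuous (whiskerCoord (g := g) (s := s)) :=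
  continuous_snd.comp continuous_subtype_val

theorem continuous_whisker {T : Type*} [TopologicalSpace T] {k : T → WhiskeredWedge g s}
    (h1 : Continuous fun t => whiskerProj (k t)) (h2 : Continuous fun t => whiskerCoord (k t)) :
    Continuous k :=
  continuous_induced_rng.2 (h1.prodMk h2)

theorem whisker_ext {z w : WhiskeredWedge g s} (h1 : whiskerProj z = whiskerProj w)
    (h2 : whiskerCoord z = whiskerCoord w) : z = w :=
  Subtype.ext (Prod.ext h1 h2)

theorem whiskerCoord_or (z : WhiskeredWedge g s) {i j : s} (h : i ≠ j) :
    whiskerCoord z i = 0 ∨ whiskerCoord z j = 0 := z.2.1 i j h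

theorem wedgeProj_whiskerProj (z : WhiskeredWedge g s) {i : s} (h : whiskerCoord z i ≠ 1) :
    wedgeProj i (whiskerProj z) = (g i).obj.pt := by
  by_contra h'
  exact h (z.2.2 i h')

theorem whiskerProj_eq_base {z : WhiskeredWedge g s} (h : ∀ i, whiskerCoord z i ≠ 1) :
    whiskerProj z = wedgeBase g s :=
  eq_base_of_wedgeProj fun i => wedgeProj_whiskerProj z (h i)

theorem whiskerProj_eq_wedgeIn {z : WhiskeredWedge g s} {i : s} (h : whiskerCoord z i ≠ 0) :
    whiskerProj z = wedgeIn i (wedgeProj i (whiskerProj z)) :=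
  eq_wedgeIn_of_wedgeProj i fun j hj => wedgeProj_whiskerProj z (by
    rw [(whiskerCoord_or z hj).resolve_right h]; exact zero_ne_one)

/-- Collapsing the legs of the star is a homotopy equivalence from the whiskered wedge to the wedge.
This is where nondegeneracy of the base points enters. -/
theorem exists_whisker_section (g : J → PtSpace.{u}) (s : Set J) :
    Compresses (whiskerProj (g := g) (s := s)) ∧
      ∃ (k : WedgeCarrier g s → WhiskeredWedge g s) (K : C(WedgeCarrier g s × I, WedgeCarrier g s)),
        Compresses k ∧ (∀ q, K (q, 0) = q) ∧ ∀ q, K (q, 1) = whiskerProj (k q) := by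
  choose H τ H0 τ0 Hpt τpt hor using fun j : s => (g j).property.exists_retraction
  obtain ⟨K, K0, K1⟩ := exists_wedge_deformation (g := g) H0 Hpt
  let k : WedgeCarrier g s → WhiskeredWedge g s := fun q =>
    ⟨(K (q, 1), fun i => σ (τ i (wedgeProj i q, 1))), fun i j hij => by
      rcases wedgeProj_or q hij with h | h
      · left; simp only [h, τpt, unitInterval.symm_one]
      · right; simp only [h, τpt, unitInterval.symm_one], fun i hi => by
      rw [K1] at hi
      simp only [(hor i _).resolve_right hi, unitInterval.symm_zero]⟩
  have hk : Continuous k := continuous_whisker (by change Continuous fun q => K (q, 1); fun_prop)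
    (by change Continuous fun q i => σ (τ i (wedgeProj i q, 1)); fun_prop)
  let G : WhiskeredWedge g s × I → WhiskeredWedge g s := fun w =>
    ⟨(K (whiskerProj w.1, w.2), fun i => whiskerCoord w.1 i *
      σ (τ i (wedgeProj i (whiskerProj w.1), w.2))), fun i j hij => by
      rcases whiskerCoord_or w.1 hij with h | h <;> simp [h], fun i hi => by
      rw [K1] at hi
      have h1 : wedgeProj i (whiskerProj w.1) ≠ (g i).obj.pt := fun h => hi (by rw [h, Hpt])
      have h2 : whiskerCoord w.1 i = 1 := w.1.2.2 i h1
      simp only [h2, (hor i _).resolve_right hi, unitInterval.symm_zero, mul_one]⟩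
  have hG : Continuous G := by
    have := continuous_whiskerProj (g := g) (s := s)
    have := continuous_whiskerCoord (g := g) (s := s)
    refine continuous_whisker ?_ ?_
    · change Continuous fun w : WhiskeredWedge g s × I => K (whiskerProj w.1, w.2)
      fun_prop
    · change Continuous fun (w : WhiskeredWedge g s × I) i => whiskerCoord w.1 i *
        σ (τ i (wedgeProj i (whiskerProj w.1), w.2))
      refine continuous_pi fun i => ?_
      have h1 : Continuous fun w : WhiskeredWedge g s × I => whiskerCoord w.1 i := by fun_prop
      have h2 : Continuous fun w : WhiskeredWedge g s × I =>
        σ (τ i (wedgeProj i (whiskerProj w.1), w.2)) := by fun_prop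
      exact h1.mul h2
  have G0 : ∀ z, G (z, 0) = z := fun z => whisker_ext (K0 _) (by
    funext i
    change whiskerCoord z i * σ (τ i (wedgeProj i (whiskerProj z), 0)) = _
    rw [τ0, unitInterval.symm_zero, mul_one])
  have G1 : ∀ z, G (z, 1) = k (whiskerProj z) := fun z => whisker_ext rfl (by
    funext i
    change whiskerCoord z i * σ (τ i (wedgeProj i (whiskerProj z), 1)) =
      σ (τ i (wedgeProj i (whiskerProj z), 1))
    by_cases h : wedgeProj i (whiskerProj z) = (g i).obj.pt
    · rw [h, τpt, unitInterval.symm_one, mul_zero]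
    · have : whiskerCoord z i = 1 := z.2.2 i h
      rw [this, one_mul])
  exact ⟨compresses_of_homotopyEquiv continuous_whiskerProj hk hG G0 G1 K.continuous K0
    fun q => rfl, k, K, compresses_of_homotopyEquiv hk continuous_whiskerProj K.continuous K0
    (fun q => rfl) hG G0 G1, K0, fun q => rfl⟩

variable {g' : J → PtSpace.{u}} (f : ∀ j, g j ⟶ g' j)

/-- The map of wedges induced by maps of the summands. -/
def wedgeMap (s : Set J) : wedge g s ⟶ wedge g' s :=
  wedgeDesc fun j hj => f j ≫ wedgeIncl j hj

theorem wedgeMap_in (j : s) (x : fam g j) :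
    (wedgeMap f s).hom.map (wedgeIn j x) = wedgeIn j ((f j).hom.map x) := rfl

theorem wedgeMap_base : (wedgeMap f s).hom.map (wedgeBase g s) = wedgeBase g' s := rfl

theorem wedgeProj_wedgeMap (i : s) (q : WedgeCarrier g s) :
    wedgeProj i ((wedgeMap f s).hom.map q) = (f i).hom.map (wedgeProj i q) := by
  rcases wedge_cases q with rfl | ⟨j, x, rfl⟩
  · rw [wedgeMap_base, wedgeProj_base, wedgeProj_base, PtCG.map_base]
  · rw [wedgeMap_in]
    by_cases hj : j = i
    · subst hj; rw [wedgeProj_self, wedgeProj_self]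
    · rw [wedgeProj_of_ne hj, wedgeProj_of_ne hj, PtCG.map_base]

/-- The map of whiskered wedges induced by maps of the summands. -/
def whiskerMap (s : Set J) (z : WhiskeredWedge g s) : WhiskeredWedge g' s :=
  ⟨((wedgeMap f s).hom.map (whiskerProj z), whiskerCoord z), z.2.1, fun i hi => z.2.2 i fun h => hi
    ((wedgeProj_wedgeMap f i _).trans ((congrArg (f i).hom.map h).trans (PtCG.map_base _)))⟩

theorem continuous_whiskerMap : Continuous (whiskerMap f s) :=
  continuous_whisker ((wedgeMap f s).hom.map.continuous.comp continuous_whiskerProj)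
    continuous_whiskerCoord

/-- Compression over a part of the star that contains no ends of legs and can be contracted: its
preimages in the whiskered wedges are contractible. -/
theorem compressesOver_whiskerMap_of_contraction {P : (s → I) → Prop} (p₀ : s → I)
    (hp₀ : ∀ i j, i ≠ j → p₀ i = 0 ∨ p₀ j = 0) (hP₀ : P p₀)
    (hP1 : ∀ p, P p → ∀ i, p i ≠ 1) {K : (s → I) × I → s → I} (hK : Continuous K)
    (K0 : ∀ p, K (p, 0) = p) (K1 : ∀ p, P p → (∀ i j, i ≠ j → p i = 0 ∨ p j = 0) → K (p, 1) = p₀)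
    (hPK : ∀ p t, P p → (∀ i j, i ≠ j → p i = 0 ∨ p j = 0) →
      P (K (p, t)) ∧ ∀ i j, i ≠ j → K (p, t) i = 0 ∨ K (p, t) j = 0) :
    CompressesOver (whiskerMap f s) {z | P (whiskerCoord z)} := by
  -- The contraction of the part of the whiskered wedge lying over the given part of the star.
  have main : ∀ g : J → PtSpace.{u}, ∃ G : {z : WhiskeredWedge g s // P (whiskerCoord z)} × I →
      {z : WhiskeredWedge g s // P (whiskerCoord z)}, Continuous G ∧ (∀ z, G (z, 0) = z) ∧
      ∀ z, G (z, 1) =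
        ⟨⟨(wedgeBase g s, p₀), hp₀, fun i hi => (hi (wedgeProj_base i)).elim⟩, hP₀⟩ := by
    intro g
    let G : {z : WhiskeredWedge g s // P (whiskerCoord z)} × I →
        {z : WhiskeredWedge g s // P (whiskerCoord z)} := fun w =>
      ⟨⟨(whiskerProj w.1.1, K (whiskerCoord w.1.1, w.2)),
        (hPK _ w.2 w.1.2 w.1.1.2.1).2, fun i hi =>
          (hi (wedgeProj_whiskerProj w.1.1 (hP1 _ w.1.2 i))).elim⟩,
        (hPK _ w.2 w.1.2 w.1.1.2.1).1⟩
    have hc1 := (continuous_whiskerProj (g := g) (s := s))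
    have hc2 := (continuous_whiskerCoord (g := g) (s := s))
    have hfst : Continuous fun w : {z : WhiskeredWedge g s // P (whiskerCoord z)} × I => w.1.1 :=
      continuous_subtype_val.comp continuous_fst
    refine ⟨G, continuous_induced_rng.2 (continuous_whisker ?_ ?_), fun z => Subtype.ext
      (whisker_ext rfl (K0 _)), fun z => Subtype.ext (whisker_ext ?_ (K1 _ z.2 z.1.2.1))⟩
    · change Continuous fun w : {z : WhiskeredWedge g s // P (whiskerCoord z)} × I =>
        whiskerProj w.1.1
      exact hc1.comp hfst
    · exact hK.comp ((hc2.comp hfst).prodMk continuous_snd)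
    · exact whiskerProj_eq_base (z := z.1) (hP1 _ z.2)
  obtain ⟨G, hG, G0, G1⟩ := main g
  obtain ⟨H, hH, H0, H1⟩ := main g'
  refine compressesOver_of_restrict ⟨⟨(wedgeBase g s, p₀), hp₀,
    fun i hi => (hi (wedgeProj_base i)).elim⟩, hP₀⟩ ?_
  exact compresses_of_contraction (continuous_whiskerMap f).restrictPreimage _ hG G0 G1 hH H0 H1

open Classical in
/-- Compression over the part of the whiskered wedge with a nonzero coordinate along a fixed leg:
that part contains the corresponding summand as a deformation retract. -/
theorem compressesOver_whiskerMap_leg (i : s) (hf : Compresses (f i).hom.map) :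
    CompressesOver (whiskerMap f s) {z | whiskerCoord z i ≠ 0} := by
  have main : ∀ g : J → PtSpace.{u},
      ∃ (r : {z : WhiskeredWedge g s // whiskerCoord z i ≠ 0} → fam g i)
        (e : fam g i → {z : WhiskeredWedge g s // whiskerCoord z i ≠ 0})
        (D : {z : WhiskeredWedge g s // whiskerCoord z i ≠ 0} × I →
          {z : WhiskeredWedge g s // whiskerCoord z i ≠ 0}),
      (∀ z, r z = wedgeProj i (whiskerProj z.1)) ∧ (∀ x, whiskerProj (e x).1 = wedgeIn i x) ∧
      (∀ x, whiskerCoord (e x).1 = Pi.single i 1) ∧ Compresses r ∧ Compresses e ∧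
      Continuous D ∧ (∀ z, D (z, 0) = z) ∧ ∀ z, D (z, 1) = e (r z) := by
    intro g
    have hc1 := (continuous_whiskerProj (g := g) (s := s))
    have hc2 := (continuous_whiskerCoord (g := g) (s := s))
    let r : {z : WhiskeredWedge g s // whiskerCoord z i ≠ 0} → fam g i := fun z =>
      wedgeProj i (whiskerProj z.1)
    have hr : Continuous r := (wedgeProj i).continuous.comp (hc1.comp continuous_subtype_val)
    let e : fam g i → {z : WhiskeredWedge g s // whiskerCoord z i ≠ 0} := fun x =>
      ⟨⟨(wedgeIn i x, Pi.single i 1), fun j k hjk => by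
        by_cases hj : j = i
        · right; exact Pi.single_eq_of_ne (fun hk => hjk (hj.trans hk.symm)) _
        · left; exact Pi.single_eq_of_ne hj _, fun j hj => by
        have : j = i := by
          by_contra hji
          exact hj (wedgeProj_of_ne (Ne.symm hji) x)
        subst this
        exact Pi.single_eq_same _ _⟩, by
        change (Pi.single i 1 : s → I) i ≠ 0
        rw [Pi.single_eq_same]; exact one_ne_zero⟩
    have he : Continuous e := continuous_induced_rng.2
      (continuous_whisker (continuous_wedgeIn i) continuous_const)
    let D : {z : WhiskeredWedge g s // whiskerCoord z i ≠ 0} × I →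
        {z : WhiskeredWedge g s // whiskerCoord z i ≠ 0} := fun w =>
      ⟨⟨(whiskerProj w.1.1, Function.update (whiskerCoord w.1.1) i
        (max (whiskerCoord w.1.1 i) w.2)), fun j k hjk => by
          by_cases hj : j = i
          · right
            have hk : k ≠ i := fun hk => hjk (hj.trans hk.symm)
            simp only [Function.update_of_ne hk]
            exact (whiskerCoord_or w.1.1 hk).resolve_right w.1.2
          · left
            simp only [Function.update_of_ne hj]
            exact (whiskerCoord_or w.1.1 hj).resolve_right w.1.2, fun j hj => by
          have h1 : whiskerCoord w.1.1 j = 1 := w.1.1.2.2 j hj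
          by_cases hji : j = i
          · subst hji
            simp only [Function.update_self, h1]
            exact max_eq_left unitInterval.le_one'
          · simp only [Function.update_of_ne hji, h1]⟩, by
        change Function.update (whiskerCoord w.1.1) i (max (whiskerCoord w.1.1 i) w.2) i ≠ 0
        rw [Function.update_self]
        exact ((lt_of_le_of_ne unitInterval.nonneg' (Ne.symm w.1.2)).trans_le
          (le_max_left _ _)).ne'⟩
    have hD : Continuous D := by
      have hfst : Continuous fun w : {z : WhiskeredWedge g s // whiskerCoord z i ≠ 0} × I =>
        w.1.1 := continuous_subtype_val.comp continuous_fst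
      have h1 : Continuous fun w : {z : WhiskeredWedge g s // whiskerCoord z i ≠ 0} × I =>
        whiskerCoord w.1.1 := hc2.comp hfst
      have h2 : Continuous fun w : {z : WhiskeredWedge g s // whiskerCoord z i ≠ 0} × I =>
        whiskerProj w.1.1 := hc1.comp hfst
      refine continuous_induced_rng.2 (continuous_whisker h2 ?_)
      exact h1.update i (((continuous_apply i).comp h1).max continuous_snd)
    have D0 : ∀ z, D (z, 0) = z := fun z => Subtype.ext (whisker_ext rfl (by
      change Function.update (whiskerCoord z.1) i (max (whiskerCoord z.1 i) 0) = _
      rw [max_eq_left unitInterval.nonneg', Function.update_eq_self]))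
    have D1 : ∀ z, D (z, 1) = e (r z) := fun z => Subtype.ext (whisker_ext
      (whiskerProj_eq_wedgeIn (z := z.1) z.2) (by
        change Function.update (whiskerCoord z.1) i (max (whiskerCoord z.1 i) 1) = Pi.single i 1
        funext j
        by_cases hj : j = i
        · subst hj
          rw [Function.update_self, Pi.single_eq_same]
          exact max_eq_right unitInterval.le_one'
        · rw [Function.update_of_ne hj, Pi.single_eq_of_ne hj]
          exact (whiskerCoord_or z.1 hj).resolve_right z.2))
    have hre : ∀ x, r (e x) = x := fun x => wedgeProj_self i x
    have hG : Continuous fun p : fam g i × I => p.1 := continuous_fst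
    exact ⟨r, e, D, fun _ => rfl, fun _ => rfl, fun _ => rfl,
      compresses_of_homotopyEquiv hr he hD D0 D1 hG (fun _ => rfl) fun x => (hre x).symm,
      compresses_of_homotopyEquiv he hr hG (fun _ => rfl) (fun x => (hre x).symm) hD D0 D1,
      hD, D0, D1⟩
  obtain ⟨r, e, D, hr, he1, he2, cr, -, hD, D0, D1⟩ := main g
  obtain ⟨r', e', D', hr', he1', he2', -, ce', -⟩ := main g'
  refine compressesOver_of_restrict ⟨(e (g i).obj.pt).1, (e (g i).obj.pt).2⟩ ?_
  have hc : Continuous (Set.restrictPreimage {z | whiskerCoord z i ≠ 0} (whiskerMap f s)) :=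
    (continuous_whiskerMap f).restrictPreimage
  refine (ce'.comp (hf.comp cr)).of_homotopy
    (G := fun p => Set.restrictPreimage {z | whiskerCoord z i ≠ 0} (whiskerMap f s)
      (D (p.1, σ p.2)))
    (hc.comp (hD.comp (by fun_prop))) (fun z => ?_) (fun z => ?_)
  · refine Subtype.ext (whisker_ext ?_ ?_)
    · simp only [unitInterval.symm_zero, D1]
      change (wedgeMap f s).hom.map (whiskerProj (e (r z)).1) = whiskerProj (e' _).1
      rw [he1, he1', wedgeMap_in]
      rfl
    · simp only [unitInterval.symm_zero, D1]
      change whiskerCoord (e (r z)).1 = whiskerCoord (e' _).1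
      rw [he2, he2']
  · simp only [unitInterval.symm_one, D0]

/-- A finite wedge of weak equivalences of spaces with nondegenerate base points is a weak
equivalence. -/
theorem compresses_wedgeMap [Finite J] (hf : ∀ j, Compresses (f j).hom.map) :
    Compresses (wedgeMap f s).hom.map := by
  classical
  have key : Compresses (whiskerMap f s) := by
    let U : Option s → Set (WhiskeredWedge g' s) := fun o =>
      o.elim {z | ∀ i, whiskerCoord z i ≠ 1} fun i => {z | whiskerCoord z i ≠ 0}
    have hc : ∀ i : s, Continuous fun z : WhiskeredWedge g' s => whiskerCoord z i := fun i =>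
      (continuous_apply i).comp continuous_whiskerCoord
    refine compresses_of_openCover (continuous_whiskerMap f) (U := U) ?_ ?_ ?_
    · rintro (_ | i)
      · have : U none = ⋂ i, {z | whiskerCoord z i ≠ 1} := by
          ext z; simp [U]
        rw [this]
        exact isOpen_iInter_of_finite fun i => isOpen_ne_fun (hc i) continuous_const
      · exact isOpen_ne_fun (hc i) continuous_const
    · intro z
      by_cases h : ∀ i, whiskerCoord z i ≠ 1
      · exact ⟨none, h⟩
      · push Not at h
        obtain ⟨i, hi⟩ := h
        exact ⟨some i, by
          change whiskerCoord z i ≠ 0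
          rw [hi]; exact one_ne_zero⟩
    · intro T hT
      by_cases hT2 : ∃ i j : s, i ≠ j ∧ some i ∈ T ∧ some j ∈ T
      · obtain ⟨i, j, hij, hi, hj⟩ := hT2
        intro m b _ hb
        have h0 := Set.mem_iInter₂.1 (hb 0 trivial)
        rcases whiskerCoord_or (b 0) hij with h | h
        · exact (h0 _ hi h).elim
        · exact (h0 _ hj h).elim
      · push Not at hT2
        by_cases hn : none ∈ T
        · by_cases hs : ∃ i : s, some i ∈ T
          · obtain ⟨i, hi⟩ := hs
            have hTeq : (⋂ o ∈ T, U o) = {z | (∀ j, whiskerCoord z j ≠ 1) ∧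
                whiskerCoord z i ≠ 0} := by
              ext z
              simp only [Set.mem_iInter]
              refine ⟨fun h => ⟨h none hn, h (some i) hi⟩, fun h o ho => ?_⟩
              rcases o with _ | j
              · exact h.1
              · by_cases hij : i = j
                · subst hij; exact h.2
                · exact (hT2 i j hij hi ho).elim
            rw [hTeq]
            -- Contract the open leg to its midpoint.
            let hl : I → I := fun t => ⟨t / 2, by
              have := t.2.1; have := t.2.2; constructor <;> linarith⟩
            have hhl : Continuous hl := by
              refine Continuous.subtype_mk ?_ _
              fun_prop
            have hhl0 : hl 0 = 0 := Subtype.ext (by simp [hl])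
            have hl1 : ∀ t, hl t ≠ 1 := fun t h => by
              have := congrArg Subtype.val h
              have := t.2.2
              simp only [hl, Set.Icc.coe_one] at *
              linarith
            have hl1' : σ (hl 1) = hl 1 := Subtype.ext (by
              simp only [hl, unitInterval.coe_symm_eq, Set.Icc.coe_one]; norm_num)
            refine compressesOver_whiskerMap_of_contraction (P := fun p => (∀ j, p j ≠ 1) ∧ p i ≠ 0)
              f (Pi.single i (hl 1)) ?_ ⟨?_, ?_⟩ (fun p hp => hp.1)
              (K := fun w => Function.update w.1 i (min (max (w.1 i) (hl w.2)) (σ (hl w.2))))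
              ?_ ?_ ?_ ?_
            · intro j k hjk
              by_cases hj : j = i
              · right; exact Pi.single_eq_of_ne (fun hk => hjk (hj.trans hk.symm)) _
              · left; exact Pi.single_eq_of_ne hj _
            · intro j
              by_cases hj : j = i
              · subst hj; rw [Pi.single_eq_same]; exact hl1 1
              · rw [Pi.single_eq_of_ne hj]; exact zero_ne_one
            · rw [Pi.single_eq_same]
              intro h
              have := congrArg Subtype.val h
              simp [hl] at this
            · have h1 : Continuous fun w : (s → I) × I => w.1 i := by fun_prop
              have h2 : Continuous fun w : (s → I) × I => hl w.2 := by fun_prop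
              exact continuous_fst.update i ((h1.max h2).min (unitInterval.continuous_symm.comp h2))
            · intro p
              simp [hhl0, unitInterval.le_one']
            · intro p hp hp'
              funext j
              by_cases hj : j = i
              · subst hj
                rw [Pi.single_eq_same]
                simp only [Function.update_self, hl1']
                exact min_eq_right (le_max_right _ _)
              · rw [Pi.single_eq_of_ne hj]
                simp only [Function.update_of_ne hj]
                exact (hp' j i hj).resolve_right hp.2
            · intro p t hp hp'
              have hpj : ∀ j, j ≠ i → p j = 0 := fun j hj => (hp' j i hj).resolve_right hp.2
              have hne1 : min (max (p i) (hl t)) (σ (hl t)) ≠ 1 := fun h => by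
                have : max (p i) (hl t) = 1 := le_antisymm unitInterval.le_one' (by
                  rw [← h]; exact min_le_left _ _)
                rcases max_choice (p i) (hl t) with h' | h'
                · exact hp.1 i (h'.symm.trans this)
                · exact hl1 t (h'.symm.trans this)
              have hne0 : min (max (p i) (hl t)) (σ (hl t)) ≠ 0 := fun h => by
                rcases min_choice (max (p i) (hl t)) (σ (hl t)) with h' | h'
                · rw [h'] at h
                  exact hp.2 (le_antisymm (by rw [← h]; exact le_max_left _ _)
                    unitInterval.nonneg')
                · rw [h'] at h
                  exact hl1 t (by
                    have := congrArg unitInterval.symm h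
                    simpa using this)
              refine ⟨⟨fun j => ?_, ?_⟩, fun j k hjk => ?_⟩
              · by_cases hj : j = i
                · subst hj; simpa using hne1
                · simp [hj, hpj j hj]
              · simpa using hne0
              · by_cases hj : j = i
                · right
                  have hk : k ≠ i := fun hk => hjk (hj.trans hk.symm)
                  simp [hk, hpj k hk]
                · left; simp [hj, hpj j hj]
          · push Not at hs
            have hTeq : (⋂ o ∈ T, U o) = {z | ∀ j, whiskerCoord z j ≠ 1} := by
              ext z
              simp only [Set.mem_iInter]
              refine ⟨fun h => h none hn, fun h o ho => ?_⟩
              rcases o with _ | j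
              · exact h
              · exact (hs j ho).elim
            rw [hTeq]
            refine compressesOver_whiskerMap_of_contraction (P := fun p => ∀ j, p j ≠ 1)
              f 0 (fun _ _ _ => Or.inl rfl) (fun _ => zero_ne_one) (fun p hp => hp)
              (K := fun w i => min (w.1 i) (σ w.2)) ?_ ?_ ?_ ?_
            · refine continuous_pi fun i => ?_
              fun_prop
            · intro p; funext i; simp [unitInterval.le_one']
            · intro p hp hp'; funext i; simp
            · intro p t hp hp'
              refine ⟨fun j h => hp j (le_antisymm unitInterval.le_one' ?_), fun i j hij => ?_⟩
              · rw [← h]; exact min_le_left _ _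
              · rcases hp' i j hij with h | h <;> simp [h]
        · obtain ⟨o, ho⟩ := hT
          obtain ⟨i, rfl⟩ : ∃ i, o = some i := by
            rcases o with _ | i
            · exact (hn ho).elim
            · exact ⟨i, rfl⟩
          have hTeq : (⋂ o ∈ T, U o) = {z | whiskerCoord z i ≠ 0} := by
            ext z
            simp only [Set.mem_iInter]
            refine ⟨fun h => h (some i) ho, fun h o' ho' => ?_⟩
            rcases o' with _ | j
            · exact (hn ho').elim
            · by_cases hij : i = j
              · subst hij; exact h
              · exact (hT2 i j hij ho ho').elim
          rw [hTeq]
          exact compressesOver_whiskerMap_leg f i (hf i)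
  obtain ⟨-, k, K, ck, K0, K1⟩ := exists_whisker_section g s
  refine ((exists_whisker_section g' s).1.comp (key.comp ck)).of_homotopy
    (G := fun p => (wedgeMap f s).hom.map (K (p.1, σ p.2)))
    ((wedgeMap f s).hom.map.continuous.comp (K.continuous.comp (by fun_prop)))
    (fun q => ?_) (fun q => ?_)
  · rw [unitInterval.symm_zero, K1]; rfl
  · rw [unitInterval.symm_one, K0]

end WedgeEquiv

/-! ### The compactly generated topology of total homotopy fibers -/

section FiberTopology

theorem isClosed_face {S : Type} (A : Set S) : IsClosed (face A) := by
  have : face A = ⋂ i ∈ Aᶜ, {x : S → I | x i = 0} := by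
    ext x; simp [face]
  rw [this]
  exact isClosed_biInter fun i _ => isClosed_eq (continuous_apply i) continuous_const

instance {S : Type} (A : Set S) : CompactSpace (face A) :=
  isCompact_iff_compactSpace.1 (isClosed_face A).isCompact

/-- A map to a total homotopy fiber is continuous if its components are, jointly with the points of
the cubes. -/
theorem continuous_to_totalFiber {S : Type} {X : Cube.{u} S} {T : Type*} [TopologicalSpace T]
    [UCompactlyGeneratedSpace.{u} T] {f : T → (totalFiber X).carrier}
    (hf : ∀ A, Continuous fun p : T × face A => (f p.1).1 A p.2) : Continuous f := by
  refine continuous_from_uCompactlyGeneratedSpace f fun K g => ?_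
  have h : Continuous[inferInstance, (inferInstance : TopologicalSpace (FiberSet X))] (f ∘ g) :=
    continuous_fiberSet fun A => ContinuousMap.continuous_of_continuous_uncurry _
      ((hf A).comp (g.continuous.prodMap continuous_id))
  exact continuous_to_compactlyGenerated (X := FiberSet X) K ⟨f ∘ g, h⟩

theorem continuous_totalFiber_eval {S : Type} (X : Cube.{u} S) (A : Set S) :
    Continuous fun p : (totalFiber X).carrier × face A => p.1.1 A p.2 := by
  have h : Continuous fun Φ : (totalFiber X).carrier => Φ.1 A :=
    continuous_totalFiber (continuous_fiberSet_apply A)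
  exact continuous_eval.comp (h.prodMap continuous_id)

theorem continuous_totalFiber_eval_comp {S : Type} {X : Cube.{u} S} {A : Set S} {T : Type*}
    [TopologicalSpace T] {f : T → (totalFiber X).carrier} {g : T → face A} (hf : Continuous f)
    (hg : Continuous g) : Continuous fun t => (f t).1 A (g t) :=
  (continuous_totalFiber_eval X A).comp (hf.prodMk hg)

theorem uCompactlyGeneratedSpace_of_compact (K : Type u) [TopologicalSpace K] [CompactSpace K]
    [T2Space K] : UCompactlyGeneratedSpace.{u} K :=
  uCompactlyGeneratedSpace_of_isClosed fun _ h => by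
    simpa using h (CompHaus.of K) ⟨id, continuous_id⟩

/-- Continuity of a map on a product of a compactly generated space with a compact Hausdorff space
can be tested on compact Hausdorff spaces over the first factor. -/
theorem continuous_prod_of_compHaus {T : Type u} [TopologicalSpace T]
    [UCompactlyGeneratedSpace.{u} T] {D : Type} [TopologicalSpace D] [CompactSpace D] [T2Space D]
    {Y : Type*} [TopologicalSpace Y] {f : T × D → Y}
    (hf : ∀ (K : CompHaus.{u}) (g : C(K, T)), Continuous fun p : K × D => f (g p.1, p.2)) :
    Continuous f := by
  have hc : ∀ t, Continuous fun d => f (t, d) := fun t =>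
    (hf (CompHaus.of PUnit) (ContinuousMap.const _ t)).comp (Continuous.prodMk_right PUnit.unit)
  let F : T → C(D, Y) := fun t => ⟨fun d => f (t, d), hc t⟩
  have hF : Continuous F := continuous_from_uCompactlyGeneratedSpace F fun K g =>
    ContinuousMap.continuous_of_continuous_uncurry _ (hf K g)
  exact continuous_eval.comp (hF.prodMap continuous_id)

theorem continuous_prod_to_totalFiber {S : Type} {X : Cube.{u} S} {T : Type u} [TopologicalSpace T]
    [UCompactlyGeneratedSpace.{u} T] {D : Type} [TopologicalSpace D] [CompactSpace D] [T2Space D]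
    {f : T × D → (totalFiber X).carrier}
    (hf : ∀ A, Continuous fun p : (T × D) × face A => (f p.1).1 A p.2) : Continuous f :=
  continuous_prod_of_compHaus fun K g =>
    have : UCompactlyGeneratedSpace.{u} (K × D) := uCompactlyGeneratedSpace_of_compact _
    continuous_to_totalFiber fun A =>
      (hf A).comp ((g.continuous.prodMap continuous_id).prodMap continuous_id)

theorem fiberSet_natural {S : Type} {X : Cube.{u} S} (Φ : FiberSet X) {A B : Set S} (h : A ⊆ B)
    {x y : S → I} (hx : x ∈ face A) (hy : y ∈ face B) (hxy : x = y) :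
    Φ.1 B ⟨y, hy⟩ = (X.map (homOfLE h)).map (Φ.1 A ⟨x, hx⟩) := by
  subst hxy
  exact (Φ.2.1 A B (homOfLE h) ⟨x, hx⟩).symm

theorem cube_map_self {S : Type} (X : Cube.{u} S) {A : Set S} (h : A ⟶ A) (x : (X.obj A).carrier) :
    (X.map h).map x = x := by
  rw [Subsingleton.elim h (𝟙 A), X.map_id]
  rfl

theorem cube_map_map {S : Type} (X : Cube.{u} S) {A B C : Set S} (h : A ⟶ B) (k : B ⟶ C)
    (l : A ⟶ C) (x : (X.obj A).carrier) : (X.map k).map ((X.map h).map x) = (X.map l).map x := by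
  rw [Subsingleton.elim l (h ≫ k), X.map_comp]
  rfl

end FiberTopology

/-! ### Iterated total homotopy fibers -/

section Iterated

variable {P Q R : Type} (e : R ≃ P ⊕ Q)

/-- The subset of `R ≃ P ⊕ Q` given by subsets of `P` and `Q`. -/
def joinSet (A : Set P) (B : Set Q) : Set R := {r | Sum.elim (· ∈ A) (· ∈ B) (e r)}

/-- The point of `I^R` given by points of `I^P` and `I^Q`. -/
def joinPt (x : P → I) (y : Q → I) (r : R) : I := Sum.elim x y (e r)

/-- The part in `P` of a subset of `R`. -/
def leftSet (C : Set R) : Set P := {p | e.symm (Sum.inl p) ∈ C}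

/-- The part in `Q` of a subset of `R`. -/
def rightSet (C : Set R) : Set Q := {q | e.symm (Sum.inr q) ∈ C}

theorem joinSet_mono {A A' : Set P} {B B' : Set Q} (hA : A ⊆ A') (hB : B ⊆ B') :
    joinSet e A B ⊆ joinSet e A' B' := by
  intro r hr
  change Sum.elim (· ∈ A') (· ∈ B') (e r)
  change Sum.elim (· ∈ A) (· ∈ B) (e r) at hr
  generalize e r = s at hr ⊢
  rcases s with p | q
  · exact hA hr
  · exact hB hr

theorem joinPt_mem {A : Set P} {B : Set Q} {x : P → I} {y : Q → I} (hx : x ∈ face A)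
    (hy : y ∈ face B) : joinPt e x y ∈ face (joinSet e A B) := by
  intro r hr
  change ¬ Sum.elim (· ∈ A) (· ∈ B) (e r) at hr
  change Sum.elim x y (e r) = 0
  generalize e r = s at hr ⊢
  rcases s with p | q
  · exact hx p hr
  · exact hy q hr

theorem joinSet_left_right (C : Set R) : joinSet e (leftSet e C) (rightSet e C) = C := by
  ext r
  change Sum.elim (· ∈ leftSet e C) (· ∈ rightSet e C) (e r) ↔ r ∈ C
  obtain ⟨s, rfl⟩ := e.symm.surjective r
  rcases s with p | q <;> simp [leftSet, rightSet]

theorem leftSet_joinSet (A : Set P) (B : Set Q) : leftSet e (joinSet e A B) = A := by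
  ext p; simp [leftSet, joinSet]

theorem rightSet_joinSet (A : Set P) (B : Set Q) : rightSet e (joinSet e A B) = B := by
  ext q; simp [rightSet, joinSet]

theorem joinPt_left_right (z : R → I) :
    joinPt e (fun p => z (e.symm (Sum.inl p))) (fun q => z (e.symm (Sum.inr q))) = z := by
  funext r
  obtain ⟨s, rfl⟩ := e.symm.surjective r
  rcases s with p | q <;> simp [joinPt]

theorem continuous_joinPt : Continuous fun p : (P → I) × (Q → I) => joinPt e p.1 p.2 := by
  refine continuous_pi fun r => ?_
  unfold joinPt
  rcases e r with p | q
  · exact (continuous_apply p).comp continuous_fst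
  · exact (continuous_apply q).comp continuous_snd

/-- The functor `(A, B) ↦ A ⊔ B` from pairs of subsets of `P` and `Q` to subsets of `R`. -/
def joinFunctor : Set P ⥤ Set Q ⥤ Set R where
  obj A :=
    { obj := fun B => joinSet e A B
      map := fun h => homOfLE (joinSet_mono e subset_rfl (leOfHom h)) }
  map h := { app := fun B => homOfLE (joinSet_mono e (leOfHom h) subset_rfl) }

/-- The cube of total homotopy fibers in the directions `Q` of a cube in the directions
`R ≃ P ⊕ Q`. -/
def iteratedCube : Cube.{u} R ⥤ Cube.{u} P where
  obj Z := joinFunctor e ⋙ (Functor.whiskeringRight _ _ _).obj Z ⋙ totalFiberFunctor Q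
  map α := Functor.whiskerLeft (joinFunctor e)
    (Functor.whiskerRight ((Functor.whiskeringRight _ _ _).map α) (totalFiberFunctor Q))

variable {e}

theorem iterated_natural {Z : Cube.{u} R} (Ψ : FiberSet ((iteratedCube e).obj Z)) {A A' : Set P}
    {B B' : Set Q} (hA : A ⊆ A') (hB : B ⊆ B') {x x' : P → I} {y y' : Q → I} (hx : x ∈ face A)
    (hx' : x' ∈ face A') (hy : y ∈ face B) (hy' : y' ∈ face B') (hxx : x = x') (hyy : y = y') :
    (Ψ.1 A' ⟨x', hx'⟩).1 B' ⟨y', hy'⟩ =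
      (Z.map (homOfLE (joinSet_mono e hA hB))).map ((Ψ.1 A ⟨x, hx⟩).1 B ⟨y, hy⟩) := by
  subst hxx hyy
  have h1 : Ψ.1 A' ⟨x, hx'⟩ = (((iteratedCube e).obj Z).map (homOfLE hA)).map (Ψ.1 A ⟨x, hx⟩) :=
    fiberSet_natural Ψ hA hx hx' rfl
  rw [h1]
  have h2 := fiberSet_natural (Ψ.1 A ⟨x, hx⟩) hB hy hy' rfl
  refine (congrArg (fun z => (Z.map (homOfLE (joinSet_mono e hA subset_rfl))).map z) h2).trans ?_
  exact cube_map_map Z _ _ _ _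

/-- A point of the total homotopy fiber, regarded as a point of the iterated one. -/
def toIterated [Finite P] (Z : Cube.{u} R) (Φ : FiberSet Z) : FiberSet ((iteratedCube e).obj Z) :=
  ⟨fun A => ⟨fun x => (⟨fun B => ⟨fun y => Φ.1 (joinSet e A B) ⟨joinPt e x.1 y.1,
      joinPt_mem e x.2 y.2⟩, by
        refine (Φ.1 _).continuous.comp (Continuous.subtype_mk ?_ _)
        exact (continuous_joinPt e).comp (continuous_const.prodMk continuous_subtype_val)⟩,
      fun B B' h y => Φ.2.1 _ _ (homOfLE (joinSet_mono e subset_rfl (leOfHom h))) _,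
      fun B y q hq hy => Φ.2.2 _ _ (e.symm (Sum.inr q)) (by simpa [joinSet] using hq) (by
        simpa [joinPt] using hy)⟩ : FiberSet ((joinFunctor e).obj A ⋙ Z)), by
      refine continuous_to_totalFiber (X := (joinFunctor e).obj A ⋙ Z) fun B => ?_
      refine (Φ.1 _).continuous.comp (Continuous.subtype_mk ?_ _)
      exact (continuous_joinPt e).comp ((continuous_subtype_val.comp continuous_fst).prodMk
        (continuous_subtype_val.comp continuous_snd))⟩,
    fun A A' h x => Subtype.ext (funext fun B => ContinuousMap.ext fun y =>
      Φ.2.1 _ _ (homOfLE (joinSet_mono e (leOfHom h) subset_rfl)) _),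
    fun A x p hp hx => Subtype.ext (funext fun B => ContinuousMap.ext fun y =>
      Φ.2.2 _ _ (e.symm (Sum.inl p)) (by simpa [joinSet] using hp) (by simpa [joinPt] using hx))⟩

/-- A point of the iterated total homotopy fiber, regarded as a point of the total homotopy
fiber. -/
def fromIterated (Z : Cube.{u} R) (Ψ : FiberSet ((iteratedCube e).obj Z)) : FiberSet Z :=
  ⟨fun C => ⟨fun z : face C => (Z.map (homOfLE (joinSet_left_right e C).le)).map
      ((Ψ.1 (leftSet e C) ⟨fun p => z.1 (e.symm (Sum.inl p)), fun p hp => z.2 _ hp⟩).1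
        (rightSet e C) ⟨fun q => z.1 (e.symm (Sum.inr q)), fun q hq => z.2 _ hq⟩), by
      refine (Z.map _).map.continuous.comp (continuous_totalFiber_eval_comp
        (X := (joinFunctor e).obj (leftSet e C) ⋙ Z)
        (f := fun z : face C => Ψ.1 (leftSet e C)
          ⟨fun p => z.1 (e.symm (Sum.inl p)), fun p hp => z.2 _ hp⟩)
        ((Ψ.1 (leftSet e C)).continuous.comp (Continuous.subtype_mk ?_ _))
        (Continuous.subtype_mk ?_ _)) <;>
      exact continuous_pi fun p => (continuous_apply _).comp continuous_subtype_val⟩, by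
    refine ⟨fun C D h z => ?_, fun C z r hr hz => ?_⟩
    · have hl : leftSet e C ⊆ leftSet e D := fun p hp => leOfHom h hp
      have hr : rightSet e C ⊆ rightSet e D := fun p hp => leOfHom h hp
      refine (cube_map_map Z _ _
        (homOfLE ((joinSet_left_right e C).le.trans (leOfHom h))) _).trans ?_
      refine Eq.trans ?_ (congrArg (fun w => (Z.map (homOfLE (joinSet_left_right e D).le)).map w)
        (iterated_natural Ψ hl hr (fun p hp => z.2 _ hp) _ (fun q hq => z.2 _ hq) _ rfl rfl).symm)
      exact (cube_map_map Z _ _ _ _).symm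
    · obtain ⟨s, rfl⟩ := e.symm.surjective r
      rcases s with p | q
      · have h1 := Ψ.2.2 (leftSet e C) ⟨fun p => z.1 (e.symm (Sum.inl p)), fun p hp => z.2 _ hp⟩ p
          hr hz
        refine (congrArg (fun w : FiberSet ((joinFunctor e).obj (leftSet e C) ⋙ Z) =>
          (Z.map (homOfLE (joinSet_left_right e C).le)).map (w.1 (rightSet e C) _)) h1).trans ?_
        exact PtCG.map_base _
      · have h1 := (Ψ.1 (leftSet e C) ⟨fun p => z.1 (e.symm (Sum.inl p)), fun p hp => z.2 _ hp⟩).2.2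
          (rightSet e C) ⟨fun q => z.1 (e.symm (Sum.inr q)), fun q hq => z.2 _ hq⟩ q hr hz
        exact (congrArg (Z.map (homOfLE (joinSet_left_right e C).le)).map h1).trans
          (PtCG.map_base _)⟩

theorem fromIterated_toIterated [Finite P] (Z : Cube.{u} R) (Φ : FiberSet Z) :
    fromIterated Z (toIterated (e := e) Z Φ) = Φ :=
  Subtype.ext (funext fun C => ContinuousMap.ext fun z =>
    (fiberSet_natural Φ (joinSet_left_right e C).le _ z.2 (joinPt_left_right e z.1)).symm)

theorem toIterated_fromIterated [Finite P] (Z : Cube.{u} R)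
    (Ψ : FiberSet ((iteratedCube e).obj Z)) :
    toIterated Z (fromIterated Z Ψ) = Ψ := by
  refine Subtype.ext (funext fun A => ContinuousMap.ext fun x => Subtype.ext (funext fun B =>
    ContinuousMap.ext fun y => ?_))
  refine (congrArg (fun w => (Z.map (homOfLE (joinSet_left_right e (joinSet e A B)).le)).map w)
    (iterated_natural Ψ (leftSet_joinSet e A B).ge (rightSet_joinSet e A B).ge x.2 _ y.2 _
      (funext fun p => by simp [joinPt]) (funext fun q => by simp [joinPt]))).trans ?_
  exact (cube_map_map Z _ _ (𝟙 _) _).trans (cube_map_self Z _ _)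

theorem continuous_toIterated [Finite P] (Z : Cube.{u} R) :
    Continuous[(totalFiber Z).top, (totalFiber ((iteratedCube e).obj Z)).top]
      (toIterated (e := e) Z) := by
  refine continuous_from_uCompactlyGeneratedSpace
    (X := (totalFiber Z).carrier) (Y := (totalFiber ((iteratedCube e).obj Z)).carrier) _
    fun K g => ?_
  have : UCompactlyGeneratedSpace.{u} K := uCompactlyGeneratedSpace_of_compact _
  have hKA (A : Set P) : UCompactlyGeneratedSpace.{u} (K × face A) :=
    uCompactlyGeneratedSpace_of_compact _
  refine continuous_to_totalFiber (X := (iteratedCube e).obj Z) fun A => ?_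
  refine continuous_to_totalFiber (X := (joinFunctor e).obj A ⋙ Z) fun B => ?_
  refine continuous_totalFiber_eval_comp (X := Z) (A := joinSet e A B)
    (f := fun p : (K × face A) × face B => g p.1.1) (by fun_prop) (Continuous.subtype_mk ?_ _)
  exact (continuous_joinPt e).comp ((continuous_subtype_val.comp
    (continuous_snd.comp continuous_fst)).prodMk (continuous_subtype_val.comp continuous_snd))

theorem continuous_fromIterated (Z : Cube.{u} R) :
    Continuous[(totalFiber ((iteratedCube e).obj Z)).top, (totalFiber Z).top]
      (fromIterated (e := e) Z) := by
  refine continuous_to_totalFiber (X := Z) (T := (totalFiber ((iteratedCube e).obj Z)).carrier)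
    fun C => ?_
  refine (Z.map _).map.continuous.comp (continuous_totalFiber_eval_comp
    (X := (joinFunctor e).obj (leftSet e C) ⋙ Z) (A := rightSet e C)
    (continuous_totalFiber_eval_comp (X := (iteratedCube e).obj Z) (A := leftSet e C)
      continuous_fst (Continuous.subtype_mk ?_ _)) (Continuous.subtype_mk ?_ _)) <;>
  exact continuous_pi fun p =>
    (continuous_apply _).comp (continuous_subtype_val.comp continuous_snd)

/-- An isomorphism of pointed spaces from a pointed homeomorphism. -/
def isoOfHomeo {X Y : PtCG.{u}} (h : X.carrier ≃ₜ Y.carrier) (hpt : h X.pt = Y.pt) : X ≅ Y where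
  hom := ⟨h, hpt⟩
  inv := ⟨h.symm, by rw [← hpt]; exact h.symm_apply_apply _⟩
  hom_inv_id := PtCG.hom_ext fun x => h.symm_apply_apply x
  inv_hom_id := PtCG.hom_ext fun x => h.apply_symm_apply x

variable (e) in
/-- The total homotopy fiber of a cube is the total homotopy fiber of the cube of total homotopy
fibers in some of the directions. -/
def iteratedIso [Finite P] (Z : Cube.{u} R) : totalFiber Z ≅ totalFiber ((iteratedCube e).obj Z) :=
  isoOfHomeo
    (@Homeomorph.mk _ _ (totalFiber Z).top (totalFiber ((iteratedCube e).obj Z)).top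
      ⟨toIterated Z, fromIterated Z, fromIterated_toIterated Z, toIterated_fromIterated Z⟩
      (continuous_toIterated Z) (continuous_fromIterated Z)) rfl

theorem iteratedIso_naturality [Finite P] {Z Z' : Cube.{u} R} (α : Z ⟶ Z') :
    totalFiberMap α ≫ (iteratedIso e Z').hom =
      (iteratedIso e Z).hom ≫ totalFiberMap ((iteratedCube e).map α) := rfl

end Iterated

/-! ### Nondegenerate base points of total homotopy fibers -/

section Extension

theorem uCompactlyGeneratedSpace_coe_of_isClosed {T : Type u} [TopologicalSpace T]
    [UCompactlyGeneratedSpace.{u} T] {A : Set T} (hA : IsClosed A) :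
    UCompactlyGeneratedSpace.{u} A := by
  refine uCompactlyGeneratedSpace_of_isClosed fun s hs => ?_
  rw [hA.isClosedEmbedding_subtypeVal.isClosed_iff_image_isClosed]
  refine UCompactlyGeneratedSpace.isClosed fun K g => ?_
  have hc : IsClosed (g ⁻¹' A) := hA.preimage g.continuous
  have : CompactSpace (g ⁻¹' A) := isCompact_iff_compactSpace.1 hc.isCompact
  have h1 := hs (CompHaus.of (g ⁻¹' A)) ⟨fun k => ⟨g k.1, k.2⟩, by fun_prop⟩
  convert hc.isClosedEmbedding_subtypeVal.isClosedMap _ h1 using 1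
  ext k
  constructor
  · rintro ⟨a, ha, hk⟩
    exact ⟨⟨k, by rw [Set.mem_preimage, ← hk]; exact a.2⟩, by
      change (⟨g k, _⟩ : A) ∈ s
      convert ha using 1
      exact Subtype.ext hk.symm, rfl⟩
  · rintro ⟨k, hk, rfl⟩
    exact ⟨_, hk, rfl⟩

/-- A subset that has a neighbourhood deformation, which moves the points of `{φ ≤ t}` into the
subset by the time `t`, has the homotopy extension property. -/
theorem exists_extension_of_deformation {T Y : Type*} [TopologicalSpace T] [TopologicalSpace Y]
    {A : Set T} (G : C(T × I, T)) (φ : C(T, ℝ)) (hφ : ∀ x, 0 ≤ φ x) (G0 : ∀ x, G (x, 0) = x)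
    (hφA : ∀ a ∈ A, φ a = 0) (hGA : ∀ a ∈ A, ∀ t, G (a, t) = a)
    (hG : ∀ x (t : I), φ x ≤ t → G (x, t) ∈ A) (f : C(T, Y)) (p : C(A × I, Y))
    (hp : ∀ a, p (a, 0) = f a) :
    ∃ K : C(T × I, Y), (∀ x, K (x, 0) = f x) ∧ ∀ (a : A) t, K (a, t) = p (a, t) := by
  classical
  let q : {z : T × I // φ z.1 ≤ z.2} → Y := fun z =>
    p (⟨G z.1, hG _ _ z.2⟩, Set.projIcc 0 1 zero_le_one (z.1.2 - φ z.1.1))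
  have hq : Continuous q := by fun_prop
  let k : T × I → Y := fun z => if h : φ z.1 ≤ z.2 then q ⟨z, h⟩ else f (G z)
  have hk : Continuous k := by
    have hc : IsClosed {z : T × I | φ z.1 ≤ z.2} :=
      isClosed_le (by fun_prop) (by fun_prop)
    have hd : IsClosed {z : T × I | (z.2 : ℝ) ≤ φ z.1} :=
      isClosed_le (by fun_prop) (by fun_prop)
    rw [← continuousOn_univ]
    have hu : (Set.univ : Set (T × I)) = {z | φ z.1 ≤ z.2} ∪ {z | (z.2 : ℝ) ≤ φ z.1} := by
      ext z
      simp [le_total]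
    rw [hu]
    refine ContinuousOn.union_of_isClosed ?_ ?_ hc hd
    · rw [continuousOn_iff_continuous_domRestrict]
      exact hq.congr fun z => (dif_pos z.2 : k z.1 = q z).symm
    · refine ContinuousOn.congr (f := fun z => f (G z)) (by fun_prop) fun z hz => ?_
      by_cases h : φ z.1 ≤ z.2
      · have h' : (z.2 : ℝ) - φ z.1 = 0 := by
          have : (z.2 : ℝ) ≤ φ z.1 := hz
          linarith
        have : Set.projIcc (0 : ℝ) 1 zero_le_one 0 = 0 := Set.projIcc_left _
        simp only [k, dif_pos h, q, h', this, hp]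
      · simp only [k, dif_neg h]
  refine ⟨⟨k, hk⟩, fun x => ?_, fun a t => ?_⟩
  · change k (x, 0) = f x
    by_cases h : φ x ≤ (0 : I)
    · have h' : ((0 : I) : ℝ) - φ x = 0 := by
        have := hφ x
        simp only [Set.Icc.coe_zero] at h ⊢
        linarith
      have : Set.projIcc (0 : ℝ) 1 zero_le_one 0 = 0 := Set.projIcc_left _
      simp only [k, dif_pos h, q, h', this, hp, G0]
    · simp only [k, dif_neg h, G0]
  · have h : φ a.1 ≤ t := by rw [hφA _ a.2]; exact t.2.1
    change k (a, t) = p (a, t)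
    simp only [k, dif_pos h, q, hφA _ a.2, hGA _ a.2, sub_zero, Set.projIcc_val]

/-- A nondegenerate base point is a neighbourhood deformation retract. -/
theorem nondegenerate.exists_deformation {X : PtCG.{u}} (hX : nondegenerate X) :
    ∃ (H : C(X.carrier × I, X.carrier)) (φ : C(X.carrier, ℝ)),
      (∀ x, H (x, 0) = x) ∧ (∀ t, H (X.pt, t) = X.pt) ∧ (∀ x, 0 ≤ φ x) ∧ φ X.pt = 0 ∧
      ∀ x (t : I), φ x ≤ t → H (x, t) = X.pt := by
  obtain ⟨H, τ, H0, τ0, Hpt, τpt, hor⟩ := hX.exists_retraction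
  have hτ : Continuous fun p : X.carrier × I => (p.2 : ℝ) - τ p := by fun_prop
  have hcont : Continuous fun x : X.carrier =>
      sSup ((fun (p : X.carrier) (t : I) => (t : ℝ) - τ (p, t)) x '' Set.univ) :=
    IsCompact.continuous_sSup isCompact_univ hτ
  obtain ⟨M, hM⟩ : ∃ M : C(X.carrier, ℝ),
      ∀ x, M x = sSup ((fun t : I => (t : ℝ) - τ (x, t)) '' Set.univ) := ⟨⟨_, hcont⟩, fun _ => rfl⟩
  have hle (x : X.carrier) (t : I) : (t : ℝ) - τ (x, t) ≤ M x := by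
    rw [hM]
    exact le_csSup (isCompact_univ.image (by fun_prop)).bddAbove ⟨t, trivial, rfl⟩
  refine ⟨H, 2 * M, H0, Hpt, fun x => ?_, ?_, ?_⟩
  · have := hle x 0
    rw [τ0] at this
    simp only [Set.Icc.coe_zero, sub_zero] at this
    change (0 : ℝ) ≤ 2 * M x
    positivity
  · change 2 * M X.pt = 0
    have : (fun t : I => (t : ℝ) - τ (X.pt, t)) '' Set.univ = {0} := by
      simp [τpt]
    rw [hM, this]
    simp
  · intro x t ht
    have hpos : ∀ s : I, 0 < s → t ≤ s → H (x, s) = X.pt := fun s hs hts => by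
      refine (hor (x, s)).resolve_left fun h => ?_
      have h1 := hle x s
      rw [h] at h1
      have h2 : 2 * M x ≤ t := ht
      have h3 : (0 : ℝ) < s := hs
      have h4 : (t : ℝ) ≤ s := hts
      simp only [Set.Icc.coe_zero, sub_zero] at h1
      linarith
    rcases eq_or_lt_of_le (unitInterval.nonneg' (t := t)) with rfl | h
    · -- the set of times at which the point is at the base point is closed
      have hc : IsClosed {s : I | H (x, s) = X.pt} := hX.1.preimage (by fun_prop :
        Continuous fun s : I => H (x, s))
      have hcl : closure (Set.Ioi (0 : I)) ⊆ {s : I | H (x, s) = X.pt} :=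
        closure_minimal (fun s hs => hpos s hs hs.le) hc
      exact hcl (by rw [closure_Ioi' ⟨1, zero_lt_one⟩]; exact Set.self_mem_Ici)
    · exact hpos t h le_rfl

theorem nondegenerate_of_iso {X Y : PtCG.{u}} (i : X ≅ Y) (hX : nondegenerate X) :
    nondegenerate Y := by
  have hi (y : Y.carrier) : i.hom.map (i.inv.map y) = y :=
    congrArg (fun q => q.map y) i.inv_hom_id
  refine ⟨?_, fun Z _ f p hp => ?_⟩
  · convert hX.1.preimage i.inv.map.continuous using 1
    ext y
    simp only [Set.mem_singleton_iff, Set.mem_preimage]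
    exact ⟨fun h => h ▸ i.inv.map_pt, fun h => by rw [← hi y, h, i.hom.map_pt]⟩
  · obtain ⟨H, H0, H1⟩ := hX.2 Z (f.comp i.hom.map) p (by simp [hp])
    refine ⟨⟨fun z => H (i.inv.map z.1, z.2), by fun_prop⟩, fun y => ?_, fun t => ?_⟩
    · exact (H0 _).trans (congrArg f (hi y))
    · exact (congrArg (fun x => H (x, t)) i.inv.map_pt).trans (H1 t)

end Extension

/-! ### Homotopy fibers of maps, as total homotopy fibers of one-dimensional cubes -/

section OneStep

variable {X : Cube.{u} PUnit.{1}}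

theorem continuous_face_apply {S : Type} (A : Set S) (i : S) : Continuous fun y : face A => y.1 i :=
  (continuous_apply i).comp continuous_subtype_val

/-- The map whose homotopy fiber is the total homotopy fiber of a one-dimensional cube. -/
abbrev edgeMap (X : Cube.{u} PUnit.{1}) : X.obj ∅ ⟶ X.obj Set.univ :=
  X.map (homOfLE (Set.empty_subset _))

/-- The initial point of a point of the homotopy fiber. -/
def initialPt (Φ : (totalFiber X).carrier) : (X.obj ∅).carrier := Φ.1 ∅ (faceZero ∅)

/-- The path of a point of the homotopy fiber. -/
def pathPt (Φ : (totalFiber X).carrier) (u : I) : (X.obj Set.univ).carrier :=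
  Φ.1 Set.univ ⟨fun _ => u, fun _ h => (h trivial).elim⟩

theorem pathPt_zero (Φ : (totalFiber X).carrier) : pathPt Φ 0 = (edgeMap X).map (initialPt Φ) :=
  fiberSet_natural Φ (Set.empty_subset Set.univ) _ _ rfl

theorem pathPt_one (Φ : (totalFiber X).carrier) : pathPt Φ 1 = (X.obj Set.univ).pt :=
  Φ.2.2 Set.univ _ PUnit.unit trivial rfl

theorem hofib_ext {Φ Ψ : (totalFiber X).carrier} (h0 : initialPt Φ = initialPt Ψ)
    (h1 : ∀ u, pathPt Φ u = pathPt Ψ u) : Φ = Ψ := by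
  refine Subtype.ext (funext fun A => ContinuousMap.ext fun y => ?_)
  rcases Set.eq_empty_or_nonempty A with rfl | hA
  · have : y = faceZero ∅ := Subtype.ext (funext fun i => y.2 i (by simp))
    rw [this]
    exact h0
  · obtain rfl : A = Set.univ := Set.Nonempty.eq_univ hA
    exact h1 (y.1 PUnit.unit)

theorem continuous_hofib_components {T : Type*} [TopologicalSpace T]
    {f : T → (totalFiber X).carrier}
    (h0 : Continuous fun t => initialPt (f t))
    (h1 : Continuous fun p : T × I => pathPt (f p.1) p.2) (A : Set PUnit.{1}) :
    Continuous fun p : T × face A => (f p.1).1 A p.2 := by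
  rcases Set.eq_empty_or_nonempty A with rfl | hA
  · have : (fun p : T × face (∅ : Set PUnit.{1}) => (f p.1).1 ∅ p.2) =
        fun p => initialPt (f p.1) := by
      funext p
      exact congrArg _ (Subtype.ext (funext fun i => p.2.2 i (by simp)))
    rw [this]
    exact h0.comp continuous_fst
  · obtain rfl : A = Set.univ := Set.Nonempty.eq_univ hA
    have hc : Continuous fun p : T × face (Set.univ : Set PUnit.{1}) => p.2.1 PUnit.unit :=
      (continuous_face_apply _ _).comp continuous_snd
    exact h1.comp (continuous_fst.prodMk hc)

theorem continuous_initialPt : Continuous fun Φ : (totalFiber X).carrier => initialPt Φ :=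
  continuous_totalFiber ((continuous_eval_const (faceZero ∅)).comp (continuous_fiberSet_apply ∅))

theorem continuous_pathPt :
    Continuous fun p : (totalFiber X).carrier × I => pathPt p.1 p.2 :=
  continuous_totalFiber_eval_comp (X := X) (A := Set.univ) continuous_fst (Continuous.subtype_mk
    (continuous_pi fun _ => continuous_snd) _)

open Classical in
/-- The point of the homotopy fiber given by a point and a path. -/
noncomputable def hofibMk (x : (X.obj ∅).carrier) (γ : C(I, (X.obj Set.univ).carrier))
    (h0 : γ 0 = (edgeMap X).map x) (h1 : γ 1 = (X.obj Set.univ).pt) : (totalFiber X).carrier :=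
  (⟨fun A => if h : A = Set.univ then
      ⟨fun y => (X.map (eqToHom h.symm)).map (γ (y.1 PUnit.unit)),
        (X.map (eqToHom h.symm)).map.continuous.comp
          (γ.continuous.comp (continuous_face_apply A PUnit.unit))⟩
    else ContinuousMap.const _ ((X.map (homOfLE (Set.empty_subset A))).map x), by
    refine ⟨fun A B h y => ?_, fun A y i hi hy => ?_⟩
    · by_cases hA : A = Set.univ
      · obtain rfl := hA
        obtain rfl : B = Set.univ := Set.eq_univ_of_univ_subset (leOfHom h)
        simp only [dif_pos]
        exact cube_map_self X _ _
      · obtain rfl : A = ∅ := by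
          by_contra hne
          exact hA (Set.Nonempty.eq_univ (Set.nonempty_iff_ne_empty.2 hne))
        beta_reduce
        rw [dif_neg hA]
        by_cases hB : B = Set.univ
        · obtain rfl := hB
          have : y.1 PUnit.unit = 0 := y.2 _ (by simp)
          rw [dif_pos rfl]
          change (X.map h).map ((X.map _).map x) = (X.map _).map (γ (y.1 PUnit.unit))
          rw [this, h0]
          exact (cube_map_map X _ _ h _).trans (cube_map_map X _ _ h _).symm
        · rw [dif_neg hB]
          exact cube_map_map X _ _ _ _
    · obtain rfl : A = Set.univ := Set.Nonempty.eq_univ ⟨i, hi⟩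
      beta_reduce
      rw [dif_pos rfl]
      change (X.map _).map (γ (y.1 i)) = _
      rw [hy, h1]
      exact PtCG.map_base _⟩ : FiberSet X)

theorem initialPt_hofibMk (x : (X.obj ∅).carrier) (γ : C(I, (X.obj Set.univ).carrier))
    (h0 : γ 0 = (edgeMap X).map x) (h1 : γ 1 = (X.obj Set.univ).pt) :
    initialPt (hofibMk x γ h0 h1) = x := by
  have h : (∅ : Set PUnit.{1}) ≠ Set.univ := Set.empty_ne_univ
  simp only [initialPt, hofibMk, dif_neg h]
  exact cube_map_self X _ _

theorem pathPt_hofibMk (x : (X.obj ∅).carrier) (γ : C(I, (X.obj Set.univ).carrier))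
    (h0 : γ 0 = (edgeMap X).map x) (h1 : γ 1 = (X.obj Set.univ).pt) (u : I) :
    pathPt (hofibMk x γ h0 h1) u = γ u := by
  simp only [pathPt, hofibMk, dif_pos]
  exact cube_map_self X _ _

/-- A family of points of the homotopy fiber is continuous if its points and paths are. -/
theorem continuous_hofibMk {T : Type*} [TopologicalSpace T] [UCompactlyGeneratedSpace.{u} T]
    {x : T → (X.obj ∅).carrier} {γ : T → C(I, (X.obj Set.univ).carrier)}
    {h0 : ∀ t, γ t 0 = (edgeMap X).map (x t)} {h1 : ∀ t, γ t 1 = (X.obj Set.univ).pt}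
    (hx : Continuous x) (hγ : Continuous fun p : T × I => γ p.1 p.2) :
    Continuous fun t => hofibMk (x t) (γ t) (h0 t) (h1 t) :=
  continuous_to_totalFiber (f := fun t => hofibMk (x t) (γ t) (h0 t) (h1 t))
    (continuous_hofib_components (f := fun t => hofibMk (x t) (γ t) (h0 t) (h1 t))
    (by simpa only [initialPt_hofibMk] using hx) (by simpa only [pathPt_hofibMk] using hγ))

theorem continuous_prod_hofibMk {T : Type u} [TopologicalSpace T] [UCompactlyGeneratedSpace.{u} T]
    {x : T × I → (X.obj ∅).carrier} {γ : T × I → C(I, (X.obj Set.univ).carrier)}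
    {h0 : ∀ t, γ t 0 = (edgeMap X).map (x t)} {h1 : ∀ t, γ t 1 = (X.obj Set.univ).pt}
    (hx : Continuous x) (hγ : Continuous fun p : (T × I) × I => γ p.1 p.2) :
    Continuous fun t => hofibMk (x t) (γ t) (h0 t) (h1 t) :=
  continuous_prod_to_totalFiber (f := fun t => hofibMk (x t) (γ t) (h0 t) (h1 t))
    (continuous_hofib_components (f := fun t => hofibMk (x t) (γ t) (h0 t) (h1 t))
    (by simpa only [initialPt_hofibMk] using hx) (by simpa only [pathPt_hofibMk] using hγ))

theorem isClosed_totalFiber_pt {S : Type} {X : Cube.{u} S}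
    (h : ∀ A, IsClosed {(X.obj A).pt}) : IsClosed {(totalFiber X).pt} := by
  have : {(totalFiber X).pt} = ⋂ (A : Set S) (y : face A),
      (fun Φ : (totalFiber X).carrier => Φ.1 A y) ⁻¹' {(X.obj A).pt} := by
    ext Φ
    simp only [Set.mem_singleton_iff, Set.mem_iInter, Set.mem_preimage]
    constructor
    · rintro rfl A y
      rfl
    · exact fun h => Subtype.ext (funext fun A => ContinuousMap.ext fun y => h A y)
  rw [this]
  exact isClosed_iInter fun A => isClosed_iInter fun y => (h A).preimage
    (continuous_totalFiber_eval_comp (X := X) continuous_id continuous_const)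

/-- The homotopy fiber of a map of spaces with nondegenerate base points has a nondegenerate base
point. The inclusion of the base point is the composite of two cofibrations: of the base point in
the subspace of those points that lie over the base point of `X ∅` (this is the loop space of
`X univ`), and of this subspace in the homotopy fiber. -/
theorem nondegenerate_hofib (X : Cube.{u} PUnit.{1}) (hX : ∀ A, nondegenerate (X.obj A)) :
    nondegenerate (totalFiber X) := by
  refine ⟨isClosed_totalFiber_pt fun A => (hX A).1, fun Y _ f p hp => ?_⟩
  obtain ⟨H, φ, H0, Hpt, φ0, φpt, hH⟩ := (hX ∅).exists_deformation
  obtain ⟨H', φ', H0', Hpt', φ0', φpt', hH'⟩ := (hX Set.univ).exists_deformation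
  set ξ := edgeMap X with hξ
  let A : Set (totalFiber X).carrier := {Φ | initialPt Φ = (X.obj ∅).pt}
  have hA : IsClosed A := (hX ∅).1.preimage continuous_initialPt
  have : UCompactlyGeneratedSpace.{u} A := uCompactlyGeneratedSpace_coe_of_isClosed hA
  -- the deformation to the loop space: drag the initial point along `H`, extending the path
  let pr : ℝ → I := Set.projIcc 0 1 zero_le_one
  have hpr : Continuous pr := continuous_projIcc
  have pr0 : pr 0 = 0 := Set.projIcc_left _
  have pr1 : pr 1 = 1 := Set.projIcc_right _
  have prI (t : I) : pr t = t := Set.projIcc_val _ t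
  let m : (totalFiber X).carrier × I → ℝ := fun z => min z.2 (φ (initialPt z.1))
  have hinit : Continuous fun z : (totalFiber X).carrier × I => initialPt z.1 :=
    continuous_initialPt.comp continuous_fst
  have hm : Continuous m := by fun_prop
  have m0 (z) : 0 ≤ m z := le_min z.2.2.1 (φ0 _)
  have m1 (z) : m z ≤ 1 := (min_le_left _ _).trans z.2.2.2
  let c : ((totalFiber X).carrier × I) × I → (X.obj Set.univ).carrier := fun w =>
    if (1 + m w.1) * w.2 ≤ m w.1 then
      ξ.map (H (initialPt w.1.1, pr (m w.1 - (1 + m w.1) * w.2)))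
    else pathPt w.1.1 (pr ((1 + m w.1) * w.2 - m w.1))
  have hc : Continuous c := by
    refine Continuous.if_le ?_ ?_ (by fun_prop) (by fun_prop) fun w hw => ?_
    · exact ξ.map.continuous.comp (H.continuous.comp ((hinit.comp continuous_fst).prodMk
        (hpr.comp (by fun_prop))))
    · exact continuous_pathPt.comp ((continuous_fst.comp continuous_fst).prodMk
        (hpr.comp (by fun_prop)))
    · rw [hw, sub_self, pr0, H0, pathPt_zero]
  have c_eq (z : (totalFiber X).carrier × I) (u : I) : c (z, u) = if (1 + m z) * u ≤ m z then
      ξ.map (H (initialPt z.1, pr (m z - (1 + m z) * u)))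
      else pathPt z.1 (pr ((1 + m z) * u - m z)) := rfl
  have c0 (z : (totalFiber X).carrier × I) : c (z, 0) = ξ.map (H (initialPt z.1, pr (m z))) := by
    rw [c_eq, if_pos (by simpa using m0 z)]
    simp
  have c1 (z : (totalFiber X).carrier × I) : c (z, 1) = (X.obj Set.univ).pt := by
    rw [c_eq, if_neg (by simp), Set.Icc.coe_one, mul_one, add_sub_cancel_right, pr1, pathPt_one]
  have c_of_zero (z : (totalFiber X).carrier × I) (h : m z = 0) (u : I) :
      c (z, u) = pathPt z.1 u := by
    rw [c_eq, h]
    split_ifs with hu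
    · have hu' : (u : ℝ) ≤ 0 := by simpa using hu
      have hu0 : u = 0 := le_antisymm hu' unitInterval.nonneg'
      rw [hu0]
      simp only [Set.Icc.coe_zero, mul_zero, sub_zero, pr0, H0, pathPt_zero, hξ]
    · rw [add_zero, one_mul, sub_zero, prI]
  let G : C((totalFiber X).carrier × I, (totalFiber X).carrier) := ⟨
    (fun z => hofibMk (H (initialPt z.1, pr (m z)))
      ⟨fun u => c (z, u), by fun_prop⟩ (c0 z) (c1 z)),
    (continuous_prod_hofibMk (H.continuous.comp (hinit.prodMk (hpr.comp hm))) hc)⟩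
  have Ginit (z) : initialPt (G z) = H (initialPt z.1, pr (m z)) :=
    initialPt_hofibMk _ _ (c0 z) (c1 z)
  have Gpath (z u) : pathPt (G z) u = c (z, u) :=
    pathPt_hofibMk _ _ (c0 z) (c1 z) u
  have G_of_zero (z : (totalFiber X).carrier × I) (h : m z = 0) : G z = z.1 :=
    hofib_ext (by rw [Ginit, h, pr0, H0]) fun u => by rw [Gpath, c_of_zero z h]
  have ext1 := exists_extension_of_deformation (A := A) G
    ⟨fun Φ => φ (initialPt Φ), φ.continuous.comp continuous_initialPt⟩ (fun _ => φ0 _)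
    (fun Φ => G_of_zero _ (by simp [m, φ0])) (fun Φ hΦ => (congrArg φ hΦ).trans φpt)
    (fun Φ hΦ t => G_of_zero _ (by
      have : φ (initialPt Φ) = 0 := (congrArg φ hΦ).trans φpt
      simp [m, this, t.2.1]))
    (fun Φ t h => by
      refine (Ginit _).trans (hH _ _ ?_)
      have : m (Φ, t) = φ (initialPt Φ) := min_eq_right h
      rw [this]
      exact (congrArg Subtype.val (Set.projIcc_of_mem zero_le_one
        ⟨φ0 _, le_trans h t.2.2⟩)).ge) f
  -- the deformation of the loop space: apply `H'` to the points of the loop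
  let B : Set A := {⟨(totalFiber X).pt, rfl⟩}
  have hpath : Continuous fun w : A × I => pathPt w.1.1 w.2 :=
    continuous_pathPt.comp ((continuous_subtype_val.comp continuous_fst).prodMk continuous_snd)
  have hpt (Φ : A) : ξ.map (X.obj ∅).pt = pathPt Φ.1 0 := by
    rw [pathPt_zero, (Φ.2 : initialPt Φ.1 = _)]
  have h0 (z : A × I) : H' (pathPt z.1.1 0, z.2) = ξ.map (X.obj ∅).pt := by
    rw [← hpt, ξ.map_pt, Hpt']
  have h1 (z : A × I) : H' (pathPt z.1.1 1, z.2) = (X.obj Set.univ).pt := by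
    rw [pathPt_one, Hpt']
  let G' : C(A × I, A) := ⟨fun z => ⟨hofibMk (X.obj ∅).pt
      ⟨fun u => H' (pathPt z.1.1 u, z.2), H'.continuous.comp
        ((hpath.comp (continuous_const.prodMk continuous_id)).prodMk continuous_const)⟩
      (h0 z) (h1 z), initialPt_hofibMk _ _ _ _⟩,
    Continuous.subtype_mk (continuous_prod_hofibMk continuous_const (H'.continuous.comp
      ((hpath.comp ((continuous_fst.comp continuous_fst).prodMk continuous_snd)).prodMk
        (continuous_snd.comp continuous_fst)))) _⟩
  have Gpath' (z u) : pathPt (G' z).1 u = H' (pathPt z.1.1 u, z.2) :=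
    pathPt_hofibMk _ _ (h0 z) (h1 z) u
  have ext_A {Φ Ψ : A} (h : ∀ u, pathPt Φ.1 u = pathPt Ψ.1 u) : Φ = Ψ :=
    Subtype.ext (hofib_ext (Φ.2.trans Ψ.2.symm) h)
  have hsup : Continuous fun Φ : A =>
      sSup ((fun (Φ : A) (u : I) => φ' (pathPt Φ.1 u)) Φ '' Set.univ) :=
    IsCompact.continuous_sSup isCompact_univ (φ'.continuous.comp hpath)
  obtain ⟨M, hM⟩ : ∃ M : C(A, ℝ), ∀ Φ, M Φ =
      sSup ((fun u : I => φ' (pathPt Φ.1 u)) '' Set.univ) := ⟨⟨_, hsup⟩, fun _ => rfl⟩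
  have hle (Φ : A) (u : I) : φ' (pathPt Φ.1 u) ≤ M Φ := by
    rw [hM]
    exact le_csSup (isCompact_univ.image (φ'.continuous.comp
      (hpath.comp (continuous_const.prodMk continuous_id)))).bddAbove ⟨u, trivial, rfl⟩
  have ptpath (u : I) : pathPt (totalFiber X).pt u = (X.obj Set.univ).pt := rfl
  have ext2 := exists_extension_of_deformation (A := B) G' M (fun Φ => (φ0' _).trans (hle Φ 0))
    (fun Φ => ext_A fun u => by rw [Gpath', H0'])
    (fun Φ hΦ => by
      rw [hM, Set.mem_singleton_iff.1 hΦ]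
      simp only [ptpath, φpt']
      simp)
    (fun Φ hΦ t => ext_A fun u => by
      rw [Gpath', Set.mem_singleton_iff.1 hΦ]
      simp only [ptpath, Hpt'])
    (fun Φ t h => ext_A fun u => by
      rw [Gpath', hH' _ _ ((hle Φ u).trans h)]
      rfl) ⟨fun Φ => f Φ.1, by fun_prop⟩ ⟨fun z => p z.2, by fun_prop⟩ (by
        rintro ⟨Φ, hΦ⟩
        exact hp.trans (congrArg (fun Ψ : A => f Ψ.1) (Set.mem_singleton_iff.1 hΦ).symm))
  obtain ⟨K, K0, K1⟩ := ext2
  obtain ⟨L, L0, L1⟩ := ext1 K K0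
  exact ⟨L, L0, fun t => (L1 ⟨(totalFiber X).pt, rfl⟩ t).trans (K1 ⟨_, rfl⟩ t)⟩

end OneStep

/-! ### Reduction to cubes of dimension one -/

section Induction

/-- The total homotopy fiber of a cube of dimension zero. -/
def toInitialIso {S : Type} [IsEmpty S] (X : Cube.{u} S) : totalFiber X ≅ X.obj ∅ where
  hom := toInitial X
  inv := ⟨@ContinuousMap.mk _ _ (X.obj ∅).top (totalFiber X).top
    (fun x => (⟨fun A => ContinuousMap.const _ ((X.map (homOfLE (Set.empty_subset A))).map x),
      fun A B h y => cube_map_map X _ _ _ _, fun A y i => isEmptyElim i⟩ : FiberSet X))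
    (continuous_to_totalFiber (X := X) fun A =>
      (X.map (homOfLE (Set.empty_subset A))).map.continuous.comp continuous_fst),
    Subtype.ext (funext fun A => ContinuousMap.ext fun y => PtCG.map_base _)⟩
  hom_inv_id := totalFiber_hom_ext fun Φ A y =>
    (fiberSet_natural Φ (Set.empty_subset A) (faceZero ∅).2 y.2 (Subsingleton.elim _ _)).symm
  inv_hom_id := PtCG.hom_ext fun x => cube_map_self X _ _

/-- A property of maps of pointed spaces that is preserved by isomorphisms passes from a map of
cubes to the map of total homotopy fibers, if it does so for cubes of dimension one. -/
theorem totalFiber_induction (C : MorphismProperty PtCG.{u}) [C.RespectsIso]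
    (hC : ∀ {X Y : Cube.{u} PUnit.{1}} (α : X ⟶ Y), (∀ A, C (α.app A)) → C (totalFiberMap α))
    (S : Type) [Finite S] :
    ∀ {X Y : Cube.{u} S} (α : X ⟶ Y), (∀ A, C (α.app A)) → C (totalFiberMap α) := by
  have empty {S : Type} [IsEmpty S] {X Y : Cube.{u} S} (α : X ⟶ Y) (h : ∀ A, C (α.app A)) :
      C (totalFiberMap α) := by
    refine (C.arrow_mk_iso_iff (Arrow.isoMk (toInitialIso X) (toInitialIso Y) ?_)).2 (h ∅)
    rfl
  have step {P Q R : Type} [Finite P] (e : R ≃ P ⊕ Q)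
      (hP : ∀ {X Y : Cube.{u} P} (α : X ⟶ Y), (∀ A, C (α.app A)) → C (totalFiberMap α))
      (hQ : ∀ {X Y : Cube.{u} Q} (α : X ⟶ Y), (∀ A, C (α.app A)) → C (totalFiberMap α))
      {X Y : Cube.{u} R} (α : X ⟶ Y) (h : ∀ A, C (α.app A)) : C (totalFiberMap α) := by
    refine (C.arrow_mk_iso_iff (Arrow.isoMk (iteratedIso e X) (iteratedIso e Y)
      (iteratedIso_naturality α).symm)).2 (hP _ fun A => hQ _ fun B => h _)
  induction S using Finite.induction_empty_option with
  | of_equiv e ih =>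
    exact fun α h => step (e.symm.trans (Equiv.emptySum PEmpty.{1} _).symm) empty ih α h
  | h_empty => exact empty
  | h_option ih => exact step (Equiv.optionEquivSumPUnit _) ih hC

/-- The property of maps that the base point of the source is nondegenerate. -/
def sourceNondegenerate : MorphismProperty PtCG.{u} := fun X _ _ => nondegenerate X

instance : sourceNondegenerate.{u}.RespectsIso :=
  MorphismProperty.RespectsIso.mk _ (fun i _ h => nondegenerate_of_iso i.symm h) fun _ _ h => h

theorem nondegenerate_totalFiber {S : Type} [Finite S] (X : Cube.{u} S)
    (hX : ∀ A, nondegenerate (X.obj A)) : nondegenerate (totalFiber X) :=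
  totalFiber_induction sourceNondegenerate (fun {X _} _ h => nondegenerate_hofib X h) S (𝟙 X) hX

end Induction

/-! ### Weak equivalences of total homotopy fibers -/

section HofibCompresses

theorem compresses_iso {X Y : PtCG.{u}} (i : X ≅ Y) : Compresses i.hom.map := by
  have h1 (y : Y.carrier) : i.hom.map (i.inv.map y) = y := congrArg (fun q => q.map y) i.inv_hom_id
  have h2 (x : X.carrier) : i.inv.map (i.hom.map x) = x := congrArg (fun q => q.map x) i.hom_inv_id
  refine ⟨i.hom.map.continuous, fun m a b _ hb hab => ⟨fun x => i.inv.map (b x), fun p => b p.1,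
    by fun_prop, by fun_prop, fun x hx => ?_, fun x => (h1 _).symm, fun x => rfl, fun x _ t => rfl⟩⟩
  exact (congrArg _ (hab x hx)).trans (h2 _)

theorem initialPt_totalFiberMap {X Y : Cube.{u} PUnit.{1}} (α : X ⟶ Y)
    (Φ : (totalFiber X).carrier) :
    initialPt ((totalFiberMap α).map Φ) = (α.app ∅).map (initialPt Φ) := rfl

theorem pathPt_totalFiberMap {X Y : Cube.{u} PUnit.{1}} (α : X ⟶ Y)
    (Φ : (totalFiber X).carrier) (u : I) :
    pathPt ((totalFiberMap α).map Φ) u = (α.app Set.univ).map (pathPt Φ u) := rfl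

/-- A map of homotopy fibers is a weak equivalence if its two components are: first solve the
lifting problem for the initial points, and then the one for the paths, which has one dimension
more. -/
theorem compresses_hofib {X Y : Cube.{u} PUnit.{1}} (α : X ⟶ Y)
    (hα : ∀ A, Compresses (α.app A).map) : Compresses (totalFiberMap α).map := by
  refine ⟨(totalFiberMap α).map.continuous, fun m a b ha hb hab => ?_⟩
  have nat (x : (X.obj ∅).carrier) :
      (edgeMap Y).map ((α.app ∅).map x) = (α.app Set.univ).map ((edgeMap X).map x) :=
    (congrArg (fun q => q.map x) (α.naturality (homOfLE (Set.empty_subset Set.univ)))).symm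
  obtain ⟨a₀, h₀, ha₀, hh₀, a₀_bd, h₀_zero, h₀_one, h₀_bd⟩ := (hα ∅).2 m
    (fun x => initialPt (a x)) (fun x => initialPt (b x))
    (continuous_initialPt.comp_continuousOn ha)
    (continuous_initialPt.comp hb) fun x hx => by rw [hab x hx, initialPt_totalFiberMap]
  have hbp : Continuous fun p : (Fin m → I) × I => pathPt (b p.1) p.2 :=
    continuous_pathPt.comp ((hb.comp continuous_fst).prodMk continuous_snd)
  obtain ⟨k, hk, k_zero, k_one, k_bd⟩ := exists_glue_cylinder
    (b := fun x => (edgeMap X).map (a₀ x)) (c := fun _ => (X.obj Set.univ).pt)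
    (h := fun p => pathPt (a p.1) p.2) ((edgeMap X).map.continuous.comp ha₀) continuous_const
    (continuous_pathPt.comp_continuousOn ((ha.comp continuousOn_fst fun p hp => hp.1).prodMk
      continuousOn_snd)) (fun x hx => by rw [pathPt_zero, a₀_bd x hx]) fun x hx => pathPt_one _
  obtain ⟨N, hN, N_zero, N_one, N_bd⟩ := exists_glue_cylinder
    (b := fun x => (⟨fun t => (edgeMap Y).map (h₀ (x, t)), (edgeMap Y).map.continuous.comp
      (hh₀.comp (Continuous.prodMk_right x))⟩ : C(I, (Y.obj Set.univ).carrier)))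
    (c := fun _ => ContinuousMap.const I (Y.obj Set.univ).pt)
    (h := fun p => ContinuousMap.const I (pathPt (b p.1) p.2))
    (ContinuousMap.continuous_of_continuous_uncurry _ ((edgeMap Y).map.continuous.comp hh₀))
    continuous_const (ContinuousMap.continuous_const'.comp hbp).continuousOn
    (fun x hx => ContinuousMap.ext fun t => by
      change pathPt (b x) 0 = (edgeMap Y).map (h₀ (x, t))
      rw [pathPt_zero, h₀_bd x hx])
    (fun x hx => ContinuousMap.ext fun t => pathPt_one _)
  have hcyl : Continuous (cylinderHomeo m) := (cylinderHomeo m).continuous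
  have cases (y : Fin (m + 1) → I) (hy : y ∈ Cube.boundary (Fin (m + 1))) :=
    mem_boundary_cylinderHomeo.1 hy
  obtain ⟨a₁, h₁, ha₁, hh₁, a₁_bd, h₁_zero, h₁_one, h₁_bd⟩ := (hα Set.univ).lift (m := m + 1)
    (a := fun y => k (cylinderHomeo m y))
    (b := fun y => pathPt (b (cylinderHomeo m y).1) (cylinderHomeo m y).2)
    (h := fun p => N (cylinderHomeo m p.1) p.2)
    (hk.comp hcyl.continuousOn fun y hy => cases y hy) (hbp.comp hcyl)
    (continuous_eval.comp_continuousOn ((hN.comp (hcyl.comp continuous_fst).continuousOn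
      fun p hp => cases p.1 hp.1).prodMk continuousOn_snd))
    (fun y hy => by
      obtain ⟨⟨x, u⟩, rfl⟩ := (cylinderHomeo m).symm.surjective y
      have := cases _ hy
      simp only [Homeomorph.apply_symm_apply] at this ⊢
      rcases this with hx | rfl | rfl
      · rw [N_bd x hx, k_bd x hx, ← pathPt_totalFiberMap, ← hab x hx]
        rfl
      · rw [N_zero, k_zero, ← nat, ← h₀_zero]
        rfl
      · rw [N_one, k_one]
        exact (PtCG.map_base _).symm)
    (fun y hy => by
      obtain ⟨⟨x, u⟩, rfl⟩ := (cylinderHomeo m).symm.surjective y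
      have := cases _ hy
      simp only [Homeomorph.apply_symm_apply] at this ⊢
      rcases this with hx | rfl | rfl
      · rw [N_bd x hx]
        rfl
      · rw [N_zero, pathPt_zero, ← h₀_one]
        rfl
      · rw [N_one, pathPt_one]
        rfl)
  have a_key (x u) (h : x ∈ Cube.boundary (Fin m) ∨ u = 0 ∨ u = 1) :
      a₁ ((cylinderHomeo m).symm (x, u)) = k (x, u) := by
    rw [a₁_bd _ (mem_boundary_cylinderHomeo.2 (by simpa using h)), Homeomorph.apply_symm_apply]
  have h_key (x u) (h : x ∈ Cube.boundary (Fin m) ∨ u = 0 ∨ u = 1) (t) :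
      h₁ ((cylinderHomeo m).symm (x, u), t) = N (x, u) t := by
    rw [h₁_bd _ (mem_boundary_cylinderHomeo.2 (by simpa using h)), Homeomorph.apply_symm_apply]
  have hsymm : Continuous (cylinderHomeo m).symm := (cylinderHomeo m).symm.continuous
  have A0 (x : Fin m → I) : a₁ ((cylinderHomeo m).symm (x, 0)) = (edgeMap X).map (a₀ x) := by
    rw [a_key _ _ (by simp), k_zero]
  have A1 (x : Fin m → I) : a₁ ((cylinderHomeo m).symm (x, 1)) = (X.obj Set.univ).pt := by
    rw [a_key _ _ (by simp), k_one]
  have B0 (z : (Fin m → I) × I) :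
      h₁ ((cylinderHomeo m).symm (z.1, 0), z.2) = (edgeMap Y).map (h₀ z) := by
    rw [h_key _ _ (by simp), N_zero]
    rfl
  have B1 (z : (Fin m → I) × I) :
      h₁ ((cylinderHomeo m).symm (z.1, 1), z.2) = (Y.obj Set.univ).pt := by
    rw [h_key _ _ (by simp), N_one]
    rfl
  refine ⟨fun x => hofibMk (a₀ x) ⟨fun u => a₁ ((cylinderHomeo m).symm (x, u)), by fun_prop⟩
      (A0 x) (A1 x),
    fun z => hofibMk (h₀ z) ⟨fun u => h₁ ((cylinderHomeo m).symm (z.1, u), z.2), by fun_prop⟩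
      (B0 z) (B1 z), continuous_hofibMk ha₀ (ha₁.comp hsymm),
    continuous_hofibMk hh₀ (hh₁.comp (by fun_prop)), fun x hx => ?_, fun x => ?_, fun x => ?_,
    fun x hx t => ?_⟩
  · refine hofib_ext ?_ fun u => ?_
    · rw [initialPt_hofibMk, a₀_bd x hx]
    · rw [pathPt_hofibMk]
      exact (a_key x u (Or.inl hx)).trans (k_bd x hx u)
  · refine hofib_ext ?_ fun u => ?_
    · rw [initialPt_hofibMk, initialPt_totalFiberMap, initialPt_hofibMk, h₀_zero]
    · rw [pathPt_hofibMk, pathPt_totalFiberMap, pathPt_hofibMk]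
      exact h₁_zero _
  · refine hofib_ext ?_ fun u => ?_
    · rw [initialPt_hofibMk, h₀_one]
    · rw [pathPt_hofibMk]
      refine (h₁_one _).trans ?_
      rw [Homeomorph.apply_symm_apply]
  · refine hofib_ext ?_ fun u => ?_
    · rw [initialPt_hofibMk, h₀_bd x hx]
    · rw [pathPt_hofibMk]
      refine (h_key x u (Or.inl hx) t).trans ?_
      rw [N_bd x hx]
      rfl

/-- The property of maps of pointed spaces to be compressible. -/
def compressibleMaps : MorphismProperty PtCG.{u} := fun _ _ f => Compresses f.map

instance : compressibleMaps.{u}.RespectsIso :=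
  MorphismProperty.RespectsIso.mk _ (fun i _ h => h.comp (compresses_iso i))
    fun i _ h => (compresses_iso i).comp h

theorem isWeakEquiv_totalFiberMap {S : Type} [Finite S] {X Y : Cube.{u} S} (α : X ⟶ Y)
    (hα : ∀ A, IsWeakEquiv (α.app A)) : IsWeakEquiv (totalFiberMap α) :=
  (isWeakEquiv_iff_compresses _).2 (totalFiber_induction compressibleMaps
    (fun α h => compresses_hofib α h) S α fun A => (isWeakEquiv_iff_compresses _).1 (hα A))

end HofibCompresses

/-! ### Cross effects of homotopy functors -/

section Perp

variable (n : ℕ)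

theorem isWeakEquiv_copiesMap {J : Type} [Finite J] {X Y : PtSpace.{u}} (f : X ⟶ Y)
    (hf : IsWeakEquiv f.hom) (s : Set J) :
    IsWeakEquiv (copiesMap (id : J → J) f s s fun _ h => h).hom :=
  (isWeakEquiv_iff_compresses _).2 (compresses_wedgeMap (g := fun _ : J => X) (g' := fun _ => Y)
    (s := s) (fun _ => f) fun _ => (isWeakEquiv_iff_compresses _).1 hf)

/-- The diagonal cross effect of a homotopy functor, as a functor to spaces with nondegenerate base
points. -/
noncomputable def perpFunctor (F : HoFunctor.{u}) : PtSpace.{u} ⥤ PtSpace.{u} :=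
  ObjectProperty.lift _ ((perp n).obj F) fun _ =>
    nondegenerate_totalFiber _ fun _ => (F.obj.obj _).property

theorem isHomotopyFunctor_perpFunctor (F : HoFunctor.{u}) : isHomotopyFunctor (perpFunctor n F) :=
  fun _ _ f hf => isWeakEquiv_totalFiberMap _ fun _ => F.property _ (isWeakEquiv_copiesMap f hf _)

/-- The diagonal cross effect as an endofunctor of the category of homotopy functors. -/
noncomputable def perpHo : HoFunctor.{u} ⥤ HoFunctor.{u} where
  obj F := ⟨perpFunctor n F, isHomotopyFunctor_perpFunctor n F⟩
  map α := ObjectProperty.homMk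
    { app := fun X => ObjectProperty.homMk (((perp n).map α).app X)
      naturality := fun _ _ f =>
        ObjectProperty.hom_ext _ (((perp n).map α).naturality f) }

end Perp

/-! ### The comonad structure on cross effects -/

section Points

variable {S J : Type} (D : Set S ⥤ (Set J)ᵒᵖ) (F : HoFunctor.{u}) {X : PtSpace.{u}}

/-- The points of the total homotopy fibers of cubes `A ↦ F (⋁_{j ∈ D A} X)`, for different cubes
and different `F`, are compared through images of their values under `F`. Two such images agree if
they are taken at the same place, and along maps that agree on the summands. -/
theorem map_fiber_congr (Φ : (((fiberOfCopies D).obj F).obj X).carrier) {A B : Set S} (hAB : A = B)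
    {x : face A} {y : face B} (hxy : x.1 = y.1) {W : PtSpace.{u}}
    {g : wedge (fun _ : J => X) (D.obj A).unop ⟶ W} {g' : wedge (fun _ : J => X) (D.obj B).unop ⟶ W}
    (h : ∀ j hj hj', wedgeIncl j hj ≫ g = wedgeIncl j hj' ≫ g') :
    (F.obj.map g).hom.map (Φ.1 A x) = (F.obj.map g').hom.map (Φ.1 B y) := by
  subst hAB
  obtain rfl : x = y := Subtype.ext hxy
  obtain rfl : g = g' := wedge_hom_ext fun j hj => h j hj hj
  rfl

variable {F} in
theorem map_map_apply {U V W : PtSpace.{u}} (f : U ⟶ V) (g : V ⟶ W)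
    (z : (F.obj.obj U).obj.carrier) :
    (F.obj.map g).hom.map ((F.obj.map f).hom.map z) = (F.obj.map (f ≫ g)).hom.map z := by
  rw [F.obj.map_comp]
  rfl

variable {F} in
theorem map_id_apply {U : PtSpace.{u}} (z : (F.obj.obj U).obj.carrier) :
    (F.obj.map (𝟙 U)).hom.map z = z := by
  rw [F.obj.map_id]
  rfl

theorem map_fiber_eq (Φ : (((fiberOfCopies D).obj F).obj X).carrier) {A B : Set S} (hAB : A = B)
    {x : face A} {y : face B} (hxy : x.1 = y.1)
    {g : wedge (fun _ : J => X) (D.obj A).unop ⟶ wedge (fun _ : J => X) (D.obj B).unop}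
    (h : ∀ j hj hj',
      wedgeIncl j hj ≫ g = wedgeIncl (g := fun _ : J => X) j hj') :
    (F.obj.map g).hom.map (Φ.1 A x) = Φ.1 B y :=
  (map_fiber_congr D F Φ hAB hxy fun j hj hj' => (h j hj hj').trans
    (Category.comp_id _).symm).trans (map_id_apply _)

theorem fiber_natural (Φ : (((fiberOfCopies D).obj F).obj X).carrier) {A B : Set S} (h : A ⊆ B)
    {x : face A} {y : face B} (hxy : x.1 = y.1) :
    Φ.1 B y = (F.obj.map (collapseMap _ (D.obj A).unop (D.obj B).unop)).hom.map (Φ.1 A x) :=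
  fiberSet_natural Φ h x.2 y.2 hxy

end Points

section Comultiplication

variable {n : ℕ}

theorem sup_mem_face {S : Type} {A B : Set S} {x y : S → I} (hx : x ∈ face A) (hy : y ∈ face B) :
    x ⊔ y ∈ face (A ∪ B) := fun i hi => by
  rw [Pi.sup_apply, hx i fun h => hi (Or.inl h), hy i fun h => hi (Or.inr h), sup_idem]

theorem continuous_sup_pt {S : Type} : Continuous fun p : (S → I) × (S → I) => p.1 ⊔ p.2 :=
  continuous_pi fun i => by
    change Continuous fun p : (S → I) × (S → I) => p.1 i ⊔ p.2 i
    fun_prop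

/-- The map of wedges that is the identity from the summand `i` to the summand `(i, i)`. -/
def diagIncl {J : Type} (X : PtSpace.{u}) (A B : Set J) :
    wedge (fun _ : J => X) (A ∪ B)ᶜ ⟶ wedge (fun _ : J => wedge (fun _ : J => X) Aᶜ) Bᶜ :=
  wedgeDesc fun i hi => wedgeIncl (g := fun _ : J => X) (s := Aᶜ) i (fun h => hi (Or.inl h)) ≫
    wedgeIncl (g := fun _ : J => wedge (fun _ : J => X) Aᶜ) (s := Bᶜ) i fun h => hi (Or.inr h)

theorem diagIncl_outer {J : Type} (X : PtSpace.{u}) {A A' : Set J} (B : Set J) :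
    diagIncl X A B ≫ copiesMap id (collapseMap (fun _ => X) Aᶜ A'ᶜ) Bᶜ Bᶜ (fun _ h => h) =
      collapseMap (fun _ => X) (A ∪ B)ᶜ (A' ∪ B)ᶜ ≫ diagIncl X A' B := by
  apply wedge_hom_ext
  intro i hi
  have hB : i ∉ B := fun h => hi (Or.inr h)
  by_cases hA' : i ∈ A'
  · have h' : i ∉ (A' ∪ B)ᶜ := fun h => h (Or.inl hA')
    simp [diagIncl, copiesMap, collapseMap, hA', hB]
  · simp [diagIncl, copiesMap, collapseMap, hA', hB]

theorem diagIncl_inner {J : Type} (X : PtSpace.{u}) (A : Set J) {B B' : Set J} :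
    diagIncl X A B ≫ collapseMap (fun _ => wedge (fun _ => X) Aᶜ) Bᶜ B'ᶜ =
      collapseMap (fun _ => X) (A ∪ B)ᶜ (A ∪ B')ᶜ ≫ diagIncl X A B' := by
  apply wedge_hom_ext
  intro i hi
  have hA : i ∉ A := fun h => hi (Or.inl h)
  by_cases hB' : i ∈ B'
  · simp [diagIncl, collapseMap, hA, hB']
  · simp [diagIncl, collapseMap, hA, hB']

/-- The underlying function of the comultiplication. -/
noncomputable def comultFun (F : HoFunctor.{u}) (X : PtSpace.{u})
    (Φ : (((perp n).obj F).obj X).carrier) :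
    (((perp n).obj ((perpHo n).obj F)).obj X).carrier :=
  (⟨fun A => ⟨fun x => (⟨fun B => ⟨fun y => (F.obj.map (diagIncl X A B)).hom.map
      (Φ.1 (A ∪ B) ⟨x.1 ⊔ y.1, sup_mem_face x.2 y.2⟩), by
        refine (F.obj.map _).hom.map.continuous.comp ((Φ.1 _).continuous.comp ?_)
        exact Continuous.subtype_mk
          (continuous_sup_pt.comp (continuous_const.prodMk continuous_subtype_val)) _⟩, by
      refine ⟨fun B B' h y => ?_, fun B y i hi hy => ?_⟩
      · have h1 := fiber_natural (complFunctor (Fin n)) F Φ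
          (Set.union_subset_union_right A (leOfHom h))
          (x := ⟨x.1 ⊔ y.1, sup_mem_face x.2 y.2⟩)
          (y := ⟨x.1 ⊔ y.1, sup_mem_face x.2 (face_mono (leOfHom h) y.2)⟩) rfl
        refine Eq.trans ?_ (congrArg (F.obj.map (diagIncl X A B')).hom.map h1).symm
        refine (map_map_apply _ _ _).trans (Eq.trans ?_ (map_map_apply _ _ _).symm)
        exact congrArg (fun g => (F.obj.map g).hom.map _) (diagIncl_inner X A)
      · have h1 : Φ.1 (A ∪ B) ⟨x.1 ⊔ y.1, sup_mem_face x.2 y.2⟩ = _ := Φ.2.2 _ _ i (Or.inr hi)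
          (by
            change x.1 i ⊔ y.1 i = 1
            rw [hy]; exact sup_of_le_right unitInterval.le_one')
        exact (congrArg (F.obj.map (diagIncl X A B)).hom.map h1).trans (PtCG.map_base _)⟩ :
      (((perp n).obj F).obj (wedge (fun _ => X) Aᶜ)).carrier), by
    refine continuous_to_totalFiber
      (X := crossEffectCube F.obj fun _ : Fin n => wedge (fun _ => X) Aᶜ) fun B => ?_
    refine (F.obj.map _).hom.map.continuous.comp ((Φ.1 _).continuous.comp ?_)
    exact Continuous.subtype_mk (continuous_sup_pt.comp
      ((continuous_subtype_val.comp continuous_fst).prodMk <|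
      continuous_subtype_val.comp continuous_snd)) _⟩, by
    refine ⟨fun A A' h x => ?_, fun A x i hi hx => ?_⟩
    · refine Subtype.ext (funext fun B => ContinuousMap.ext fun y => ?_)
      have h1 := fiber_natural (complFunctor (Fin n)) F Φ
        (Set.union_subset_union_left B (leOfHom h))
        (x := ⟨x.1 ⊔ y.1, sup_mem_face x.2 y.2⟩)
        (y := ⟨x.1 ⊔ y.1, sup_mem_face (face_mono (leOfHom h) x.2) y.2⟩) rfl
      refine Eq.trans ?_ (congrArg (F.obj.map (diagIncl X A' B)).hom.map h1).symm
      refine (map_map_apply _ _ _).trans (Eq.trans ?_ (map_map_apply _ _ _).symm)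
      exact congrArg (fun g => (F.obj.map g).hom.map _) (diagIncl_outer X B)
    · refine Subtype.ext (funext fun B => ContinuousMap.ext fun y => ?_)
      have h1 : Φ.1 (A ∪ B) ⟨x.1 ⊔ y.1, sup_mem_face x.2 y.2⟩ = _ := Φ.2.2 _ _ i (Or.inl hi)
        (by
          change x.1 i ⊔ y.1 i = 1
          rw [hx]; exact sup_of_le_left unitInterval.le_one')
      exact (congrArg (F.obj.map (diagIncl X A B)).hom.map h1).trans (PtCG.map_base _)⟩ :
    FiberSet (crossEffectCube ((perpHo n).obj F).obj fun _ : Fin n => X))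

theorem continuous_comultFun (F : HoFunctor.{u}) (X : PtSpace.{u}) :
    Continuous (comultFun (n := n) F X) := by
  refine continuous_to_totalFiber (T := (((perp n).obj F).obj X).carrier)
    (X := crossEffectCube ((perpHo n).obj F).obj fun _ : Fin n => X) fun A => ?_
  refine continuous_prod_to_totalFiber (T := (((perp n).obj F).obj X).carrier)
    (X := crossEffectCube F.obj fun _ : Fin n => wedge (fun _ => X) Aᶜ) fun B => ?_
  refine (F.obj.map _).hom.map.continuous.comp (continuous_totalFiber_eval_comp
    (X := crossEffectCube F.obj fun _ : Fin n => X) (continuous_fst.comp continuous_fst) ?_)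
  exact Continuous.subtype_mk (continuous_sup_pt.comp ((continuous_subtype_val.comp
    (continuous_snd.comp continuous_fst)).prodMk (continuous_subtype_val.comp continuous_snd))) _

/-- The comultiplication `⊥_n F (X) ⟶ ⊥_n ⊥_n F (X)`: the value of the image of `Φ` at `(x, y)` is
the image of `Φ (max x y)` under the inclusion of the wedge on the summands `(i, i)`. -/
noncomputable def comultHom (F : HoFunctor.{u}) (X : PtSpace.{u}) :
    ((perp n).obj F).obj X ⟶ ((perp n).obj ((perpHo n).obj F)).obj X :=
  ⟨⟨comultFun F X, continuous_comultFun F X⟩,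
    Subtype.ext (funext fun A => ContinuousMap.ext fun x => Subtype.ext (funext fun B =>
      ContinuousMap.ext fun y => (F.obj.map (diagIncl X A B)).hom.map_pt))⟩

theorem perp_perp_hom_ext {F : HoFunctor.{u}} {X : PtSpace.{u}} {Y : PtCG.{u}}
    {f g : Y ⟶ ((perp n).obj ((perpHo n).obj F)).obj X}
    (h : ∀ (y : Y.carrier) (A : Set (Fin n)) (x : face A) (B : Set (Fin n)) (x' : face B),
      Subtype.val ((f.map y).1 A x) B x' = Subtype.val ((g.map y).1 A x) B x') : f = g :=
  totalFiber_hom_ext fun y A x => Subtype.ext (funext fun B => ContinuousMap.ext fun x' =>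
    h y A x B x')

/-- The comultiplication, as a natural transformation. -/
noncomputable def comult (n : ℕ) : perpHo.{u} n ⟶ perpHo n ⋙ perpHo n where
  app F := ObjectProperty.homMk
    { app := fun X => ObjectProperty.homMk (comultHom F X)
      naturality := fun X Y f => by
        apply ObjectProperty.hom_ext
        refine perp_perp_hom_ext fun Φ A x B y => ?_
        refine (map_map_apply _ _ _).trans (Eq.trans ?_ (map_map_apply _ _ _).symm)
        refine map_fiber_congr (complFunctor (Fin n)) F Φ rfl rfl fun j hj hj' => ?_
        rfl }
  naturality F G α := by
    apply ObjectProperty.hom_ext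
    ext X : 2
    apply ObjectProperty.hom_ext
    refine perp_perp_hom_ext fun Φ A x B y => ?_
    exact (congrArg (fun q => q.hom.map (Φ.1 (A ∪ B) ⟨x.1 ⊔ y.1, sup_mem_face x.2 y.2⟩))
      (α.hom.naturality (diagIncl X A B))).symm

/-- The counit, as a natural transformation of endofunctors of the category of homotopy functors. -/
noncomputable def counitHo (n : ℕ) : perpHo.{u} n ⟶ 𝟭 _ where
  app F := ObjectProperty.homMk
    { app := fun X => ObjectProperty.homMk (((counit n).app F).app X)
      naturality := fun _ _ f => ObjectProperty.hom_ext _ (((counit n).app F).naturality f) }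
  naturality F G α := by
    apply ObjectProperty.hom_ext
    ext X : 2
    apply ObjectProperty.hom_ext
    exact congrArg (fun q => q.app X) ((counit n).naturality α)

theorem zero_sup_pt {S : Type} (x : S → I) : (fun _ => 0) ⊔ x = x :=
  funext fun _ => sup_of_le_right unitInterval.nonneg'

theorem sup_zero_pt {S : Type} (x : S → I) : x ⊔ (fun _ => 0) = x :=
  funext fun _ => sup_of_le_left unitInterval.nonneg'

theorem hoFunctor_hom_ext {F G : HoFunctor.{u}} {α β : F ⟶ G}
    (h : ∀ X, (α.hom.app X).hom = (β.hom.app X).hom) : α = β :=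
  ObjectProperty.hom_ext _ (NatTrans.ext (funext fun X => ObjectProperty.hom_ext _ (h X)))

/-- The cotriple `⊥_n` on the category of homotopy functors. -/
noncomputable def perpComonad (n : ℕ) : Comonad HoFunctor.{u} where
  toFunctor := perpHo n
  ε := counitHo n
  δ := comult n
  coassoc F := by
    refine hoFunctor_hom_ext fun X => totalFiber_hom_ext fun Φ A x => Subtype.ext (funext fun B =>
      ContinuousMap.ext fun y => Subtype.ext (funext fun C => ContinuousMap.ext fun z => ?_))
    refine (map_map_apply _ _ _).trans (Eq.trans ?_ (map_map_apply _ _ _).symm)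
    exact map_fiber_congr (complFunctor (Fin n)) F Φ (Set.union_assoc A B C).symm
      (sup_assoc x.1 y.1 z.1).symm fun j hj hj' => rfl
  left_counit F := by
    refine hoFunctor_hom_ext fun X => totalFiber_hom_ext fun Φ A x => ?_
    refine (map_map_apply _ _ _).trans ?_
    exact map_fiber_eq (complFunctor (Fin n)) F Φ (Set.empty_union A) (zero_sup_pt x.1)
      fun j hj hj' => rfl
  right_counit F := by
    refine hoFunctor_hom_ext fun X => totalFiber_hom_ext fun Φ A x => ?_
    refine (map_map_apply _ _ _).trans ?_
    exact map_fiber_eq (complFunctor (Fin n)) F Φ (Set.union_empty A) (sup_zero_pt x.1)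
      fun j hj hj' => rfl

end Comultiplication

/-! ### Iterated cross effects and free cubes -/

section FreeIteration

variable {n k : ℕ}

/-- The directions of the free cube for `k + 1` points: those of the new point `0`, and those of the
free cube for the other `k` points. -/
def consEquiv (n k : ℕ) : Fin (k + 1) × Fin n ≃ Fin n ⊕ (Fin k × Fin n) where
  toFun p := Fin.cases (motive := fun _ => Fin n ⊕ (Fin k × Fin n)) (Sum.inl p.2)
    (fun j => Sum.inr (j, p.2)) p.1
  invFun := Sum.elim (fun u => (0, u)) fun q => (q.1.succ, q.2)
  left_inv p := by
    obtain ⟨i, u⟩ := p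
    refine Fin.cases ?_ (fun j => ?_) i <;> simp
  right_inv s := by
    rcases s with u | ⟨j, u⟩ <;> simp

theorem mem_freeSet_join {A : Set (Fin n)} {B : Set (Fin k × Fin n)} {f : Fin (k + 1) → Fin n} :
    f ∈ freeSet (joinSet (consEquiv n k) A B) ↔ f 0 ∈ Aᶜ ∧ Fin.tail f ∈ freeSet B := by
  constructor
  · refine fun h => ⟨fun h0 => ?_, fun q hq => ?_⟩
    · exact h (show (0, f 0) ∈ joinSet (consEquiv n k) A B from h0) rfl
    · exact h (show (q.1.succ, q.2) ∈ joinSet (consEquiv n k) A B from hq)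
  · rintro ⟨h0, h1⟩ ⟨i, u⟩ hr
    revert hr
    refine Fin.cases (fun hr he => ?_) (fun j hr => ?_) i
    · exact h0 (by
        have he : u = f 0 := he
        rw [← he]
        exact hr)
    · exact h1 (show (j, u) ∈ B from hr)

theorem wedgeIncl_congr {J : Type} {X : PtSpace.{u}} {s : Set J} {i j : J} (h : i = j) (hi : i ∈ s)
    (hj : j ∈ s) : wedgeIncl (g := fun _ : J => X) i hi = wedgeIncl (g := fun _ : J => X) j hj := by
  subst h
  rfl

/-- The wedge over the functions on `k + 1` points, as a wedge of wedges: the summand `f` is the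
summand `f 0` of the summand given by the other values of `f`. -/
def splitWedge (X : PtSpace.{u}) (A : Set (Fin n)) (B : Set (Fin k × Fin n)) :
    wedge (fun _ : Fin (k + 1) → Fin n => X) (freeSet (joinSet (consEquiv n k) A B)) ≅
      wedge (fun _ : Fin k → Fin n => wedge (fun _ : Fin n => X) Aᶜ) (freeSet B) where
  hom := wedgeDesc fun f hf =>
    wedgeIncl (g := fun _ : Fin n => X) (s := Aᶜ) (f 0) (mem_freeSet_join.1 hf).1 ≫
      wedgeIncl (g := fun _ : Fin k → Fin n => wedge (fun _ : Fin n => X) Aᶜ) (s := freeSet B)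
        (Fin.tail f) (mem_freeSet_join.1 hf).2
  inv := wedgeDesc fun f hf => wedgeDesc fun i hi =>
    wedgeIncl (g := fun _ : Fin (k + 1) → Fin n => X)
      (s := freeSet (joinSet (consEquiv n k) A B)) (Fin.cons i f)
      (mem_freeSet_join.2 ⟨hi, hf⟩)
  hom_inv_id := wedge_hom_ext fun f hf => by
    simp only [wedgeIncl_desc_assoc, Category.assoc, wedgeIncl_desc, Category.comp_id]
    exact wedgeIncl_congr (Fin.cons_self_tail f) _ _
  inv_hom_id := wedge_hom_ext fun f hf => wedge_hom_ext fun i hi => by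
    simp only [wedgeIncl_desc_assoc, wedgeIncl_desc, Category.comp_id]
    rfl

theorem splitWedge_outer (X : PtSpace.{u}) {A A' : Set (Fin n)} (B : Set (Fin k × Fin n)) :
    collapseMap (fun _ => X) (freeSet (joinSet (consEquiv n k) A B))
        (freeSet (joinSet (consEquiv n k) A' B)) ≫ (splitWedge X A' B).hom =
      (splitWedge X A B).hom ≫ copiesMap id (collapseMap (fun _ => X) Aᶜ A'ᶜ) (freeSet B)
        (freeSet B) (fun _ h => h) := by
  apply wedge_hom_ext
  intro f hf
  have hB := (mem_freeSet_join.1 hf).2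
  by_cases hA' : f 0 ∈ A'ᶜ
  · have h' := (mem_freeSet_join (A := A')).2 ⟨hA', hB⟩
    simp only [collapseMap, splitWedge, copiesMap, wedgeIncl_desc_assoc, wedgeIncl_desc, dif_pos h',
      dif_pos hA', Category.assoc, id]
  · have h' : f ∉ freeSet (joinSet (consEquiv n k) A' B) := fun h => hA' (mem_freeSet_join.1 h).1
    simp only [collapseMap, splitWedge, copiesMap, wedgeIncl_desc_assoc, wedgeIncl_desc, dif_neg h',
      dif_neg hA', Category.assoc, id, zeroMap_comp]

theorem splitWedge_inner (X : PtSpace.{u}) (A : Set (Fin n)) {B B' : Set (Fin k × Fin n)} :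
    collapseMap (fun _ => X) (freeSet (joinSet (consEquiv n k) A B))
        (freeSet (joinSet (consEquiv n k) A B')) ≫ (splitWedge X A B').hom =
      (splitWedge X A B).hom ≫ collapseMap (fun _ => wedge (fun _ => X) Aᶜ) (freeSet B)
        (freeSet B') := by
  apply wedge_hom_ext
  intro f hf
  have hA := (mem_freeSet_join.1 hf).1
  by_cases hB' : Fin.tail f ∈ freeSet B'
  · have h' := (mem_freeSet_join (B := B')).2 ⟨hA, hB'⟩
    simp only [collapseMap, splitWedge, wedgeIncl_desc_assoc, wedgeIncl_desc, dif_pos h',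
      dif_pos hB', Category.assoc]
  · have h' : f ∉ freeSet (joinSet (consEquiv n k) A B') := fun h => hB' (mem_freeSet_join.1 h).2
    simp only [collapseMap, splitWedge, wedgeIncl_desc_assoc, wedgeIncl_desc, dif_neg h',
      dif_neg hB', Category.assoc, zeroMap_comp, comp_zeroMap]

theorem map_square_apply {F : HoFunctor.{u}} {U V V' W : PtSpace.{u}} {f : U ⟶ V} {g : V ⟶ W}
    {f' : U ⟶ V'} {g' : V' ⟶ W} (h : f ≫ g = f' ≫ g') (z : (F.obj.obj U).obj.carrier) :
    (F.obj.map g).hom.map ((F.obj.map f).hom.map z) =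
      (F.obj.map g').hom.map ((F.obj.map f').hom.map z) := by
  rw [map_map_apply, map_map_apply, h]

/-- The diagonal cross effect of a functor from pointed spaces to pointed compactly generated
spaces. -/
noncomputable def perpCG (n : ℕ) : (PtSpace.{u} ⥤ PtCG.{u}) ⥤ PtSpace.{u} ⥤ PtCG.{u} where
  obj G := copies (Fin n) ⋙ (Functor.whiskeringLeft _ _ _).obj (complFunctor (Fin n)) ⋙
    (Functor.whiskeringRight _ _ _).obj G ⋙ totalFiberFunctor (Fin n)
  map α := Functor.whiskerLeft (copies (Fin n) ⋙
      (Functor.whiskeringLeft _ _ _).obj (complFunctor (Fin n)))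
    (Functor.whiskerRight ((Functor.whiskeringRight _ _ _).map α) (totalFiberFunctor (Fin n)))

/-- The cube of the total homotopy fibers of `F` of the free cubes for `k` points on the vertices of
the cross-effect cube consists of the total homotopy fibers of `F` of the free cube for `k + 1`
points in the directions of the last `k` points. -/
noncomputable def splitCubeIso (n k : ℕ) (F : HoFunctor.{u}) (X : PtSpace.{u}) :
    (iteratedCube (consEquiv n k)).obj
        (freeIndex (Fin (k + 1)) (Fin n) ⋙ (wedges fun _ => X) ⋙ F.obj ⋙ inclPt) ≅
      complFunctor (Fin n) ⋙ (wedges fun _ => X) ⋙ (freeFiber n (Fin k)).obj F :=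
  NatIso.ofComponents (fun A => (totalFiberFunctor _).mapIso
    (NatIso.ofComponents (fun B => (F.obj ⋙ inclPt).mapIso (splitWedge X A B)) (fun _ =>
      PtCG.hom_ext fun z => map_square_apply (splitWedge_inner X A) z)))
    (fun _ => totalFiber_hom_ext fun Φ B y => map_square_apply (splitWedge_outer X B) (Φ.1 B y))

/-- One more cross effect corresponds to one more point. -/
noncomputable def freeFiberSucc (n k : ℕ) :
    freeFiber.{u} n (Fin (k + 1)) ≅ freeFiber n (Fin k) ⋙ perpCG n :=
  NatIso.ofComponents (fun F => NatIso.ofComponents (fun X =>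
      iteratedIso (consEquiv n k)
        (freeIndex (Fin (k + 1)) (Fin n) ⋙ (wedges fun _ => X) ⋙ F.obj ⋙ inclPt) ≪≫
      (totalFiberFunctor _).mapIso (splitCubeIso n k F X))
    (fun {X Y} f => by
      refine totalFiber_hom_ext fun Φ A x => Subtype.ext (funext fun B =>
        ContinuousMap.ext fun y => ?_)
      refine (map_map_apply _ _ _).trans (Eq.trans ?_ (map_map_apply _ _ _).symm)
      exact map_fiber_congr (freeIndex (Fin (k + 1)) (Fin n)) F Φ rfl rfl fun j hj hj' => rfl))
    (fun {F G} α => by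
      ext X : 2
      refine totalFiber_hom_ext fun Φ A x => Subtype.ext (funext fun B =>
        ContinuousMap.ext fun y => ?_)
      exact (congrArg (fun q => q.hom.map (Φ.1 (joinSet (consEquiv n k) A B)
        ⟨joinPt (consEquiv n k) x.1 y.1, joinPt_mem _ x.2 y.2⟩))
        (α.hom.naturality (splitWedge X A B).hom)).symm)

/-- The wedge of the copies of `X` indexed by the unique function on the empty set. -/
def wedgeFinZero (n : ℕ) (X : PtSpace.{u}) :
    wedge (fun _ : Fin 0 → Fin n => X) (freeSet ∅) ≅ X where
  hom := fold X _
  inv := wedgeIncl (g := fun _ : Fin 0 → Fin n => X) Fin.elim0 fun _ h => h.elim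
  hom_inv_id := wedge_hom_ext fun f hf => by
    obtain rfl : f = Fin.elim0 := Subsingleton.elim _ _
    rfl
  inv_hom_id := rfl

/-- For the empty set, the free cube is the space itself. -/
noncomputable def freeFiberZero (n : ℕ) : freeFiber.{u} n (Fin 0) ≅ forgetHo :=
  NatIso.ofComponents (fun F => NatIso.ofComponents (fun X =>
      toInitialIso (freeIndex (Fin 0) (Fin n) ⋙ (wedges fun _ => X) ⋙ F.obj ⋙ inclPt) ≪≫
        (F.obj ⋙ inclPt).mapIso (wedgeFinZero n X))
    (fun {X Y} f => by
      refine PtCG.hom_ext fun Φ => ?_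
      refine (map_map_apply _ _ _).trans (Eq.trans ?_ (map_map_apply _ _ _).symm)
      exact map_fiber_congr (freeIndex (Fin 0) (Fin n)) F Φ rfl rfl fun j hj hj' => rfl))
    (fun {F G} α => by
      ext X : 2
      refine PtCG.hom_ext fun Φ => ?_
      exact (congrArg (fun q => q.hom.map (Φ.1 ∅ (faceZero ∅)))
        (α.hom.naturality (wedgeFinZero n X).hom)).symm)

/-- The iterated cross effects as total homotopy fibers of free cubes; the outermost cross effect
corresponds to the point `0`. -/
noncomputable def iteratePerpIso (n : ℕ) :
    ∀ k : ℕ, iterate (perpHo.{u} n) k ⋙ forgetHo ≅ freeFiber n (Fin k)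
  | 0 => Functor.leftUnitor _ ≪≫ (freeFiberZero n).symm
  | k + 1 => Functor.isoWhiskerLeft (iterate (perpHo n) k)
      (Iso.refl _ : perpHo n ⋙ forgetHo ≅ forgetHo ⋙ perpCG n) ≪≫
      Functor.isoWhiskerRight (iteratePerpIso n k) (perpCG n) ≪≫ (freeFiberSucc n k).symm

theorem iteratePerpIso_one_inv (F : HoFunctor.{u}) (X : PtSpace.{u})
    (Φ : (((freeFiber n (Fin 1)).obj F).obj X).carrier) (A : Set (Fin n)) (x : face A) :
    ((((iteratePerpIso n 1).inv.app F).app X).map Φ : FiberSet (crossEffectCube F.obj fun _ => X)).1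
        A x = (F.obj.map ((splitWedge (k := 0) X A ∅).hom ≫ fold _ _)).hom.map
      (Φ.1 (joinSet (consEquiv n 0) A ∅)
        ⟨joinPt (consEquiv n 0) x.1 fun _ => 0, joinPt_mem _ x.2 (faceZero ∅).2⟩) :=
  map_map_apply _ _ _

theorem iteratePerpIso_two_inv (F : HoFunctor.{u}) (X : PtSpace.{u})
    (Φ : (((freeFiber n (Fin 2)).obj F).obj X).carrier) (A B : Set (Fin n)) (x : face A)
    (y : face B) :
    Subtype.val (((((iteratePerpIso n 2).inv.app F).app X).map Φ :
        FiberSet (crossEffectCube ((perpHo n).obj F).obj fun _ => X)).1 A x) B y =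
      (F.obj.map ((splitWedge (k := 1) X A (joinSet (consEquiv n 0) B ∅)).hom ≫
        (splitWedge (k := 0) _ B ∅).hom ≫ fold _ _)).hom.map
      (Φ.1 (joinSet (consEquiv n 1) A (joinSet (consEquiv n 0) B ∅))
        ⟨joinPt (consEquiv n 1) x.1 (joinPt (consEquiv n 0) y.1 fun _ => 0),
          joinPt_mem _ x.2 (joinPt_mem _ y.2 (faceZero ∅).2)⟩) :=
  (map_map_apply _ _ _).trans (map_map_apply _ _ _)

theorem comp_hom_eq_of_inv_comp_eq {C : Type*} [Category C] {A A' B B' : C} (i : A ≅ A')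
    (j : B ≅ B') {f : A ⟶ B} {g : A' ⟶ B'} (h : i.inv ≫ f = g ≫ j.inv) : f ≫ j.hom = i.hom ≫ g := by
  rw [← Iso.eq_comp_inv, Category.assoc, ← h, Iso.hom_inv_id_assoc]

/-- The counit corresponds to the map from the empty set to the set with one element. -/
theorem iteratePerpIso_counit (F : HoFunctor.{u}) :
    (iteratePerpIso n 1).inv.app F ≫ (counit n).app F =
      (freeFiberMap n (Fin.elim0 : Fin 0 → Fin 1)).app F ≫ (iteratePerpIso n 0).inv.app F := by
  ext X : 2
  refine PtCG.hom_ext fun Φ => ?_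
  refine (congrArg (F.obj.map (fold X (∅ : Set (Fin n))ᶜ)).hom.map
    (iteratePerpIso_one_inv F X Φ ∅ (faceZero ∅))).trans ?_
  refine (map_map_apply _ _ _).trans (Eq.trans ?_ (map_map_apply _ _ _).symm)
  refine map_fiber_congr (freeIndex (Fin 1) (Fin n)) F Φ ?_ ?_ fun j hj hj' => rfl
  · ext ⟨i, u⟩
    obtain rfl : i = 0 := Subsingleton.elim (α := Fin 1) _ _
    exact ⟨fun h => h.elim, fun ⟨_, h, _⟩ => h.elim⟩
  · funext ⟨i, u⟩
    obtain rfl : i = 0 := Subsingleton.elim (α := Fin 1) _ _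
    refine le_antisymm unitInterval.nonneg' ?_
    exact (pushCoord_le_iff _ _ _ _).2 fun p => p.1.elim0

/-- The comultiplication corresponds to the map from a set with two elements to the set with one
element. -/
theorem iteratePerpIso_comult (F : HoFunctor.{u}) :
    (iteratePerpIso n 1).inv.app F ≫ forgetHo.map ((comult n).app F) =
      (freeFiberMap n (fun _ : Fin 2 => (0 : Fin 1))).app F ≫ (iteratePerpIso n 2).inv.app F := by
  ext X : 2
  refine perp_perp_hom_ext fun Φ A x B y => ?_
  refine Eq.trans ?_ (iteratePerpIso_two_inv F X _ A B x y).symm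
  refine (congrArg (F.obj.map (diagIncl X A B)).hom.map (iteratePerpIso_one_inv F X Φ (A ∪ B)
    ⟨x.1 ⊔ y.1, sup_mem_face x.2 y.2⟩)).trans ?_
  refine (map_map_apply _ _ _).trans (Eq.trans ?_ (map_map_apply _ _ _).symm)
  refine map_fiber_congr (freeIndex (Fin 1) (Fin n)) F Φ ?_ ?_ fun j hj hj' => rfl
  · ext ⟨i, u⟩
    obtain rfl : i = 0 := Subsingleton.elim (α := Fin 1) _ _
    change u ∈ A ∪ B ↔ _
    constructor
    · rintro (h | h)
      · exact ⟨(0, u), h, rfl⟩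
      · exact ⟨(1, u), h, rfl⟩
    · rintro ⟨⟨i, v⟩, h, hv⟩
      obtain rfl : v = u := congrArg Prod.snd hv
      revert h
      refine Fin.cases (fun h => Or.inl h) (fun i => ?_) i
      obtain rfl : i = 0 := Subsingleton.elim (α := Fin 1) _ _
      exact fun h => Or.inr h
  · funext ⟨i, u⟩
    obtain rfl : i = 0 := Subsingleton.elim (α := Fin 1) _ _
    change x.1 u ⊔ y.1 u = _
    refine eq_of_forall_ge_iff fun c => ?_
    rw [sup_le_iff]
    refine Iff.trans ?_ (pushCoord_le_iff _ _ _ _).symm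
    constructor
    · rintro ⟨h0, h1⟩ ⟨i, v⟩ hv
      obtain rfl : v = u := congrArg Prod.snd hv
      refine Fin.cases h0 (fun i => ?_) i
      obtain rfl : i = 0 := Subsingleton.elim (α := Fin 1) _ _
      exact h1
    · exact fun h => ⟨h (0, u) rfl, h (1, u) rfl⟩

end FreeIteration

end CrossEffects

theorem mainTheorem6 (n : ℕ) :
    ∃ (W : Comonad CrossEffects.HoFunctor.{u})
      (e : W.toFunctor ⋙ CrossEffects.forgetHo ≅ CrossEffects.perp n)
      (θ : ∀ k : ℕ, CrossEffects.iterate W.toFunctor k ⋙ CrossEffects.forgetHo ≅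
        (CrossEffects.freeFunctor n).obj (Opposite.op (CrossEffects.finSet k))),
      (∀ F : CrossEffects.HoFunctor.{u}, CrossEffects.forgetHo.map (W.ε.app F) =
        e.hom.app F ≫ (CrossEffects.counit n).app F) ∧
      (∀ F : CrossEffects.HoFunctor.{u},
        CrossEffects.forgetHo.map (W.ε.app F) ≫ (θ 0).hom.app F =
          (θ 1).hom.app F ≫ ((CrossEffects.freeFunctor n).map
            (FintypeCat.homMk (Fin.elim0 : Fin 0 → Fin 1) :
              CrossEffects.finSet 0 ⟶ CrossEffects.finSet 1).op).app F) ∧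
      (∀ F : CrossEffects.HoFunctor.{u},
        CrossEffects.forgetHo.map (W.δ.app F) ≫ (θ 2).hom.app F =
          (θ 1).hom.app F ≫ ((CrossEffects.freeFunctor n).map
            (FintypeCat.homMk (fun _ : Fin 2 => (0 : Fin 1)) :
              CrossEffects.finSet 2 ⟶ CrossEffects.finSet 1).op).app F) := by
  refine ⟨CrossEffects.perpComonad n, Iso.refl _, CrossEffects.iteratePerpIso n, fun F => ?_,
    fun F => ?_, fun F => ?_⟩
  · exact (Category.id_comp _).symm
  · exact CrossEffects.comp_hom_eq_of_inv_comp_eq ((CrossEffects.iteratePerpIso n 1).app F)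
      ((CrossEffects.iteratePerpIso n 0).app F) (CrossEffects.iteratePerpIso_counit F)
  · exact CrossEffects.comp_hom_eq_of_inv_comp_eq ((CrossEffects.iteratePerpIso n 1).app F)
      ((CrossEffects.iteratePerpIso n 2).app F) (CrossEffects.iteratePerpIso_comult F)
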